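/- Let $(V,\omega)$ be a finite-dimensional real symplectic vector space, $\dim V=2p$. The Siegel space $\mathfrak H(V)$ is the set of Hodge structures of $(V,\omega)$, i.e. splittings $V\otimes_{\mathbb R}\mathbb C=V^{1,0}\oplus V^{0,1}$ that are orthogonal for the Hermitian form $\langle z,w\rangle=\frac{\sqrt{-1}}2\,\omega(z,\bar w)$, such that $\langle\cdot,\cdot\rangle$ is positive definite on $V^{1,0}$ and complex conjugation maps $V^{1,0}$ onto $V^{0,1}$. The group $\mathrm{Sp}(V)$ acts on it by $V^{1,0}\oplus V^{0,1}\mapsto\varphi(V^{1,0})\oplus\varphi(V^{0,1})$. A symplectic basis $x_1,\dots,x_p,y_1,\dots,y_p$ of $V$ (one in which $\omega=\sum_i x_i^*\wedge y_i^*$) exists, and any such basis identifies $\mathfrak H(V)$ with the generalized upper half plane $\mathfrak H_p=\{Z\in\mathrm{Mat}_{p\times p}(\mathbb C): Z^{T}=Z,\ \operatorname{Im}Z>0\}$, the matrix $Z$ corresponding to the Hodge structure whose $V^{1,0}$ is spanned by the vectors $\sum_i\overline{Z_{ij}}\,x_i+y_j$ $(1\le j\le p)$. Let $d_{\mathtt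 S}$ be the Riemannian distance on $\mathfrak H(V)\cong\mathfrak H_p$ of the Siegel metric $$g_{\mathtt S}=\operatorname{tr}\bigl(Y^{-1}\,dZ\,Y^{-1}\,\overline{dZ}\bigr),\qquad Y=\operatorname{Im}Z .$$ Then, for every symplectic linear transformation $\varphi\in\mathrm{Sp}(V)$ (and every choice of the symplectic basis), the Siegel translation length $\ell_{\mathtt S}(\varphi)=\inf_{H\in\mathfrak H(V)}d_{\mathtt S}(H,\varphi(H))$ satisfies $$\ell_{\mathtt S}(\varphi)=2\sqrt{\mathbf w(P_\varphi)},$$ where $P_\varphi$ is the characteristic polynomial of $\varphi$ and $\mathbf w(Q)=\sum_{j=1}^d\log^2\max(1,|\lambda_j|)$ for a monic polynomial $Q$ of degree $d$ with complex roots $\lambda_1,\dots,\lambda_d$ (counted with multiplicity). -/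

import Mathlib

open scoped TensorProduct ENNReal Matrix

noncomputable section

namespace SiegelSpace

/-! ### The generalized upper half plane and its Siegel metric -/

/-- The generalized upper half plane of rank `p`: complex symmetric `p × p` matrices whose
(entrywise) imaginary part is positive definite. -/
def upperHalfPlane (p : ℕ) : Set (Matrix (Fin p) (Fin p) ℂ) :=
  {Z | Zᵀ = Z ∧ (Z.map Complex.im).PosDef}

/-- The Riemannian metric tensor `tr (Y⁻¹ dZ Y⁻¹ conj(dZ))`, `Y = Im Z`, at the point `Z`,
evaluated on the tangent vector `ξ` (a complex symmetric matrix; the trace is then a real number).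
`map conj` is the entrywise complex conjugate. -/
def metricTensor {p : ℕ} (Z ξ : Matrix (Fin p) (Fin p) ℂ) : ℝ :=
  let Yinv : Matrix (Fin p) (Fin p) ℂ := ((Z.map Complex.im)⁻¹).map Complex.ofReal
  (Yinv * ξ * Yinv * ξ.map (starRingEnd ℂ)).trace.re

/-- `γ` restricts to a `C¹` curve `[0,1] → upperHalfPlane p` from `Z` to `W`
(smoothness is tested on the matrix entries). -/
structure IsCurve {p : ℕ} (γ : ℝ → Matrix (Fin p) (Fin p) ℂ)
    (Z W : Matrix (Fin p) (Fin p) ℂ) : Prop where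
  contDiffOn : ∀ i j, ContDiffOn ℝ 1 (fun t => γ t i j) (Set.Icc 0 1)
  mem : ∀ t ∈ Set.Icc (0 : ℝ) 1, γ t ∈ upperHalfPlane p
  source : γ 0 = Z
  target : γ 1 = W

/-- The velocity of a curve parametrized by `[0,1]`, taken entrywise (one-sided at the ends). -/
def velocity {p : ℕ} (γ : ℝ → Matrix (Fin p) (Fin p) ℂ) (t : ℝ) : Matrix (Fin p) (Fin p) ℂ :=
  Matrix.of fun i j => derivWithin (fun s => γ s i j) (Set.Icc 0 1) t

/-- The Riemannian length of a curve parametrized by `[0,1]`. -/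
def curveLength {p : ℕ} (γ : ℝ → Matrix (Fin p) (Fin p) ℂ) : ℝ :=
  ∫ t in (0 : ℝ)..1, Real.sqrt (metricTensor (γ t) (velocity γ t))

/-- The Riemannian distance of the Siegel metric on the generalized upper half plane:
the infimum of the lengths of all `C¹` curves joining `Z` to `W`, taken in `[0,∞]`. -/
def upperHalfPlaneDist {p : ℕ} (Z W : Matrix (Fin p) (Fin p) ℂ) : ℝ≥0∞ :=
  ⨅ (γ : ℝ → Matrix (Fin p) (Fin p) ℂ) (_ : IsCurve γ Z W), ENNReal.ofReal (curveLength γ)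

/-! ### Hodge structures on a real symplectic vector space -/

variable {V : Type*} [AddCommGroup V] [Module ℝ V]

/-- Complex conjugation on `V ⊗ ℂ` (written `ℂ ⊗[ℝ] V`). -/
def conj : (ℂ ⊗[ℝ] V) →ₗ[ℝ] (ℂ ⊗[ℝ] V) :=
  LinearMap.rTensor V Complex.conjAe.toLinearMap

/-- The Hermitian form `⟨z, w⟩ = (√-1 / 2) ω(z, conj w)` on `V ⊗ ℂ`,
where `ω` is extended complex bilinearly. -/
def hermitianForm (ω : LinearMap.BilinForm ℝ V) (z w : ℂ ⊗[ℝ] V) : ℂ :=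
  Complex.I / 2 * (LinearMap.BilinForm.baseChange ℂ ω) z (conj w)

/-- A point of the Siegel space of `(V, ω)`: a Hermitian orthogonal splitting
`V ⊗ ℂ = V10 ⊕ V01` such that the Hermitian form is positive definite on `V10` and complex
conjugation maps `V10` onto `V01`. (The Hermitian form takes real values on the diagonal.) -/
@[ext]
structure HodgeStructure (ω : LinearMap.BilinForm ℝ V) where
  V10 : Submodule ℂ (ℂ ⊗[ℝ] V)
  V01 : Submodule ℂ (ℂ ⊗[ℝ] V)
  isCompl : IsCompl V10 V01
  orthogonal : ∀ z ∈ V10, ∀ w ∈ V01, hermitianForm ω z w = 0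
  pos : ∀ z ∈ V10, z ≠ 0 → 0 < (hermitianForm ω z z).re
  conj_image : conj '' (V10 : Set (ℂ ⊗[ℝ] V)) = V01

/-- The group `Sp(V)` of symplectic linear transformations of `(V, ω)`. -/
def Sp (ω : LinearMap.BilinForm ℝ V) : Subgroup (V ≃ₗ[ℝ] V) where
  carrier := {φ | ∀ v w, ω (φ v) (φ w) = ω v w}
  one_mem' := fun _ _ => rfl
  mul_mem' := fun {φ ψ} hφ hψ v w => (hφ (ψ v) (ψ w)).trans (hψ v w)
  inv_mem' := fun {φ} hφ v w => by
    have h := hφ (φ⁻¹ v) (φ⁻¹ w)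
    have e : ∀ u, φ (φ⁻¹ u) = u := fun u => φ.apply_symm_apply u
    rw [e, e] at h
    exact h.symm

variable {ω : LinearMap.BilinForm ℝ V}

/-- The complex linear extension of a real linear automorphism. -/
def complexify (φ : V ≃ₗ[ℝ] V) : (ℂ ⊗[ℝ] V) ≃ₗ[ℂ] (ℂ ⊗[ℝ] V) :=
  LinearEquiv.baseChange ℝ ℂ V V φ

theorem complexify_tmul (φ : V ≃ₗ[ℝ] V) (a : ℂ) (v : V) :
    complexify φ (a ⊗ₜ[ℝ] v) = a ⊗ₜ[ℝ] φ v := rfl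

theorem conj_tmul (a : ℂ) (v : V) :
    conj (a ⊗ₜ[ℝ] v) = (starRingEnd ℂ a) ⊗ₜ[ℝ] v := rfl

theorem conj_complexify (φ : V ≃ₗ[ℝ] V) (z : ℂ ⊗[ℝ] V) :
    conj (complexify φ z) = complexify φ (conj z) := by
  induction z with
  | zero => simp
  | tmul a v => simp only [complexify_tmul, conj_tmul]
  | add x y hx hy => simp only [map_add, hx, hy]

theorem hermitianForm_complexify (φ : Sp ω) (z w : ℂ ⊗[ℝ] V) :
    hermitianForm ω (complexify φ.1 z) (complexify φ.1 w) = hermitianForm ω z w := by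
  unfold hermitianForm
  rw [conj_complexify]
  congr 1
  generalize conj w = w'
  induction z with
  | zero => simp
  | add x y hx hy => simp only [map_add, LinearMap.add_apply, hx, hy]
  | tmul a v =>
    induction w' with
    | zero => simp
    | add x y hx hy => simp only [map_add, hx, hy]
    | tmul b u =>
      simp only [complexify_tmul, LinearMap.BilinForm.baseChange_tmul]
      rw [φ.2 v u]

/-- The action of `Sp(V)` on the Siegel space, taking `V10 ⊕ V01` to `φ(V10) ⊕ φ(V01)`. -/
def act (φ : Sp ω) (H : HodgeStructure ω) : HodgeStructure ω where
  V10 := H.V10.map (complexify φ.1).toLinearMap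
  V01 := H.V01.map (complexify φ.1).toLinearMap
  isCompl := (Submodule.orderIsoMapComap (complexify φ.1)).isCompl H.isCompl
  orthogonal := by
    rintro _ ⟨z, hz, rfl⟩ _ ⟨w, hw, rfl⟩
    exact (hermitianForm_complexify φ z w).trans (H.orthogonal z hz w hw)
  pos := by
    rintro _ ⟨z, hz, rfl⟩ h0
    have hz0 : z ≠ 0 := by
      rintro rfl
      exact h0 (map_zero _)
    have h := H.pos z hz hz0
    rw [← hermitianForm_complexify φ z z] at h
    exact h
  conj_image := by
    ext w
    constructor
    · rintro ⟨_, ⟨z, hz, rfl⟩, rfl⟩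
      refine ⟨conj z, ?_, (conj_complexify φ.1 z).symm⟩
      rw [← H.conj_image]
      exact ⟨z, hz, rfl⟩
    · rintro ⟨u, hu, rfl⟩
      rw [← H.conj_image] at hu
      obtain ⟨z, hz, rfl⟩ := hu
      exact ⟨complexify φ.1 z, ⟨z, hz, rfl⟩, conj_complexify φ.1 z⟩

/-! ### The Siegel metric on the space of Hodge structures -/

/-- A symplectic basis `x₁, …, x_p, y₁, …, y_p` of `(V, ω)`, that is, a basis in which
`ω = x₁* ∧ y₁* + ⋯ + x_p* ∧ y_p*`. The vectors `x i` and `y i` are `basis (Sum.inl i)` and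
`basis (Sum.inr i)`. -/
structure SymplecticBasis (ω : LinearMap.BilinForm ℝ V) (p : ℕ) where
  basis : Module.Basis (Fin p ⊕ Fin p) ℝ V
  apply_inl_inl : ∀ i j, ω (basis (Sum.inl i)) (basis (Sum.inl j)) = 0
  apply_inr_inr : ∀ i j, ω (basis (Sum.inr i)) (basis (Sum.inr j)) = 0
  apply_inl_inr : ∀ i j, ω (basis (Sum.inl i)) (basis (Sum.inr j)) = if i = j then 1 else 0
  apply_inr_inl : ∀ i j, ω (basis (Sum.inr i)) (basis (Sum.inl j)) = if i = j then -1 else 0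

/-- The identification of the generalized upper half plane with the space of Hodge structures
given by a symplectic basis: `Z` corresponds to `H` if `V10` is spanned by the vectors
`∑ i, conj (Z i j) x_i + y_j`, i.e. by the columns of the block matrix `(conj Z; I)`.
In particular `√-1 • I` corresponds to the span of the vectors `x_j + √-1 y_j`, and the action
of a symplectic transformation with blocks `A, B, C, D` becomes `Z ↦ (A Z + B) (C Z + D)⁻¹`. -/
def Corresponds {p : ℕ} (b : SymplecticBasis ω p) (Z : Matrix (Fin p) (Fin p) ℂ)
    (H : HodgeStructure ω) : Prop :=
  H.V10 = Submodule.span ℂ (Set.range fun j : Fin p =>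
    (∑ i, (starRingEnd ℂ (Z i j)) ⊗ₜ[ℝ] b.basis (Sum.inl i)) + 1 ⊗ₜ[ℝ] b.basis (Sum.inr j))

/-- The Siegel distance on the space of Hodge structures, transported from the generalized upper
half plane by a symplectic basis. (For every Hodge structure there is exactly one corresponding
`Z` in the generalized upper half plane, so the infimum selects the unique pair `Z₁`, `Z₂`.) -/
def siegelDist {p : ℕ} (b : SymplecticBasis ω p) (H₁ H₂ : HodgeStructure ω) : ℝ≥0∞ :=
  ⨅ (Z₁ ∈ upperHalfPlane p) (Z₂ ∈ upperHalfPlane p)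
    (_ : Corresponds b Z₁ H₁) (_ : Corresponds b Z₂ H₂), upperHalfPlaneDist Z₁ Z₂

/-- The Siegel translation length of a symplectic transformation. -/
def translationLength {p : ℕ} (b : SymplecticBasis ω p) (φ : Sp ω) : ℝ≥0∞ :=
  ⨅ H : HodgeStructure ω, siegelDist b H (act φ H)

/-! ### The Jensen square sum -/

/-- The Jensen square sum `∑ log² max(1, |λ|)` of a (monic) complex polynomial, over its roots
`λ` counted with multiplicity. -/
def jensenSquareSum (Q : Polynomial ℂ) : ℝ :=
  (Q.roots.map fun l => Real.log (max 1 ‖l‖) ^ 2).sum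

end SiegelSpace

end

noncomputable section

namespace SiegelSpace

/-! ### Triangularization -/

/-! A point Z = X + √-1 Y is encoded by the real positive definite symplectic matrix S = `formMatrix
Z`. With J = `stdForm`, the matrix S J is the complex structure whose √-1-eigenspace is V10, so a
symplectic transformation with matrix M acts by S ↦ M S Mᵀ (`formMatrix_eq_of_corresponds_act`,
`corresponds_act`). The trace metric tr((S⁻¹ dS)²) is twice the Siegel metric
(`exists_hasEntryDeriv_formMatrix`).

Lower bound (`sqrt_sum_log_sq_le_curveLength`). Over ℂ, M is similar to a lower triangular T = B M
B⁻¹ whose diagonal lists the eigenvalues. A curve from S to M S Mᵀ becomes a curve P = B S Bᴴ ending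
at T P(0) Tᴴ. Put c_k = 2 log |T_kk|. The Busemann function ∑ c_k log(k-th pivot of P) has Lipschitz
constant |c| and grows by exactly |c|² between the ends, so the curve has length at least |c| in the
trace metric.

Upper bound (`HasNormalForm.exists_curve`). The infimum need not be attained, so a limit is taken.
Splitting off invariant isotropic or symplectic subspaces one after another gives a symplectic basis
with integer weights in which M is block triangular and its block diagonal part L satisfies L Lᵀ =
diag(r², r⁻²) (`existsNormalForm_of_finrank`). Conjugating by the symplectic scaling s^w and letting
s → ∞ leaves only L, so the conjugate moves the base point √-1 to a point near √-1 r². Explicit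
curves joining the two have length close to √(∑ (2 log r_i)²), and symplectic matrices carry them
isometrically to the given basis.

The eigenvalues have absolute values r_i and r_i⁻¹. Hence |c|² = 2 ∑ (2 log r_i)², where the factor
2 is the one between the two metrics, and ∑ log² r_i is the Jensen square sum. The two bounds agree.
-/

theorem exists_basis_lowerTriangular {K : Type*} [Field K] [IsAlgClosed K] (n : ℕ) :
    ∀ {V : Type*} [AddCommGroup V] [Module K V] [FiniteDimensional K V] (f : Module.End K V),
      Module.finrank K V = n →
      ∃ b : Module.Basis (Fin n) K V, ∀ i j, i < j → b.repr (f (b j)) i = 0 := by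
  induction n with
  | zero =>
    intro V _ _ _ f h
    exact ⟨Module.finBasisOfFinrankEq K V h, fun i => i.elim0⟩
  | succ n ih =>
    intro V _ _ _ f h
    have hnt : Nontrivial V := Module.nontrivial_of_finrank_pos (R := K) (by omega)
    obtain ⟨μ, hμ⟩ := Module.End.exists_eigenvalue f
    -- The range of f - μ is proper, so some nonzero functional g kills it. Then g ∘ f = μ g, and
    -- ker g is an invariant hyperplane. Placing a vector with g y = 1 in front of a basis of ker g
    -- yields a lower, not upper, triangular matrix.
    have hrange : LinearMap.range (f - algebraMap K (Module.End K V) μ) < ⊤ := by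
      rw [lt_top_iff_ne_top]
      intro htop
      have hinj := LinearMap.injective_iff_surjective.2 (LinearMap.range_eq_top.1 htop)
      obtain ⟨v, hv⟩ := hμ.exists_hasEigenvector
      refine hv.2 (hinj ?_)
      simp [hv.apply_eq_smul, Module.algebraMap_end_apply]
    obtain ⟨g, hg0, hg⟩ := Submodule.exists_le_ker_of_lt_top _ hrange
    have hgf : ∀ v, g (f v) = μ * g v := by
      intro v
      have h1 := hg (LinearMap.mem_range_self _ v)
      simp only [LinearMap.mem_ker, LinearMap.sub_apply, Module.algebraMap_end_apply, map_sub,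
        map_smul, smul_eq_mul] at h1
      exact sub_eq_zero.1 h1
    have hfW : ∀ v ∈ LinearMap.ker g, f v ∈ LinearMap.ker g := by
      intro v hv
      rw [LinearMap.mem_ker] at hv ⊢
      rw [hgf, hv, mul_zero]
    have hgs : LinearMap.range g = ⊤ :=
      LinearMap.range_eq_top.2 (LinearMap.surjective hg0)
    have hW : Module.finrank K (LinearMap.ker g) = n := by
      have h1 := LinearMap.finrank_range_add_finrank_ker g
      rw [hgs, finrank_top, Module.finrank_self, h] at h1
      omega
    obtain ⟨b, hb⟩ := ih (f.restrict hfW) hW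
    obtain ⟨y, hy⟩ := LinearMap.surjective hg0 1
    let B : Module.Basis (Fin (n + 1)) K V := Module.Basis.mkFinCons y b
      (by
        intro c x hx hc
        have h1 : g (c • y + x) = 0 := by rw [hc, map_zero]
        rw [map_add, map_smul, hy, LinearMap.mem_ker.1 hx] at h1
        simpa using h1)
      (by
        intro z
        refine ⟨-g z, ?_⟩
        rw [LinearMap.mem_ker, map_add, map_smul, hy]
        simp)
    have hBs : ∀ i : Fin n, B i.succ = (b i : V) := fun i => by
      simp [B]
    have hBr : ∀ w : LinearMap.ker g, B.repr (w : V) 0 = 0 ∧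
        ∀ i : Fin n, B.repr (w : V) i.succ = b.repr w i := by
      intro w
      have hw : (w : V) = ∑ i : Fin (n + 1), (Fin.cons 0 (b.repr w) : Fin (n + 1) → K) i • B i := by
        rw [Fin.sum_univ_succ]
        simp only [Fin.cons_zero, zero_smul, zero_add, Fin.cons_succ, hBs]
        conv_lhs => rw [← b.sum_repr w]
        exact map_sum (LinearMap.ker g).subtype _ _
      have h2 := fun i => congrFun (congrArg (fun v => (B.repr v : Fin (n + 1) → K)) hw) i
      simp only [Module.Basis.repr_sum_self] at h2
      exact ⟨by simpa using h2 0, fun i => by simpa using h2 i.succ⟩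
    refine ⟨B, fun i j hij => ?_⟩
    obtain ⟨j, rfl⟩ := Fin.exists_succ_eq.2 (Fin.ne_zero_of_lt hij)
    have h3 : f (B j.succ) = ((f.restrict hfW (b j) : LinearMap.ker g) : V) := by
      rw [hBs]; rfl
    rw [h3]
    refine Fin.cases ?_ (fun i hij => ?_) i hij
    · intro _; exact (hBr _).1
    · rw [(hBr _).2]
      exact hb i j (Fin.succ_lt_succ_iff.1 hij)

theorem roots_finset_prod_X_sub_C {R α : Type*} [CommRing R] [IsDomain R] (s : Finset α)
    (f : α → R) :
    (∏ a ∈ s, (Polynomial.X - Polynomial.C (f a))).roots = s.val.map f := by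
  rw [← Polynomial.roots_multiset_prod_X_sub_C (s.val.map f), Multiset.map_map]
  rfl

theorem roots_charpoly_of_lowerTriangular {n : ℕ} (T : Matrix (Fin n) (Fin n) ℂ)
    (hT : ∀ i j, i < j → T i j = 0) :
    T.charpoly.roots = Finset.univ.val.map (fun i => T i i) := by
  rw [← Matrix.charpoly_transpose, Matrix.charpoly_of_isUpperTriangular]
  · simp only [Matrix.transpose_apply]
    exact roots_finset_prod_X_sub_C _ _
  · intro i j hij
    exact hT j i hij

/-- Every complex matrix is similar to a lower triangular one, whose diagonal lists the roots of
the characteristic polynomial. -/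
theorem exists_lowerTriangular {ι : Type*} [Fintype ι] [DecidableEq ι] (M : Matrix ι ι ℂ) :
    ∃ (n : ℕ) (B : Matrix (Fin n) ι ℂ) (B' : Matrix ι (Fin n) ℂ),
      B * B' = 1 ∧ B' * B = 1 ∧ (∀ i j, i < j → (B * M * B') i j = 0) ∧
      M.charpoly.roots = Finset.univ.val.map (fun i => (B * M * B') i i) := by
  obtain ⟨b, hb⟩ := exists_basis_lowerTriangular _ (Matrix.toLin' M) rfl
  let e := Pi.basisFun ℂ ι
  have key : b.toMatrix e * M * e.toMatrix b = LinearMap.toMatrix b b (Matrix.toLin' M) := by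
    have h := basis_toMatrix_mul_linearMap_toMatrix_mul_basis_toMatrix b e b e (Matrix.toLin' M)
    rw [← h]
    congr 2
    rw [← Matrix.toLin_eq_toLin']
    exact (LinearMap.toMatrix_toLin e e M).symm
  refine ⟨_, b.toMatrix e, e.toMatrix b, b.toMatrix_mul_toMatrix_flip e,
    e.toMatrix_mul_toMatrix_flip b, ?_, ?_⟩
  · intro i j hij
    rw [key, LinearMap.toMatrix_apply]
    exact hb i j hij
  · rw [key]
    have h1 : M.charpoly = (LinearMap.toMatrix b b (Matrix.toLin' M)).charpoly := by
      rw [LinearMap.charpoly_toMatrix, ← LinearMap.charpoly_toMatrix _ e]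
      congr 1
      rw [← Matrix.toLin_eq_toLin']
      exact (LinearMap.toMatrix_toLin e e M).symm
    rw [h1]
    refine roots_charpoly_of_lowerTriangular _ fun i j hij => ?_
    rw [LinearMap.toMatrix_apply]
    exact hb i j hij

/-! ### Entrywise calculus of matrix valued functions -/

section Calculus

variable {l m n : Type*} {𝕂 : Type*} [RCLike 𝕂]

/-- `A` has the derivative `A'` at `t`, entry by entry. -/
def HasEntryDeriv (A : ℝ → Matrix m n 𝕂) (A' : Matrix m n 𝕂) (t : ℝ) : Prop :=
  ∀ i j, HasDerivAt (fun s => A s i j) (A' i j) t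

theorem hasEntryDeriv_const (A : Matrix m n 𝕂) (t : ℝ) : HasEntryDeriv (fun _ => A) 0 t :=
  fun i j => hasDerivAt_const t (A i j)

theorem HasEntryDeriv.mul [Fintype m] {A : ℝ → Matrix l m 𝕂} {B : ℝ → Matrix m n 𝕂}
    {A' : Matrix l m 𝕂} {B' : Matrix m n 𝕂} {t : ℝ} (hA : HasEntryDeriv A A' t)
    (hB : HasEntryDeriv B B' t) :
    HasEntryDeriv (fun s => A s * B s) (A' * B t + A t * B') t := by
  intro i j
  simp only [Matrix.mul_apply, Matrix.add_apply, ← Finset.sum_add_distrib]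
  exact HasDerivAt.fun_sum fun k _ => (hA i k).mul (hB k j)

theorem HasEntryDeriv.const_mul [Fintype m] {B : ℝ → Matrix m n 𝕂} {B' : Matrix m n 𝕂} {t : ℝ}
    (A : Matrix l m 𝕂) (hB : HasEntryDeriv B B' t) :
    HasEntryDeriv (fun s => A * B s) (A * B') t := by
  simpa using (hasEntryDeriv_const A t).mul hB

theorem HasEntryDeriv.mul_const [Fintype m] {A : ℝ → Matrix l m 𝕂} {A' : Matrix l m 𝕂} {t : ℝ}
    (hA : HasEntryDeriv A A' t) (B : Matrix m n 𝕂) :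
    HasEntryDeriv (fun s => A s * B) (A' * B) t := by
  simpa using hA.mul (hasEntryDeriv_const B t)

theorem HasEntryDeriv.add {A B : ℝ → Matrix m n 𝕂} {A' B' : Matrix m n 𝕂} {t : ℝ}
    (hA : HasEntryDeriv A A' t) (hB : HasEntryDeriv B B' t) :
    HasEntryDeriv (fun s => A s + B s) (A' + B') t :=
  fun i j => (hA i j).add (hB i j)

variable [Fintype n] [DecidableEq n]

/-- The derivative of the determinant at the identity matrix is the trace. -/
theorem HasEntryDeriv.det_of_eq_one {A : ℝ → Matrix n n 𝕂} {A' : Matrix n n 𝕂} {t : ℝ}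
    (hA : HasEntryDeriv A A' t) (h1 : A t = 1) :
    HasDerivAt (fun s => (A s).det) A'.trace t := by
  simp only [Matrix.det_apply]
  have h2 : HasDerivAt (fun s => ∑ σ : Equiv.Perm n, Equiv.Perm.sign σ • ∏ i, A s (σ i) i)
      (∑ σ : Equiv.Perm n, Equiv.Perm.sign σ •
        ∑ i, (∏ j ∈ Finset.univ.erase i, A t (σ j) j) • A' (σ i) i) t :=
    HasDerivAt.fun_sum fun σ _ =>
      (HasDerivAt.fun_finsetProd fun i _ => hA (σ i) i).const_smul (Equiv.Perm.sign σ)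
  convert h2 using 1
  rw [Finset.sum_eq_single 1]
  · simp only [Equiv.Perm.sign_one, one_smul, Equiv.Perm.one_apply, h1, Matrix.one_apply_eq,
      Finset.prod_const_one, Matrix.trace, Matrix.diag_apply]
  · intro σ _ hσ
    rw [Finset.sum_eq_zero, smul_zero]
    intro i _
    -- A nontrivial permutation cannot move only one point, so even with the factor i removed the
    -- product keeps an off-diagonal entry of the identity matrix.
    have : ∃ j, j ≠ i ∧ σ j ≠ j := by
      by_contra! hcon
      apply hσ
      ext j
      by_cases hj : j = i
      · subst hj
        by_contra hne
        exact hne (σ.injective (hcon _ hne))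
      · exact hcon j hj
    obtain ⟨j, hji, hj⟩ := this
    rw [Finset.prod_eq_zero (Finset.mem_erase.2 ⟨hji, Finset.mem_univ j⟩), zero_smul]
    rw [h1, Matrix.one_apply_ne hj]
  · simp

end Calculus

/-! ### Leading principal minors -/

section Minors

variable {n : ℕ}

/-- The coordinate projection onto the first `k` coordinates. -/
def leadProj (n k : ℕ) : Matrix (Fin n) (Fin n) ℂ :=
  Matrix.diagonal fun i => if (i : ℕ) < k then 1 else 0

/-- The matrix that agrees with `A` on the leading `k × k` block and is the identity elsewhere. -/
def truncation (k : ℕ) (A : Matrix (Fin n) (Fin n) ℂ) : Matrix (Fin n) (Fin n) ℂ :=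
  leadProj n k * A * leadProj n k + (1 - leadProj n k)

theorem leadProj_mul_self (k : ℕ) : leadProj n k * leadProj n k = leadProj n k := by
  rw [leadProj, Matrix.diagonal_mul_diagonal]
  congr 1
  ext i
  split_ifs <;> simp

theorem truncation_apply (k : ℕ) (A : Matrix (Fin n) (Fin n) ℂ) (i j : Fin n) :
    truncation k A i j = if (i : ℕ) < k ∧ (j : ℕ) < k then A i j else if i = j then 1 else 0 := by
  rw [truncation, leadProj, Matrix.add_apply, Matrix.mul_diagonal, Matrix.diagonal_mul,
    Matrix.sub_apply, Matrix.one_apply, Matrix.diagonal_apply]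
  by_cases hij : i = j
  · subst hij
    by_cases hi : (i : ℕ) < k <;> simp [hi]
  · by_cases hi : (i : ℕ) < k <;> by_cases hj : (j : ℕ) < k <;> simp [hi, hj, hij]

theorem truncation_one (k : ℕ) : truncation k (1 : Matrix (Fin n) (Fin n) ℂ) = 1 := by
  rw [truncation, mul_one, leadProj_mul_self]
  abel

theorem leadProj_mul_of_lowerTriangular (k : ℕ) {L : Matrix (Fin n) (Fin n) ℂ}
    (hL : ∀ i j, i < j → L i j = 0) : leadProj n k * L = leadProj n k * L * leadProj n k := by
  ext i j
  rw [leadProj, Matrix.mul_diagonal, Matrix.diagonal_mul]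
  by_cases hi : (i : ℕ) < k
  · by_cases hj : (j : ℕ) < k
    · simp [hi, hj]
    · rw [hL i j (Fin.lt_def.2 (by omega))]
      simp
  · simp [hi]

theorem leadProj_conjTranspose (k : ℕ) : (leadProj n k)ᴴ = leadProj n k := by
  rw [leadProj, Matrix.diagonal_conjTranspose]
  congr 1
  ext i
  simp only [Pi.star_apply]
  split_ifs <;> simp

theorem truncation_conjTranspose (k : ℕ) (A : Matrix (Fin n) (Fin n) ℂ) :
    truncation k Aᴴ = (truncation k A)ᴴ := by
  simp only [truncation, Matrix.conjTranspose_add, Matrix.conjTranspose_sub,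
    Matrix.conjTranspose_mul, leadProj_conjTranspose, Matrix.conjTranspose_one, Matrix.mul_assoc]

/-- The first k rows of a lower triangular L involve only its first k columns, that is E L = E L E
for the projection E. The leading block of L A therefore sees only leading blocks; A is arbitrary.
-/
theorem truncation_lowerTriangular_mul (k : ℕ) {L : Matrix (Fin n) (Fin n) ℂ}
    (hL : ∀ i j, i < j → L i j = 0) (A : Matrix (Fin n) (Fin n) ℂ) :
    truncation k (L * A) = truncation k L * truncation k A := by
  have h1 := leadProj_mul_of_lowerTriangular k hL
  have h2 := leadProj_mul_self (n := n) k
  unfold truncation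
  generalize leadProj n k = E at *
  have h3 : E * L * E * (1 - E) = 0 := by rw [mul_sub, mul_one, mul_assoc _ E E, h2, sub_self]
  have h4 : (1 - E) * (E * A * E) = 0 := by
    rw [← mul_assoc, ← mul_assoc, sub_mul, one_mul, h2, sub_self, zero_mul, zero_mul]
  have h5 : (1 - E) * (1 - E) = 1 - E := by
    rw [sub_mul, one_mul, mul_sub, mul_one, h2, sub_self, sub_zero]
  have h6 : E * L * E * (E * A * E) = E * (L * A) * E := by
    rw [← h1]
    calc E * L * (E * A * E) = (E * L * E) * A * E := by simp only [mul_assoc]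
      _ = E * (L * A) * E := by rw [← h1]; simp only [mul_assoc]
  rw [add_mul, mul_add, mul_add, h3, h4, h5, h6, add_zero, zero_add]

theorem truncation_conj (k : ℕ) {L : Matrix (Fin n) (Fin n) ℂ}
    (hL : ∀ i j, i < j → L i j = 0) (A : Matrix (Fin n) (Fin n) ℂ) :
    truncation k (L * A * Lᴴ) = truncation k L * truncation k A * (truncation k L)ᴴ := by
  rw [mul_assoc, truncation_lowerTriangular_mul k hL, mul_assoc]
  congr 1
  -- The right factor Lᴴ is upper triangular; its case is the adjoint of the left one.
  have h := truncation_lowerTriangular_mul k hL Aᴴ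
  have h2 := congrArg Matrix.conjTranspose h
  rwa [← truncation_conjTranspose, Matrix.conjTranspose_mul, Matrix.conjTranspose_conjTranspose,
    Matrix.conjTranspose_mul, truncation_conjTranspose, Matrix.conjTranspose_conjTranspose] at h2

theorem det_truncation_lowerTriangular (k : ℕ) {L : Matrix (Fin n) (Fin n) ℂ}
    (hL : ∀ i j, i < j → L i j = 0) :
    (truncation k L).det = ∏ i : Fin n, if (i : ℕ) < k then L i i else 1 := by
  rw [Matrix.det_of_isLowerTriangular]
  · refine Finset.prod_congr rfl fun i _ => ?_
    rw [truncation_apply]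
    simp
  · intro i j hij
    have hij : i < j := hij
    rw [truncation_apply, hL i j hij]
    simp [hij.ne]

/-- The logarithm of the absolute value of the leading principal minor of size `k`. -/
def logMinor (k : ℕ) (A : Matrix (Fin n) (Fin n) ℂ) : ℝ := Real.log ‖(truncation k A).det‖

theorem logMinor_conj (k : ℕ) {L : Matrix (Fin n) (Fin n) ℂ} (hL : ∀ i j, i < j → L i j = 0)
    (hL0 : ∀ i, L i i ≠ 0) {A : Matrix (Fin n) (Fin n) ℂ} (hA : (truncation k A).det ≠ 0) :
    logMinor k (L * A * Lᴴ) = 2 * logMinor k L + logMinor k A := by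
  have h1 : (truncation k L).det ≠ 0 := by
    rw [det_truncation_lowerTriangular k hL]
    refine Finset.prod_ne_zero_iff.2 fun i _ => ?_
    split_ifs
    exacts [hL0 i, one_ne_zero]
  unfold logMinor
  rw [truncation_conj k hL, Matrix.det_mul, Matrix.det_mul, Matrix.det_conjTranspose, norm_mul,
    norm_mul, norm_star, Real.log_mul, Real.log_mul]
  · ring
  all_goals simp [h1, hA]

theorem logMinor_succ_sub (k : Fin n) {L : Matrix (Fin n) (Fin n) ℂ}
    (hL : ∀ i j, i < j → L i j = 0) (hL0 : ∀ i, L i i ≠ 0) :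
    logMinor (k + 1) L - logMinor k L = Real.log ‖L k k‖ := by
  unfold logMinor
  have h1 : ∀ k : ℕ, (truncation k L).det ≠ 0 := by
    intro k
    rw [det_truncation_lowerTriangular k hL]
    refine Finset.prod_ne_zero_iff.2 fun i _ => ?_
    split_ifs
    exacts [hL0 i, one_ne_zero]
  have h2 : (truncation (k + 1) L).det = (truncation k L).det * L k k := by
    simp only [det_truncation_lowerTriangular _ hL]
    rw [← Finset.mul_prod_erase _ _ (Finset.mem_univ k),
      ← Finset.mul_prod_erase (Finset.univ) (fun i : Fin n => if (i : ℕ) < k then L i i else 1)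
        (Finset.mem_univ k)]
    simp only [lt_add_iff_pos_right, zero_lt_one, if_true, lt_irrefl, if_false, one_mul]
    rw [mul_comm]
    congr 1
    refine Finset.prod_congr rfl fun i hi => ?_
    have hne : (i : ℕ) ≠ k := fun h => (Finset.mem_erase.1 hi).1 (Fin.ext h)
    congr 1
    simp only [eq_iff_iff]
    omega
  rw [h2, norm_mul, Real.log_mul (norm_ne_zero_iff.2 (h1 k)) (norm_ne_zero_iff.2 (hL0 k))]
  ring

open scoped ComplexOrder in
/-- A positive definite matrix is brought to the identity by a lower triangular change of basis. -/
theorem exists_lowerTriangular_conj_eq_one {P : Matrix (Fin n) (Fin n) ℂ} (hP : P.PosDef) :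
    ∃ A : Matrix (Fin n) (Fin n) ℂ, (∀ i j, i < j → A i j = 0) ∧ (∀ i, A i i ≠ 0) ∧
      A * P * Aᴴ = 1 := by
  have hLt : ∀ i j, i < j → LDL.lowerInv hP i j = 0 := fun i j => LDL.lowerInv_triangular hP
  have hdiag := LDL.diag_eq_lowerInv_conj hP
  set L := LDL.lowerInv hP with hL
  have hu : IsUnit L := by
    rw [hL]; exact isUnit_of_invertible _
  have hD : (L * P * Lᴴ).PosDef :=
    hP.mul_mul_conjTranspose_same (Matrix.vecMul_injective_of_isUnit hu)
  rw [← hdiag, LDL.diag] at hD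
  have hd : ∀ i, 0 < LDL.diagEntries hP i := Matrix.posDef_diagonal_iff.1 hD
  set d := LDL.diagEntries hP with hdd
  have hdr : ∀ i, 0 < (d i).re ∧ (((d i).re : ℝ) : ℂ) = d i := fun i => by
    have := Complex.pos_iff.1 (hd i)
    exact ⟨this.1, Complex.ext (by simp) (by simpa using this.2)⟩
  -- The LDL decomposition diagonalizes P with positive entries d; scaling by d^(-1/2) then gives
  -- the identity.
  let s : Fin n → ℂ := fun i => ((Real.sqrt (d i).re)⁻¹ : ℝ)
  have hs : ∀ i, s i ≠ 0 := fun i => by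
    simp only [s, ne_eq, Complex.ofReal_eq_zero, inv_eq_zero]
    exact (Real.sqrt_pos.2 (hdr i).1).ne'
  have hLii : ∀ i, L i i ≠ 0 := by
    have hdet : L.det ≠ 0 := ((Matrix.isUnit_iff_isUnit_det _).1 hu).ne_zero
    rw [Matrix.det_of_isLowerTriangular L (fun i j hij => hLt i j hij)] at hdet
    exact fun i => Finset.prod_ne_zero_iff.1 hdet i (Finset.mem_univ i)
  refine ⟨Matrix.diagonal s * L, ?_, ?_, ?_⟩
  · intro i j hij
    rw [Matrix.diagonal_mul, hLt i j hij, mul_zero]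
  · intro i
    rw [Matrix.diagonal_mul]
    exact mul_ne_zero (hs i) (hLii i)
  · rw [Matrix.conjTranspose_mul, Matrix.diagonal_conjTranspose]
    have : Matrix.diagonal s * L * P * (Lᴴ * Matrix.diagonal (star s)) =
        Matrix.diagonal s * (L * P * Lᴴ) * Matrix.diagonal (star s) := by
      simp only [mul_assoc]
    rw [this, ← hdiag, LDL.diag, Matrix.diagonal_mul_diagonal, Matrix.diagonal_mul_diagonal,
      ← Matrix.diagonal_one]
    congr 1
    ext i
    simp only [Pi.star_apply, s, Complex.star_def, Complex.conj_ofReal, ← hdd]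
    rw [← (hdr i).2, ← Complex.ofReal_mul, ← Complex.ofReal_mul, Complex.ofReal_eq_one]
    have h1 := Real.mul_self_sqrt (hdr i).1.le
    have h2 := (Real.sqrt_pos.2 (hdr i).1).ne'
    simp only [Complex.ofReal_re]
    field_simp
    linarith

open scoped ComplexOrder in
-- Truncating A P Aᴴ = 1 with A lower triangular exhibits the minor of P as a factor of 1. This
-- keeps the logarithms in `logMinor` away from zero.
theorem det_truncation_ne_zero_of_posDef {P : Matrix (Fin n) (Fin n) ℂ} (hP : P.PosDef) (k : ℕ) :
    (truncation k P).det ≠ 0 := by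
  obtain ⟨A, hA, -, hA1⟩ := exists_lowerTriangular_conj_eq_one hP
  have h := congrArg Matrix.det (truncation_conj k hA P)
  rw [hA1, truncation_one, Matrix.det_one, Matrix.det_mul, Matrix.det_mul] at h
  intro h0
  rw [h0, mul_zero, zero_mul] at h
  exact one_ne_zero h

end Minors

/-! ### Length of paths of positive definite matrices -/

section PosDefPaths

variable {n : ℕ}

open scoped ComplexOrder

/-- A weighted sum of the logarithms of the pivots of `P`: a Busemann function on the space of
positive definite matrices. -/
def busemann (c : Fin n → ℝ) (P : Matrix (Fin n) (Fin n) ℂ) : ℝ :=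
  ∑ k, c k * (logMinor (k + 1) P - logMinor k P)

/-- Each pivot is multiplied by |L_kk|², so a lower triangular congruence shifts the function by a
constant. This is used twice: to reduce derivatives to the point P = 1, and to measure the
displacement caused by T. -/
theorem busemann_conj (c : Fin n → ℝ) {L : Matrix (Fin n) (Fin n) ℂ}
    (hL : ∀ i j, i < j → L i j = 0) (hL0 : ∀ i, L i i ≠ 0) {P : Matrix (Fin n) (Fin n) ℂ}
    (hP : ∀ k, (truncation k P).det ≠ 0) :
    busemann c (L * P * Lᴴ) = ∑ k, c k * (2 * Real.log ‖L k k‖) + busemann c P := by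
  unfold busemann
  rw [← Finset.sum_add_distrib]
  refine Finset.sum_congr rfl fun k _ => ?_
  rw [logMinor_conj _ hL hL0 (hP _), logMinor_conj _ hL hL0 (hP _), ← logMinor_succ_sub k hL hL0]
  ring

theorem HasEntryDeriv.truncation {P : ℝ → Matrix (Fin n) (Fin n) ℂ}
    {Q : Matrix (Fin n) (Fin n) ℂ} {t : ℝ} (hP : HasEntryDeriv P Q t) (k : ℕ) :
    HasEntryDeriv (fun s => truncation k (P s)) (leadProj n k * Q * leadProj n k) t := by
  have h := ((hP.const_mul (leadProj n k)).mul_const (leadProj n k)).add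
    (hasEntryDeriv_const (1 - leadProj n k) t)
  simpa [SiegelSpace.truncation] using h

theorem trace_leadProj_conj (k : ℕ) (Q : Matrix (Fin n) (Fin n) ℂ) :
    (leadProj n k * Q * leadProj n k).trace = ∑ i : Fin n, if (i : ℕ) < k then Q i i else 0 := by
  rw [Matrix.trace]
  refine Finset.sum_congr rfl fun i _ => ?_
  rw [Matrix.diag_apply, leadProj, Matrix.mul_diagonal, Matrix.diagonal_mul]
  split_ifs <;> simp

/-- Here log |det| is the real part of the complex logarithm, which is differentiable near det = 1;
the derivative of det at the identity is the trace of the leading block. -/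
theorem hasDerivAt_logMinor_of_eq_one {P : ℝ → Matrix (Fin n) (Fin n) ℂ}
    {Q : Matrix (Fin n) (Fin n) ℂ} {t : ℝ} (hP : HasEntryDeriv P Q t) (h1 : P t = 1) (k : ℕ) :
    HasDerivAt (fun s => logMinor k (P s))
      (∑ i : Fin n, if (i : ℕ) < k then (Q i i).re else 0) t := by
  have htr : truncation k (P t) = 1 := by rw [h1, truncation_one]
  have hd := (hP.truncation k).det_of_eq_one htr
  have hdet : (truncation k (P t)).det = 1 := by rw [htr, Matrix.det_one]
  have hlog := hd.clog_real (by rw [hdet]; exact Complex.one_mem_slitPlane)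
  rw [hdet, div_one, trace_leadProj_conj] at hlog
  have hre := Complex.reCLM.hasFDerivAt.comp_hasDerivAt t hlog
  have hsum : Complex.reCLM (∑ i : Fin n, if (i : ℕ) < k then Q i i else 0) =
      ∑ i : Fin n, if (i : ℕ) < k then (Q i i).re else 0 := by
    simp only [Complex.reCLM_apply, Complex.re_sum]
    refine Finset.sum_congr rfl fun i _ => ?_
    split_ifs <;> simp
  rw [hsum] at hre
  exact hre.congr_of_eventuallyEq (Filter.Eventually.of_forall fun s => (Complex.log_re _).symm)

theorem hasDerivAt_busemann_of_eq_one (c : Fin n → ℝ) {P : ℝ → Matrix (Fin n) (Fin n) ℂ}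
    {Q : Matrix (Fin n) (Fin n) ℂ} {t : ℝ} (hP : HasEntryDeriv P Q t) (h1 : P t = 1) :
    HasDerivAt (fun s => busemann c (P s)) (∑ k, c k * (Q k k).re) t := by
  have h : HasDerivAt (fun s => busemann c (P s)) (∑ k : Fin n, c k *
      ((∑ i : Fin n, if (i : ℕ) < k + 1 then (Q i i).re else 0) -
        ∑ i : Fin n, if (i : ℕ) < k then (Q i i).re else 0)) t :=
    HasDerivAt.fun_sum fun k _ => ((hasDerivAt_logMinor_of_eq_one hP h1 _).sub
      (hasDerivAt_logMinor_of_eq_one hP h1 _)).const_mul (c k)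
  convert h using 1
  refine Finset.sum_congr rfl fun k _ => ?_
  congr 1
  -- The difference of the partial traces over i < k + 1 and i < k is the single entry at k.
  rw [← Finset.sum_sub_distrib, Finset.sum_eq_single k]
  · simp
  · intro i _ hik
    have hne : (i : ℕ) ≠ k := fun h => hik (Fin.ext h)
    by_cases hlt : (i : ℕ) < k
    · simp [hlt, show (i : ℕ) < k + 1 by omega]
    · simp [hlt, show ¬ (i : ℕ) < k + 1 by omega]
  · simp

/-- The diagonal of a Hermitian matrix is dominated by its Frobenius norm. -/
theorem sum_mul_diag_le (c : Fin n → ℝ) {R : Matrix (Fin n) (Fin n) ℂ} (hR : R.IsHermitian) :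
    ∑ k, c k * (R k k).re ≤ √(∑ k, c k ^ 2) * √(R * R).trace.re := by
  have h1 : ∑ k, (R k k).re ^ 2 ≤ (R * R).trace.re := by
    rw [Matrix.trace, Complex.re_sum]
    refine Finset.sum_le_sum fun k _ => ?_
    rw [Matrix.diag_apply, Matrix.mul_apply, Complex.re_sum]
    have h2 : ∀ j, (R k j * R j k).re = ‖R k j‖ ^ 2 := fun j => by
      rw [← hR.apply j k, Complex.star_def, Complex.mul_conj, Complex.ofReal_re,
        Complex.normSq_eq_norm_sq]
    simp only [h2]
    calc (R k k).re ^ 2 ≤ ‖R k k‖ ^ 2 := by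
          rw [← sq_abs (R k k).re]
          exact pow_le_pow_left₀ (abs_nonneg _) (Complex.abs_re_le_norm _) 2
      _ ≤ _ := Finset.single_le_sum (f := fun j => ‖R k j‖ ^ 2) (fun j _ => sq_nonneg _)
          (Finset.mem_univ k)
  refine (Real.sum_mul_le_sqrt_mul_sqrt Finset.univ c fun k => (R k k).re).trans ?_
  gcongr

/-- The Busemann function is Lipschitz for the metric `tr ((P⁻¹ dP)²)`. -/
theorem exists_hasDerivAt_busemann (c : Fin n → ℝ) {P : ℝ → Matrix (Fin n) (Fin n) ℂ}
    {Q : Matrix (Fin n) (Fin n) ℂ} {t : ℝ} (hP : HasEntryDeriv P Q t) (hQ : Q.IsHermitian)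
    (hpos : ∀ᶠ s in nhds t, (P s).PosDef) :
    ∃ d, HasDerivAt (fun s => busemann c (P s)) d t ∧
      d ≤ √(∑ k, c k ^ 2) * √((P t)⁻¹ * Q * (P t)⁻¹ * Q).trace.re := by
  -- A fixed A normalizes the path at the one time t; along A P Aᴴ the Busemann function differs
  -- from the original by a constant, so the derivative can be read off at the identity.
  obtain ⟨A, hA, hA0, hA1⟩ := exists_lowerTriangular_conj_eq_one hpos.self_of_nhds
  have h1 := hasDerivAt_busemann_of_eq_one c ((hP.const_mul A).mul_const Aᴴ) hA1
  refine ⟨∑ k, c k * ((A * Q * Aᴴ) k k).re, ?_, ?_⟩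
  · have h2 := h1.sub_const (∑ k, c k * (2 * Real.log ‖A k k‖))
    refine h2.congr_of_eventuallyEq ?_
    filter_upwards [hpos] with s hs
    rw [busemann_conj c hA hA0 fun k => det_truncation_ne_zero_of_posDef hs k]
    ring
  · have hR : (A * Q * Aᴴ).IsHermitian := by
      rw [Matrix.IsHermitian, Matrix.conjTranspose_mul, Matrix.conjTranspose_mul,
        Matrix.conjTranspose_conjTranspose, hQ.eq, Matrix.mul_assoc]
    refine (sum_mul_diag_le c hR).trans_eq ?_
    congr 3
    -- With P⁻¹ = Aᴴ A, the squared Frobenius norm of A Q Aᴴ is tr(P⁻¹ Q P⁻¹ Q) by cyclicity of the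
    -- trace.
    have hinv : (P t)⁻¹ = Aᴴ * A := by
      refine Matrix.inv_eq_left_inv ?_
      rw [mul_assoc]
      have : Aᴴ = (A * P t)⁻¹ := (Matrix.inv_eq_right_inv hA1).symm
      rw [this]
      refine Matrix.nonsing_inv_mul _ ?_
      rw [← Matrix.isUnit_iff_isUnit_det]
      exact IsUnit.of_mul_eq_one _ hA1
    rw [hinv]
    calc (A * Q * Aᴴ * (A * Q * Aᴴ)).trace = ((A * Q * Aᴴ * A * Q) * Aᴴ).trace := by
          simp only [mul_assoc]
      _ = _ := by rw [Matrix.trace_mul_comm]; simp only [mul_assoc]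

theorem continuous_det_truncation (k : ℕ) :
    Continuous fun A : Matrix (Fin n) (Fin n) ℂ => (truncation k A).det := by
  unfold truncation
  fun_prop

theorem continuousOn_busemann (c : Fin n → ℝ) {P : ℝ → Matrix (Fin n) (Fin n) ℂ} {s : Set ℝ}
    (hc : ContinuousOn P s) (hP : ∀ t ∈ s, (P t).PosDef) :
    ContinuousOn (fun t => busemann c (P t)) s := by
  have h : ∀ k, ContinuousOn (fun t => logMinor k (P t)) s := fun k =>
    ((continuous_det_truncation k).comp_continuousOn hc).norm.log fun t ht =>
      norm_ne_zero_iff.2 (det_truncation_ne_zero_of_posDef (hP t ht) k)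
  exact continuousOn_finsetSum _ fun k _ => continuousOn_const.mul ((h _).sub (h _))

/-- A path of positive definite matrices from `P` to `T P Tᴴ`, with `T` triangular, has at least
the length of the translation part of `T`. -/
theorem sqrt_sum_log_sq_le_integral {P Q : ℝ → Matrix (Fin n) (Fin n) ℂ} {σ : ℝ → ℝ}
    (hc : ContinuousOn P (Set.Icc 0 1)) (hpos : ∀ t ∈ Set.Icc (0 : ℝ) 1, (P t).PosDef)
    (hP : ∀ t ∈ Set.Ioo (0 : ℝ) 1, HasEntryDeriv P (Q t) t)
    (hQ : ∀ t ∈ Set.Ioo (0 : ℝ) 1, (Q t).IsHermitian)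
    (hσ : MeasureTheory.IntegrableOn σ (Set.Icc 0 1))
    (hσQ : ∀ t ∈ Set.Ioo (0 : ℝ) 1, σ t = √((P t)⁻¹ * Q t * (P t)⁻¹ * Q t).trace.re)
    {T : Matrix (Fin n) (Fin n) ℂ} (hT : ∀ i j, i < j → T i j = 0) (hT0 : ∀ i, T i i ≠ 0)
    (hT1 : P 1 = T * P 0 * Tᴴ) :
    √(∑ i, (2 * Real.log ‖T i i‖) ^ 2) ≤ ∫ t in (0 : ℝ)..1, σ t := by
  -- These weights are the displacements themselves: the direction in which the Busemann function
  -- detects the whole translation, increasing by |c|².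
  set c : Fin n → ℝ := fun i => 2 * Real.log ‖T i i‖ with hcdef
  have hd : ∀ t ∈ Set.Ioo (0 : ℝ) 1, ∃ d, HasDerivAt (fun s => busemann c (P s)) d t ∧
      d ≤ √(∑ k, c k ^ 2) * σ t := by
    intro t ht
    rw [hσQ t ht]
    refine exists_hasDerivAt_busemann c (hP t ht) (hQ t ht) ?_
    filter_upwards [isOpen_Ioo.mem_nhds ht] with s hs using hpos s (Set.Ioo_subset_Icc_self hs)
  choose! d hd1 hd2 using hd
  have hmain := intervalIntegral.sub_le_integral_of_hasDeriv_right_of_le zero_le_one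
    (continuousOn_busemann c hc hpos) (fun t ht => (hd1 t ht).hasDerivWithinAt)
    (hσ.const_mul (√(∑ k, c k ^ 2))) hd2
  have h0 : (0 : ℝ) ∈ Set.Icc (0 : ℝ) 1 := by simp
  rw [hT1, busemann_conj c hT hT0 (det_truncation_ne_zero_of_posDef (hpos 0 h0)),
    intervalIntegral.integral_const_mul] at hmain
  have hsq : ∑ k, c k * (2 * Real.log ‖T k k‖) = √(∑ k, c k ^ 2) * √(∑ k, c k ^ 2) := by
    rw [Real.mul_self_sqrt (Finset.sum_nonneg fun k _ => sq_nonneg _)]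
    exact Finset.sum_congr rfl fun k _ => (sq _).symm
  rw [hsq] at hmain
  -- The inequality obtained is |c|² ≤ |c| · length. Dividing needs |c| > 0; when |c| = 0 it is
  -- enough that the length is nonnegative.
  rcases (Real.sqrt_nonneg (∑ k, c k ^ 2)).eq_or_lt with h | h
  · rw [← h]
    rw [intervalIntegral.integral_of_le zero_le_one]
    refine MeasureTheory.integral_nonneg_of_ae ?_
    rw [← MeasureTheory.restrict_Ioo_eq_restrict_Ioc]
    filter_upwards [MeasureTheory.ae_restrict_mem measurableSet_Ioo] with t ht
    simp only [Pi.zero_apply]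
    rw [hσQ t ht]
    exact Real.sqrt_nonneg _
  · refine le_of_mul_le_mul_left ?_ h
    linarith

end PosDefPaths

/-! ### The positive definite symplectic matrix of a point of the upper half plane -/

section FormMatrix

variable {p : ℕ}

/-- The matrix of the symplectic form `x₁* ∧ y₁* + ⋯ + x_p* ∧ y_p*`. -/
def stdForm (p : ℕ) (R : Type*) [Ring R] : Matrix (Fin p ⊕ Fin p) (Fin p ⊕ Fin p) R :=
  Matrix.fromBlocks 0 1 (-1) 0

/-- The real positive definite symplectic matrix attached to `Z = X + √-1 Y`. -/
def formMatrix (Z : Matrix (Fin p) (Fin p) ℂ) : Matrix (Fin p ⊕ Fin p) (Fin p ⊕ Fin p) ℝ :=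
  Matrix.fromBlocks 1 (Z.map Complex.re) 0 1 *
    Matrix.fromBlocks (Z.map Complex.im) 0 0 (Z.map Complex.im)⁻¹ *
    Matrix.fromBlocks 1 0 (Z.map Complex.re) 1

/-- The point of the upper half plane attached to a positive definite symplectic matrix. -/
def ofFormMatrix (S : Matrix (Fin p ⊕ Fin p) (Fin p ⊕ Fin p) ℝ) : Matrix (Fin p) (Fin p) ℂ :=
  (S.toBlocks₁₂ * S.toBlocks₂₂⁻¹).map Complex.ofReal +
    Complex.I • (S.toBlocks₂₂⁻¹).map Complex.ofReal

theorem map_re_ofFormMatrix (S : Matrix (Fin p ⊕ Fin p) (Fin p ⊕ Fin p) ℝ) :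
    (ofFormMatrix S).map Complex.re = S.toBlocks₁₂ * S.toBlocks₂₂⁻¹ := by
  ext i j
  simp [ofFormMatrix]

theorem map_im_ofFormMatrix (S : Matrix (Fin p ⊕ Fin p) (Fin p ⊕ Fin p) ℝ) :
    (ofFormMatrix S).map Complex.im = S.toBlocks₂₂⁻¹ := by
  ext i j
  simp [ofFormMatrix]

theorem ext_re_im {Z W : Matrix (Fin p) (Fin p) ℂ} (hre : Z.map Complex.re = W.map Complex.re)
    (him : Z.map Complex.im = W.map Complex.im) : Z = W := by
  ext i j
  exact Complex.ext (congrFun₂ hre i j) (congrFun₂ him i j)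

theorem isUnit_det_of_posDef {n : Type*} [Fintype n] [DecidableEq n] {A : Matrix n n ℝ}
    (hA : A.PosDef) : IsUnit A.det := hA.det_pos.ne'.isUnit

theorem map_re_transpose {Z : Matrix (Fin p) (Fin p) ℂ} (hZ : Z ∈ upperHalfPlane p) :
    (Z.map Complex.re)ᵀ = Z.map Complex.re := by
  rw [← Matrix.transpose_map, hZ.1]

theorem formMatrix_eq {Z : Matrix (Fin p) (Fin p) ℂ} :
    formMatrix Z = Matrix.fromBlocks
      (Z.map Complex.im + Z.map Complex.re * (Z.map Complex.im)⁻¹ * Z.map Complex.re)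
      (Z.map Complex.re * (Z.map Complex.im)⁻¹) ((Z.map Complex.im)⁻¹ * Z.map Complex.re)
      (Z.map Complex.im)⁻¹ := by
  simp [formMatrix, Matrix.fromBlocks_multiply]

theorem posDef_fromBlocks_zero {A B : Matrix (Fin p) (Fin p) ℝ} (hA : A.PosDef) (hB : B.PosDef) :
    (Matrix.fromBlocks A 0 0 B).PosDef := by
  rw [Matrix.posDef_iff_dotProduct_mulVec] at hA hB ⊢
  refine ⟨Matrix.IsHermitian.fromBlocks hA.1 (by simp) hB.1, fun {x} hx => ?_⟩
  obtain ⟨u, v, rfl⟩ : ∃ u v, x = Sum.elim u v := ⟨_, _, (Sum.elim_comp_inl_inr x).symm⟩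
  have h1 : star (Sum.elim u v) ⬝ᵥ Matrix.fromBlocks A 0 0 B *ᵥ Sum.elim u v =
      star u ⬝ᵥ A *ᵥ u + star v ⬝ᵥ B *ᵥ v := by
    rw [Matrix.fromBlocks_mulVec]
    simp [dotProduct]
  rw [h1]
  by_cases hu : u = 0
  · by_cases hv : v = 0
    · subst hu hv
      exact absurd (by ext i; cases i <;> rfl) hx
    · subst hu
      simpa using hB.2 hv
  · have h2 := hA.2 hu
    by_cases hv : v = 0
    · subst hv
      simpa using h2
    · exact add_pos h2 (hB.2 hv)

theorem formMatrix_posDef {Z : Matrix (Fin p) (Fin p) ℂ} (hZ : Z ∈ upperHalfPlane p) :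
    (formMatrix Z).PosDef := by
  have h1 := posDef_fromBlocks_zero hZ.2 hZ.2.inv
  have h2 : (Matrix.fromBlocks 1 (Z.map Complex.re) 0 1 :
      Matrix (Fin p ⊕ Fin p) (Fin p ⊕ Fin p) ℝ)ᴴ = Matrix.fromBlocks 1 0 (Z.map Complex.re) 1 := by
    rw [Matrix.fromBlocks_conjTranspose, Matrix.conjTranspose_eq_transpose_of_trivial (Z.map _),
      map_re_transpose hZ]
    simp
  rw [formMatrix, ← h2]
  refine h1.mul_mul_conjTranspose_same (Matrix.vecMul_injective_of_isUnit ?_)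
  rw [Matrix.isUnit_iff_isUnit_det, Matrix.det_fromBlocks_zero₂₁]
  simp

theorem formMatrix_symplectic {Z : Matrix (Fin p) (Fin p) ℂ} (hZ : Z ∈ upperHalfPlane p) :
    formMatrix Z * stdForm p ℝ * formMatrix Z = stdForm p ℝ := by
  have hu := isUnit_det_of_posDef hZ.2
  rw [formMatrix_eq, stdForm, Matrix.fromBlocks_multiply, Matrix.fromBlocks_multiply]
  generalize Z.map Complex.re = X
  generalize Z.map Complex.im = Y at hu
  have h1 := Matrix.mul_nonsing_inv _ hu
  have h2 := Matrix.nonsing_inv_mul _ hu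
  simp only [mul_zero, mul_neg, mul_one, zero_add, add_zero]
  congr 1
  · simp only [neg_mul, mul_add, add_mul, mul_assoc]
    rw [← mul_assoc Y Y⁻¹, h1, h2, one_mul, mul_one]
    abel
  · simp only [neg_mul, add_mul, mul_assoc, h1]
    abel
  · simp only [neg_mul, mul_add]
    rw [h2]
    simp only [mul_assoc]
    abel
  · simp only [neg_mul, mul_assoc]
    abel

/-- Write S in blocks a, b, c, d. Positivity makes d invertible and symmetry gives c = bᵀ. The
relation S J S = J says d b = c d, which makes X = b d⁻¹ symmetric, and a d = 1 + b², which recovers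
a from b and d. -/
theorem ofFormMatrix_spec {S : Matrix (Fin p ⊕ Fin p) (Fin p ⊕ Fin p) ℝ} (hS : S.PosDef)
    (hS' : S * stdForm p ℝ * S = stdForm p ℝ) :
    ofFormMatrix S ∈ upperHalfPlane p ∧ formMatrix (ofFormMatrix S) = S := by
  obtain ⟨a, b, c, d, rfl⟩ : ∃ a b c d, S = Matrix.fromBlocks a b c d :=
    ⟨_, _, _, _, (Matrix.fromBlocks_toBlocks S).symm⟩
  have hd : d.PosDef := by
    have := hS.submatrix (e := Sum.inr) Sum.inr_injective
    exact this
  have hu := isUnit_det_of_posDef hd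
  have hsymm := hS.isHermitian
  rw [Matrix.isHermitian_fromBlocks_iff] at hsymm
  obtain ⟨-, hbc, -, hdd⟩ := hsymm
  rw [Matrix.conjTranspose_eq_transpose_of_trivial] at hbc
  rw [Matrix.IsHermitian, Matrix.conjTranspose_eq_transpose_of_trivial] at hdd
  have h1 := Matrix.mul_nonsing_inv _ hu
  have h2 := Matrix.nonsing_inv_mul _ hu
  rw [stdForm, Matrix.fromBlocks_multiply, Matrix.fromBlocks_multiply, Matrix.fromBlocks_inj] at hS'
  obtain ⟨-, h12, -, h22⟩ := hS'
  simp only [mul_zero, mul_neg, mul_one, zero_add, add_zero, neg_mul] at h12 h22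
  have h22' : d * b = c * d := by rw [neg_add_eq_zero] at h22; exact h22
  have h12' : a * d = 1 + b * b := by rw [← h12]; abel
  have hX : b * d⁻¹ = d⁻¹ * c := by
    calc b * d⁻¹ = d⁻¹ * (d * b) * d⁻¹ := by rw [← mul_assoc, h2, one_mul]
      _ = d⁻¹ * c := by rw [h22', mul_assoc, mul_assoc, h1, mul_one]
  constructor
  · refine ⟨ext_re_im ?_ ?_, ?_⟩
    · rw [Matrix.transpose_map, map_re_ofFormMatrix, Matrix.toBlocks_fromBlocks₁₂,
        Matrix.toBlocks_fromBlocks₂₂, Matrix.transpose_mul, Matrix.transpose_nonsing_inv, hdd, hbc,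
        hX]
    · rw [Matrix.transpose_map, map_im_ofFormMatrix, Matrix.toBlocks_fromBlocks₂₂,
        Matrix.transpose_nonsing_inv, hdd]
    · rw [map_im_ofFormMatrix, Matrix.toBlocks_fromBlocks₂₂]
      exact hd.inv
  · rw [formMatrix_eq, map_im_ofFormMatrix, map_re_ofFormMatrix, Matrix.toBlocks_fromBlocks₁₂,
      Matrix.toBlocks_fromBlocks₂₂, Matrix.nonsing_inv_nonsing_inv _ hu]
    congr 1
    · rw [mul_assoc b, h2, mul_one]
      calc d⁻¹ + b * (b * d⁻¹) = (1 + b * b) * d⁻¹ := by rw [add_mul, one_mul, mul_assoc]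
        _ = a := by rw [← h12', mul_assoc, h1, mul_one]
    · rw [mul_assoc, h2, mul_one]
    · rw [hX, ← mul_assoc, h1, one_mul]

/-- Y⁻¹ is real, so the cross terms of the real and imaginary parts of ξ are purely imaginary and
disappear from the real part of the trace. -/
theorem metricTensor_eq (Z ξ : Matrix (Fin p) (Fin p) ℂ) :
    metricTensor Z ξ =
      ((Z.map Complex.im)⁻¹ * ξ.map Complex.re * (Z.map Complex.im)⁻¹ * ξ.map Complex.re).trace +
      ((Z.map Complex.im)⁻¹ * ξ.map Complex.im * (Z.map Complex.im)⁻¹ * ξ.map Complex.im).trace := by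
  unfold metricTensor
  generalize (Z.map Complex.im)⁻¹ = G
  dsimp only
  rw [Matrix.mul_assoc, Matrix.mul_assoc _ G, Matrix.mul_assoc _ G]
  simp only [Matrix.trace, Matrix.diag_apply]
  rw [← Finset.sum_add_distrib, Complex.re_sum]
  refine Finset.sum_congr rfl fun i _ => ?_
  rw [Matrix.mul_apply, Matrix.mul_apply, Matrix.mul_apply, Complex.re_sum,
    ← Finset.sum_add_distrib]
  refine Finset.sum_congr rfl fun j _ => ?_
  simp [Matrix.mul_apply]

end FormMatrix

/-! ### Smoothness and derivatives of real matrix functions, including inverses -/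

section Calculus

variable {l m n : Type*}

/-- `A` is continuously differentiable on `s`, entry by entry. -/
def EntryContDiffOn (A : ℝ → Matrix m n ℝ) (s : Set ℝ) : Prop :=
  ∀ i j, ContDiffOn ℝ 1 (fun t => A t i j) s

theorem entryContDiffOn_const (A : Matrix m n ℝ) (s : Set ℝ) : EntryContDiffOn (fun _ => A) s :=
  fun _ _ => contDiffOn_const

theorem EntryContDiffOn.mul [Fintype m] {A : ℝ → Matrix l m ℝ} {B : ℝ → Matrix m n ℝ} {s : Set ℝ}
    (hA : EntryContDiffOn A s) (hB : EntryContDiffOn B s) :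
    EntryContDiffOn (fun t => A t * B t) s := by
  intro i j
  simp only [Matrix.mul_apply]
  exact ContDiffOn.sum fun k _ => (hA i k).mul (hB k j)

theorem EntryContDiffOn.continuousOn {A : ℝ → Matrix m n ℝ} {s : Set ℝ}
    (hA : EntryContDiffOn A s) : ContinuousOn A s :=
  continuousOn_pi.2 fun i => continuousOn_pi.2 fun j => (hA i j).continuousOn

theorem HasEntryDeriv.fromBlocks {o q : Type*} {A : ℝ → Matrix l m ℝ} {B : ℝ → Matrix l q ℝ}
    {C : ℝ → Matrix o m ℝ} {D : ℝ → Matrix o q ℝ} {A' : Matrix l m ℝ} {B' : Matrix l q ℝ}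
    {C' : Matrix o m ℝ} {D' : Matrix o q ℝ} {t : ℝ} (hA : HasEntryDeriv A A' t)
    (hB : HasEntryDeriv B B' t) (hC : HasEntryDeriv C C' t) (hD : HasEntryDeriv D D' t) :
    HasEntryDeriv (fun s => Matrix.fromBlocks (A s) (B s) (C s) (D s))
      (Matrix.fromBlocks A' B' C' D') t := by
  rintro (i | i) (j | j)
  exacts [hA i j, hB i j, hC i j, hD i j]

variable [Fintype n] [DecidableEq n]

theorem EntryContDiffOn.det {A : ℝ → Matrix n n ℝ} {s : Set ℝ} (hA : EntryContDiffOn A s) :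
    ContDiffOn ℝ 1 (fun t => (A t).det) s := by
  simp only [Matrix.det_apply]
  exact ContDiffOn.sum fun σ _ => ContDiffOn.const_smul _ (contDiffOn_prod fun i _ => hA (σ i) i)

theorem EntryContDiffOn.inv {A : ℝ → Matrix n n ℝ} {s : Set ℝ} (hA : EntryContDiffOn A s)
    (h0 : ∀ t ∈ s, (A t).det ≠ 0) : EntryContDiffOn (fun t => (A t)⁻¹) s := by
  intro i j
  simp only [Matrix.inv_def, Matrix.smul_apply, Ring.inverse_eq_inv, smul_eq_mul,
    Matrix.adjugate_apply]
  refine (hA.det.inv h0).mul (EntryContDiffOn.det fun a b => ?_)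
  by_cases hab : a = j
  · subst hab
    simp only [Matrix.updateRow_self]
    exact contDiffOn_const
  · simp only [Matrix.updateRow_ne hab]
    exact hA a b

/-- Differentiability comes from the cofactor formula; the value of the derivative is found
separately in `HasEntryDeriv.inv`, by differentiating A A⁻¹ = 1. -/
theorem HasEntryDeriv.exists_inv {A : ℝ → Matrix n n ℝ} {A' : Matrix n n ℝ} {t : ℝ}
    (hA : HasEntryDeriv A A' t) (h0 : (A t).det ≠ 0) :
    ∃ D, HasEntryDeriv (fun s => (A s)⁻¹) D t := by
  have hdet : ∀ B : ℝ → Matrix n n ℝ, (∀ i j, DifferentiableAt ℝ (fun s => B s i j) t) →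
      DifferentiableAt ℝ (fun s => (B s).det) t := by
    intro B hB
    simp only [Matrix.det_apply]
    exact DifferentiableAt.fun_sum fun σ _ =>
      (DifferentiableAt.fun_finsetProd fun i _ => hB (σ i) i).const_smul _
  have hdiff : ∀ i j, DifferentiableAt ℝ (fun s => (A s)⁻¹ i j) t := by
    intro i j
    simp only [Matrix.inv_def, Matrix.smul_apply, Ring.inverse_eq_inv, smul_eq_mul,
      Matrix.adjugate_apply]
    refine ((hdet A fun i j => (hA i j).differentiableAt).inv h0).mul (hdet _ fun a b => ?_)
    by_cases hab : a = j
    · subst hab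
      simp only [Matrix.updateRow_self]
      exact differentiableAt_const _
    · simp only [Matrix.updateRow_ne hab]
      exact (hA a b).differentiableAt
  exact ⟨Matrix.of fun i j => deriv (fun s => (A s)⁻¹ i j) t, fun i j => (hdiff i j).hasDerivAt⟩

theorem HasEntryDeriv.unique {A : ℝ → Matrix m l ℝ} {A' A'' : Matrix m l ℝ} {t : ℝ}
    (h : HasEntryDeriv A A' t) (h' : HasEntryDeriv A A'' t) : A' = A'' := by
  ext i j
  exact (h i j).unique (h' i j)

theorem HasEntryDeriv.congr_of_eventuallyEq {A B : ℝ → Matrix m l ℝ} {A' : Matrix m l ℝ} {t : ℝ}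
    (h : HasEntryDeriv A A' t) (hB : ∀ᶠ s in nhds t, B s = A s) : HasEntryDeriv B A' t := by
  intro i j
  refine (h i j).congr_of_eventuallyEq ?_
  filter_upwards [hB] with s hs
  rw [hs]

theorem HasEntryDeriv.inv {A : ℝ → Matrix n n ℝ} {A' : Matrix n n ℝ} {t : ℝ}
    (hA : HasEntryDeriv A A' t) (h0 : ∀ᶠ s in nhds t, (A s).det ≠ 0) :
    HasEntryDeriv (fun s => (A s)⁻¹) (-((A t)⁻¹ * A' * (A t)⁻¹)) t := by
  obtain ⟨D, hD⟩ := hA.exists_inv h0.self_of_nhds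
  have h1 : HasEntryDeriv (fun s => A s * (A s)⁻¹) 0 t := by
    refine (hasEntryDeriv_const (1 : Matrix n n ℝ) t).congr_of_eventuallyEq ?_
    filter_upwards [h0] with s hs using Matrix.mul_nonsing_inv _ hs.isUnit
  have h2 := (hA.mul hD).unique h1
  have hu : IsUnit (A t).det := h0.self_of_nhds.isUnit
  have h3 : D = -((A t)⁻¹ * A' * (A t)⁻¹) := by
    have h4 := congrArg (fun M => (A t)⁻¹ * M) h2
    simp only [mul_add, mul_zero] at h4
    rw [← mul_assoc, ← mul_assoc, Matrix.nonsing_inv_mul _ hu, one_mul] at h4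
    exact eq_neg_of_add_eq_zero_right h4
  rwa [← h3]

theorem HasEntryDeriv.transpose {A : ℝ → Matrix m l ℝ} {A' : Matrix m l ℝ} {t : ℝ}
    (h : HasEntryDeriv A A' t) : HasEntryDeriv (fun s => (A s)ᵀ) A'ᵀ t := fun i j => h j i

theorem HasEntryDeriv.map_ofReal {A : ℝ → Matrix m l ℝ} {A' : Matrix m l ℝ} {t : ℝ}
    (h : HasEntryDeriv A A' t) :
    HasEntryDeriv (fun s => (A s).map Complex.ofReal) (A'.map Complex.ofReal) t :=
  fun i j => (h i j).ofReal_comp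

theorem HasEntryDeriv.map_re {A : ℝ → Matrix m l ℂ} {A' : Matrix m l ℂ} {t : ℝ}
    (h : HasEntryDeriv A A' t) :
    HasEntryDeriv (fun s => (A s).map Complex.re) (A'.map Complex.re) t :=
  fun i j => Complex.reCLM.hasFDerivAt.comp_hasDerivAt t (h i j)

theorem HasEntryDeriv.map_im {A : ℝ → Matrix m l ℂ} {A' : Matrix m l ℂ} {t : ℝ}
    (h : HasEntryDeriv A A' t) :
    HasEntryDeriv (fun s => (A s).map Complex.im) (A'.map Complex.im) t :=
  fun i j => Complex.imCLM.hasFDerivAt.comp_hasDerivAt t (h i j)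

end Calculus

/-! ### Comparison of the Siegel metric with the trace metric -/

section FormMatrix

theorem trace_fromBlocks {m n R : Type*} [Fintype m] [Fintype n] [AddCommMonoid R]
    (A : Matrix m m R) (B : Matrix m n R) (C : Matrix n m R) (D : Matrix n n R) :
    (Matrix.fromBlocks A B C D).trace = A.trace + D.trace := by
  simp [Matrix.trace, Fintype.sum_sum_type]

variable {p : ℕ}

/-- Twice the Siegel metric is the trace metric `tr ((S⁻¹ dS)²)` of the form matrix. -/
theorem exists_hasEntryDeriv_formMatrix {γ : ℝ → Matrix (Fin p) (Fin p) ℂ}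
    {ξ : Matrix (Fin p) (Fin p) ℂ} {t : ℝ} (hγ : HasEntryDeriv γ ξ t)
    (hmem : ∀ᶠ s in nhds t, γ s ∈ upperHalfPlane p) :
    ∃ S', HasEntryDeriv (fun s => formMatrix (γ s)) S' t ∧ S'ᵀ = S' ∧
      ((formMatrix (γ t))⁻¹ * S' * (formMatrix (γ t))⁻¹ * S').trace =
        2 * metricTensor (γ t) ξ := by
  have hdet : ∀ᶠ s in nhds t, ((γ s).map Complex.im).det ≠ 0 := by
    filter_upwards [hmem] with s hs using hs.2.det_pos.ne'
  have h0 := fun (A : Matrix (Fin p) (Fin p) ℝ) => hasEntryDeriv_const A t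
  have hX := hγ.map_re
  have hY := hγ.map_im
  have hG := hY.inv hdet
  have hS := (((h0 1).fromBlocks hX (h0 0) (h0 1)).mul
    (hY.fromBlocks (h0 0) (h0 0) hG)).mul ((h0 1).fromBlocks (h0 0) hX (h0 1))
  refine ⟨_, hS, ?_, ?_⟩
  · refine hS.transpose.unique (hS.congr_of_eventuallyEq ?_)
    filter_upwards [hmem] with s hs
    have := (formMatrix_posDef hs).isHermitian
    rwa [Matrix.IsHermitian, Matrix.conjTranspose_eq_transpose_of_trivial] at this
  · have hu := isUnit_det_of_posDef hmem.self_of_nhds.2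
    rw [metricTensor_eq]
    unfold formMatrix
    generalize (γ t).map Complex.re = X
    generalize (γ t).map Complex.im = Y at hu
    generalize ξ.map Complex.re = X'
    generalize ξ.map Complex.im = Y'
    have hGY := Matrix.nonsing_inv_mul _ hu
    have hYG := Matrix.mul_nonsing_inv _ hu
    set G := Y⁻¹
    set N : Matrix (Fin p ⊕ Fin p) (Fin p ⊕ Fin p) ℝ := Matrix.fromBlocks 1 X 0 1
    set N' : Matrix (Fin p ⊕ Fin p) (Fin p ⊕ Fin p) ℝ := Matrix.fromBlocks 1 0 X 1
    set Ni : Matrix (Fin p ⊕ Fin p) (Fin p ⊕ Fin p) ℝ := Matrix.fromBlocks 1 (-X) 0 1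
    set Ni' : Matrix (Fin p ⊕ Fin p) (Fin p ⊕ Fin p) ℝ := Matrix.fromBlocks 1 0 (-X) 1
    have hNi : Ni * N = 1 := by simp [N, Ni, Matrix.fromBlocks_multiply]
    have hNi' : Ni' * N' = 1 := by simp [N', Ni', Matrix.fromBlocks_multiply]
    have hNi2 : N * Ni = 1 := by simp [N, Ni, Matrix.fromBlocks_multiply]
    have hNi2' : N' * Ni' = 1 := by simp [N', Ni', Matrix.fromBlocks_multiply]
    set Δ : Matrix (Fin p ⊕ Fin p) (Fin p ⊕ Fin p) ℝ := Matrix.fromBlocks Y 0 0 G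
    set Δi : Matrix (Fin p ⊕ Fin p) (Fin p ⊕ Fin p) ℝ := Matrix.fromBlocks G 0 0 Y
    have hΔ : Δi * Δ = 1 := by simp [Δ, Δi, Matrix.fromBlocks_multiply, hGY, hYG]
    -- S = N Δ N' with unipotent N and N'. K is the derivative of S in this frame, S' = N K N', so
    -- the unipotent factors cancel in the trace and only tr((Δ⁻¹ K)²) remains.
    set K : Matrix (Fin p ⊕ Fin p) (Fin p ⊕ Fin p) ℝ :=
      Matrix.fromBlocks Y' (X' * G) (G * X') (-(G * Y' * G)) with hK
    have hinv : (N * Δ * N')⁻¹ = Ni' * Δi * Ni := by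
      refine Matrix.inv_eq_left_inv ?_
      calc Ni' * Δi * Ni * (N * Δ * N') = Ni' * (Δi * (Ni * N) * Δ) * N' := by
            simp only [mul_assoc]
        _ = 1 := by rw [hNi, mul_one, hΔ, mul_one, hNi']
    have hS' : ((Matrix.fromBlocks 0 X' 0 0 * Δ + N * Matrix.fromBlocks Y' 0 0 (-(G * Y' * G))) * N'
        + N * Δ * Matrix.fromBlocks 0 0 X' 0) = N * K * N' := by
      have e1 : (Matrix.fromBlocks 0 X' 0 0 : Matrix (Fin p ⊕ Fin p) (Fin p ⊕ Fin p) ℝ) =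
          N * Matrix.fromBlocks 0 X' 0 0 := by simp [N, Matrix.fromBlocks_multiply]
      have e2 : (Matrix.fromBlocks 0 0 X' 0 : Matrix (Fin p ⊕ Fin p) (Fin p ⊕ Fin p) ℝ) =
          Matrix.fromBlocks 0 0 X' 0 * N' := by simp [N', Matrix.fromBlocks_multiply]
      have e3 : K = Matrix.fromBlocks 0 X' 0 0 * Δ + Matrix.fromBlocks Y' 0 0 (-(G * Y' * G)) +
          Δ * Matrix.fromBlocks 0 0 X' 0 := by
        simp [hK, Δ, Matrix.fromBlocks_multiply, Matrix.fromBlocks_add]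
      rw [e1, e2, e3]
      simp only [mul_add, add_mul, mul_assoc]
    rw [hinv, hS']
    have hcyc : (Ni' * Δi * Ni * (N * K * N') * (Ni' * Δi * Ni) * (N * K * N')).trace =
        (Δi * K * (Δi * K)).trace := by
      calc _ = (Ni' * (Δi * (Ni * N) * K * (N' * Ni') * Δi * (Ni * N) * K * N')).trace := by
            simp only [mul_assoc]
        _ = (Ni' * ((Δi * K * (Δi * K)) * N')).trace := by
            rw [hNi, hNi2', mul_one, mul_one, mul_one]; simp only [mul_assoc]
        _ = _ := by rw [Matrix.trace_mul_comm, mul_assoc, hNi2', mul_one]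
    rw [hcyc]
    -- The two diagonal blocks of (Δ⁻¹ K)² have the same trace, each equal to the Siegel metric;
    -- this is the origin of the factor 2.
    have hΔK : Δi * K = Matrix.fromBlocks (G * Y') (G * X' * G) X' (-(Y' * G)) := by
      simp only [Δi, hK, Matrix.fromBlocks_multiply, zero_mul, add_zero, zero_add, mul_neg,
        ← mul_assoc, hYG, one_mul, neg_zero]
    rw [hΔK, Matrix.fromBlocks_multiply, trace_fromBlocks, Matrix.trace_add,
      Matrix.trace_add]
    have c1 : (X' * (G * X' * G)).trace = (G * X' * G * X').trace := Matrix.trace_mul_comm _ _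
    have c2 : (-(Y' * G) * -(Y' * G)).trace = (G * Y' * (G * Y')).trace := by
      rw [neg_mul_neg, mul_assoc, Matrix.trace_mul_comm]
      simp only [mul_assoc]
    rw [c1, c2]
    simp only [← mul_assoc]
    ring

end FormMatrix

theorem map_ofReal_mul {l m n : Type*} [Fintype m] (A : Matrix l m ℝ) (B : Matrix m n ℝ) :
    (A * B).map Complex.ofReal = A.map Complex.ofReal * B.map Complex.ofReal :=
  Matrix.map_mul (f := Complex.ofRealHom)

theorem map_ofReal_one {n : Type*} [DecidableEq n] :
    (1 : Matrix n n ℝ).map Complex.ofReal = 1 :=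
  Matrix.map_one _ Complex.ofReal_zero Complex.ofReal_one

/-! ### Hodge structures in the coordinates of a symplectic basis -/

section Coordinates

variable {V : Type*} [AddCommGroup V] [Module ℝ V] {ω : LinearMap.BilinForm ℝ V} {p : ℕ}

/-- The complex basis of `V ⊗ ℂ` given by a symplectic basis of `V`. -/
def SymplecticBasis.complexBasis (b : SymplecticBasis ω p) :
    Module.Basis (Fin p ⊕ Fin p) ℂ (ℂ ⊗[ℝ] V) := b.basis.baseChange ℂ

theorem SymplecticBasis.complexBasis_apply (b : SymplecticBasis ω p) (k : Fin p ⊕ Fin p) :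
    b.complexBasis k = 1 ⊗ₜ[ℝ] b.basis k := Module.Basis.baseChange_apply ℂ b.basis k

theorem SymplecticBasis.complexBasis_repr_tmul (b : SymplecticBasis ω p) (a : ℂ) (v : V)
    (k : Fin p ⊕ Fin p) : b.complexBasis.repr (a ⊗ₜ v) k = b.basis.repr v k * a := by
  rw [SymplecticBasis.complexBasis, Module.Basis.baseChange_repr_tmul]
  simp

theorem SymplecticBasis.repr_conj (b : SymplecticBasis ω p) (z : ℂ ⊗[ℝ] V)
    (k : Fin p ⊕ Fin p) :
    b.complexBasis.repr (conj z) k = starRingEnd ℂ (b.complexBasis.repr z k) := by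
  induction z with
  | zero => simp
  | add x y hx hy => simp only [map_add, Finsupp.add_apply, hx, hy]
  | tmul a v => simp [conj_tmul, b.complexBasis_repr_tmul]

theorem SymplecticBasis.baseChange_form (b : SymplecticBasis ω p) (z w : ℂ ⊗[ℝ] V) :
    LinearMap.BilinForm.baseChange ℂ ω z w =
      ∑ i, (b.complexBasis.repr z (Sum.inl i) * b.complexBasis.repr w (Sum.inr i) -
        b.complexBasis.repr z (Sum.inr i) * b.complexBasis.repr w (Sum.inl i)) := by
  have hform : ∀ k l, LinearMap.BilinForm.baseChange ℂ ω (b.complexBasis k) (b.complexBasis l) =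
      (ω (b.basis k) (b.basis l) : ℂ) := by
    intro k l
    rw [b.complexBasis_apply, b.complexBasis_apply, LinearMap.BilinForm.baseChange_tmul]
    simp
  conv_lhs => rw [← b.complexBasis.sum_repr z, ← b.complexBasis.sum_repr w]
  simp only [map_add, LinearMap.add_apply, map_sum, LinearMap.sum_apply, map_smul,
    LinearMap.smul_apply, hform,
    Fintype.sum_sum_type, b.apply_inl_inl, b.apply_inr_inr, b.apply_inl_inr, b.apply_inr_inl,
    smul_eq_mul]
  rw [Finset.sum_sub_distrib, sub_eq_add_neg, ← Finset.sum_neg_distrib]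
  simp [apply_ite Complex.ofReal, mul_comm]
  exact add_comm _ _

/-- The complex subspace of vectors `∑ uᵢ xᵢ + vᵢ yᵢ` with `u = W v`. -/
def graphSubmodule (b : SymplecticBasis ω p) (W : Matrix (Fin p) (Fin p) ℂ) :
    Submodule ℂ (ℂ ⊗[ℝ] V) where
  carrier := {z | ∀ i, b.complexBasis.repr z (Sum.inl i) =
    ∑ j, W i j * b.complexBasis.repr z (Sum.inr j)}
  zero_mem' := fun i => by simp
  add_mem' := fun {z w} hz hw i => by
    simp only [map_add, Finsupp.add_apply, mul_add, Finset.sum_add_distrib]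
    rw [hz i, hw i]
  smul_mem' := fun c z hz i => by
    simp only [map_smul, Finsupp.smul_apply, smul_eq_mul]
    rw [hz i, Finset.mul_sum]
    exact Finset.sum_congr rfl fun j _ => by ring

theorem span_eq_graphSubmodule (b : SymplecticBasis ω p) (Z : Matrix (Fin p) (Fin p) ℂ) :
    Submodule.span ℂ (Set.range fun j : Fin p =>
      (∑ i, (starRingEnd ℂ (Z i j)) ⊗ₜ[ℝ] b.basis (Sum.inl i)) + 1 ⊗ₜ[ℝ] b.basis (Sum.inr j)) =
      graphSubmodule b (Z.map (starRingEnd ℂ)) := by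
  have hvec : ∀ j : Fin p, (∑ i, (starRingEnd ℂ (Z i j)) ⊗ₜ[ℝ] b.basis (Sum.inl i)) +
      1 ⊗ₜ[ℝ] b.basis (Sum.inr j) = (∑ i, starRingEnd ℂ (Z i j) • b.complexBasis (Sum.inl i)) +
        b.complexBasis (Sum.inr j) := by
    intro j
    simp only [b.complexBasis_apply, TensorProduct.smul_tmul', smul_eq_mul, mul_one]
  simp only [hvec]
  apply le_antisymm
  · rw [Submodule.span_le]
    rintro _ ⟨j, rfl⟩
    intro i
    simp [Finsupp.single_apply]
  · intro z hz
    have hz' : z = ∑ j, b.complexBasis.repr z (Sum.inr j) •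
        ((∑ i, starRingEnd ℂ (Z i j) • b.complexBasis (Sum.inl i)) +
        b.complexBasis (Sum.inr j)) := by
      conv_lhs => rw [← b.complexBasis.sum_repr z, Fintype.sum_sum_type]
      simp only [smul_add, Finset.sum_add_distrib]
      congr 1
      simp only [Finset.smul_sum]
      rw [Finset.sum_comm]
      refine Finset.sum_congr rfl fun i _ => ?_
      rw [hz i, Finset.sum_smul]
      refine Finset.sum_congr rfl fun j _ => ?_
      rw [smul_smul, Matrix.map_apply, mul_comm]
    rw [hz']
    exact Submodule.sum_mem _ fun j _ => Submodule.smul_mem _ _ (Submodule.subset_span ⟨j, rfl⟩)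

theorem corresponds_iff {b : SymplecticBasis ω p} {Z : Matrix (Fin p) (Fin p) ℂ}
    {H : HodgeStructure ω} :
    Corresponds b Z H ↔ H.V10 = graphSubmodule b (Z.map (starRingEnd ℂ)) := by
  rw [Corresponds, span_eq_graphSubmodule]

theorem hermitianForm_eq (b : SymplecticBasis ω p) (z w : ℂ ⊗[ℝ] V) :
    hermitianForm ω z w = Complex.I / 2 * ∑ i,
      (b.complexBasis.repr z (Sum.inl i) * starRingEnd ℂ (b.complexBasis.repr w (Sum.inr i)) -
        b.complexBasis.repr z (Sum.inr i) * starRingEnd ℂ (b.complexBasis.repr w (Sum.inl i))) := by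
  rw [hermitianForm, b.baseChange_form]
  simp only [b.repr_conj]

theorem conj_conj_apply (z : ℂ ⊗[ℝ] V) : conj (conj z) = z := by
  induction z with
  | zero => simp
  | add x y hx hy => simp only [map_add, hx, hy]
  | tmul a v => simp [conj_tmul]

theorem conj_mem_graphSubmodule {b : SymplecticBasis ω p} {W : Matrix (Fin p) (Fin p) ℂ}
    {z : ℂ ⊗[ℝ] V} (hz : z ∈ graphSubmodule b W) :
    conj z ∈ graphSubmodule b (W.map (starRingEnd ℂ)) := by
  intro i
  simp only [b.repr_conj, hz i, map_sum, map_mul, Matrix.map_apply]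

theorem map_star_map_star (W : Matrix (Fin p) (Fin p) ℂ) :
    (W.map (starRingEnd ℂ)).map (starRingEnd ℂ) = W := by
  ext i j
  simp

/-- The difference of the two graph matrices is Z - conj Z = 2 √-1 Y with Y invertible. A common
vector satisfies Y v = 0, and a decomposition of (u, v) amounts to solving 2 √-1 Y c = u - conj(Z)
v. -/
theorem isCompl_graphSubmodule (b : SymplecticBasis ω p) {Z : Matrix (Fin p) (Fin p) ℂ}
    (hZ : Z ∈ upperHalfPlane p) :
    IsCompl (graphSubmodule b (Z.map (starRingEnd ℂ))) (graphSubmodule b Z) := by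
  have hu := isUnit_det_of_posDef hZ.2
  set Y := Z.map Complex.im with hY
  have hdiff : ∀ i j, Z i j - starRingEnd ℂ (Z i j) = 2 * Complex.I * (Y i j : ℂ) := fun i j => by
    rw [Complex.sub_conj, hY, Matrix.map_apply]; push_cast; ring
  have hYc : (Y.map Complex.ofReal) * (Y⁻¹.map Complex.ofReal) = 1 := by
    rw [← map_ofReal_mul, Matrix.mul_nonsing_inv _ hu, map_ofReal_one]
  have hYc' : (Y⁻¹.map Complex.ofReal) * (Y.map Complex.ofReal) = 1 := by
    rw [← map_ofReal_mul, Matrix.nonsing_inv_mul _ hu, map_ofReal_one]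
  rw [isCompl_iff]
  constructor
  · rw [Submodule.disjoint_def]
    intro z h1 h2
    have h3 : (Y.map Complex.ofReal) *ᵥ (fun j => b.complexBasis.repr z (Sum.inr j)) = 0 := by
      ext i
      have h4 := (h2 i).symm.trans (h1 i)
      rw [← sub_eq_zero, ← Finset.sum_sub_distrib] at h4
      simp only [Matrix.map_apply, ← sub_mul, hdiff, mul_assoc, ← Finset.mul_sum] at h4
      simpa [Matrix.mulVec, dotProduct] using h4
    have h5 : (fun j => b.complexBasis.repr z (Sum.inr j)) = 0 := by
      have := congrArg (fun v => (Y⁻¹.map Complex.ofReal) *ᵥ v) h3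
      simpa [Matrix.mulVec_mulVec, hYc'] using this
    have h6 : ∀ j, b.complexBasis.repr z (Sum.inr j) = 0 := fun j => congrFun h5 j
    refine b.complexBasis.repr.map_eq_zero_iff.1 (Finsupp.ext fun k => ?_)
    rcases k with i | j
    · rw [h1 i]; simp [h6]
    · exact h6 j
  · rw [codisjoint_iff, eq_top_iff]
    intro z _
    set u : Fin p → ℂ := fun i => b.complexBasis.repr z (Sum.inl i)
    set v : Fin p → ℂ := fun i => b.complexBasis.repr z (Sum.inr i)
    -- c is the y-coordinate of the component in the graph of Z, obtained by solving that linear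
    -- equation.
    set c : Fin p → ℂ := (Y⁻¹.map Complex.ofReal) *ᵥ
      fun i => (2 * Complex.I)⁻¹ * (u i - ∑ j, starRingEnd ℂ (Z i j) * v j) with hc
    have hYv : ∀ i, ∑ j, (Y i j : ℂ) * c j =
        (2 * Complex.I)⁻¹ * (u i - ∑ j, starRingEnd ℂ (Z i j) * v j) := by
      intro i
      have : (Y.map Complex.ofReal) *ᵥ c =
          fun i => (2 * Complex.I)⁻¹ * (u i - ∑ j, starRingEnd ℂ (Z i j) * v j) := by
        rw [hc, Matrix.mulVec_mulVec, hYc, Matrix.one_mulVec]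
      exact congrFun this i
    let w : ℂ ⊗[ℝ] V := ∑ k, (Sum.elim (fun i => ∑ j, Z i j * c j) c : Fin p ⊕ Fin p → ℂ) k •
      b.complexBasis k
    have hw : ∀ k, b.complexBasis.repr w k =
        (Sum.elim (fun i => ∑ j, Z i j * c j) c : Fin p ⊕ Fin p → ℂ) k := fun k =>
      congrFun (b.complexBasis.repr_sum_self _) k
    have h1 : w ∈ graphSubmodule b Z := fun i => by simp only [hw, Sum.elim_inl, Sum.elim_inr]
    have h2 : z - w ∈ graphSubmodule b (Z.map (starRingEnd ℂ)) := by
      intro i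
      simp only [map_sub, Finsupp.sub_apply, hw, Sum.elim_inl, Sum.elim_inr, Matrix.map_apply,
        mul_sub, Finset.sum_sub_distrib]
      have h3 : ∑ j, Z i j * c j = ∑ j, starRingEnd ℂ (Z i j) * c j +
          2 * Complex.I * ∑ j, (Y i j : ℂ) * c j := by
        rw [Finset.mul_sum, ← Finset.sum_add_distrib]
        refine Finset.sum_congr rfl fun j _ => ?_
        rw [← mul_assoc, ← hdiff]; ring
      rw [h3, hYv, mul_inv_cancel_left₀ (by simp [Complex.I_ne_zero])]
      simp only [u, v]
      ring
    rw [← sub_add_cancel z w]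
    exact Submodule.add_mem_sup h2 h1

/-- The Hodge structure of a point of the upper half plane. -/
def hodgeStructure (b : SymplecticBasis ω p) {Z : Matrix (Fin p) (Fin p) ℂ}
    (hZ : Z ∈ upperHalfPlane p) : HodgeStructure ω where
  V10 := graphSubmodule b (Z.map (starRingEnd ℂ))
  V01 := graphSubmodule b Z
  isCompl := isCompl_graphSubmodule b hZ
  orthogonal := by
    intro z hz w hw
    have hw' := conj_mem_graphSubmodule hw
    have hsymm : ∀ i j, Z i j = Z j i := fun i j => congrFun₂ hZ.1 j i
    rw [hermitianForm, b.baseChange_form, Finset.sum_sub_distrib]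
    simp only [hz _, hw' _, Finset.sum_mul, Finset.mul_sum]
    rw [Finset.sum_comm, sub_eq_zero.2, mul_zero]
    refine Finset.sum_congr rfl fun j _ => Finset.sum_congr rfl fun i _ => ?_
    rw [Matrix.map_apply, Matrix.map_apply, hsymm]
    ring
  pos := by
    intro z hz hz0
    set v : Fin p → ℂ := fun i => b.complexBasis.repr z (Sum.inr i) with hv
    have hv0 : v ≠ 0 := by
      intro h0
      refine hz0 (b.complexBasis.repr.map_eq_zero_iff.1 (Finsupp.ext fun k => ?_))
      have h6 : ∀ j, b.complexBasis.repr z (Sum.inr j) = 0 := fun j => congrFun h0 j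
      rcases k with i | j
      · rw [hz i]; simp [h6]
      · exact h6 j
    have hsymm : ∀ i j, Z i j = Z j i := fun i j => congrFun₂ hZ.1 j i
    -- On the graph the Hermitian form is v ↦ v* Y v in the y-coordinates, so its positivity is that
    -- of Y = Im Z.
    have h1 : hermitianForm ω z z = ∑ i, ∑ j, ((Z i j).im : ℂ) * (starRingEnd ℂ (v i) * v j) := by
      rw [hermitianForm_eq b, Finset.sum_sub_distrib]
      simp only [hz _, map_sum, map_mul, Finset.sum_mul, Finset.mul_sum, Matrix.map_apply,
        Complex.conj_conj]
      rw [Finset.sum_comm (f := fun x i => b.complexBasis.repr z (Sum.inr x) *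
        (Z x i * starRingEnd ℂ (b.complexBasis.repr z (Sum.inr i)))), ← Finset.sum_sub_distrib,
        Finset.mul_sum]
      refine Finset.sum_congr rfl fun i _ => ?_
      rw [← Finset.sum_sub_distrib, Finset.mul_sum]
      refine Finset.sum_congr rfl fun j _ => ?_
      have h2 : Z i j - starRingEnd ℂ (Z i j) = 2 * Complex.I * ((Z i j).im : ℂ) := by
        rw [Complex.sub_conj]; push_cast; ring
      simp only [hv]
      rw [hsymm j i]
      linear_combination (-Complex.I / 2 * b.complexBasis.repr z (Sum.inr j) *
        starRingEnd ℂ (b.complexBasis.repr z (Sum.inr i))) * h2 -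
        ((Z i j).im : ℂ) * b.complexBasis.repr z (Sum.inr j) *
        starRingEnd ℂ (b.complexBasis.repr z (Sum.inr i)) * Complex.I_sq
    have h2 : (hermitianForm ω z z).re =
        (fun i => (v i).re) ⬝ᵥ Z.map Complex.im *ᵥ (fun i => (v i).re) +
        (fun i => (v i).im) ⬝ᵥ Z.map Complex.im *ᵥ (fun i => (v i).im) := by
      rw [h1]
      simp only [Complex.re_sum, dotProduct, Matrix.mulVec, Finset.mul_sum,
        ← Finset.sum_add_distrib]
      refine Finset.sum_congr rfl fun i _ => Finset.sum_congr rfl fun j _ => ?_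
      simp
      ring
    rw [h2]
    have hpd := (Matrix.posDef_iff_dotProduct_mulVec.1 hZ.2).2
    have hps := fun x => (Matrix.posSemidef_iff_dotProduct_mulVec.1 hZ.2.posSemidef).2 x
    by_cases hre : (fun i => (v i).re) = 0
    · have him : (fun i => (v i).im) ≠ 0 := fun him => hv0 (by
        ext i; exact Complex.ext (congrFun hre i) (congrFun him i))
      exact add_pos_of_nonneg_of_pos (hps _) (hpd him)
    · exact add_pos_of_pos_of_nonneg (hpd hre) (hps _)
  conj_image := by
    ext w
    constructor
    · rintro ⟨z, hz, rfl⟩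
      have := conj_mem_graphSubmodule hz
      rwa [map_star_map_star] at this
    · intro hw
      exact ⟨conj w, conj_mem_graphSubmodule hw, conj_conj_apply w⟩

theorem corresponds_hodgeStructure (b : SymplecticBasis ω p) {Z : Matrix (Fin p) (Fin p) ℂ}
    (hZ : Z ∈ upperHalfPlane p) : Corresponds b Z (hodgeStructure b hZ) :=
  corresponds_iff.2 rfl

end Coordinates

/-! ### The action of the symplectic group -/

section Action

variable {V : Type*} [AddCommGroup V] [Module ℝ V] {ω : LinearMap.BilinForm ℝ V} {p : ℕ}

/-- The matrix of a symplectic transformation in a symplectic basis. -/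
def SymplecticBasis.toMatrix (b : SymplecticBasis ω p) (φ : Sp ω) :
    Matrix (Fin p ⊕ Fin p) (Fin p ⊕ Fin p) ℝ :=
  LinearMap.toMatrix b.basis b.basis (φ.1 : V →ₗ[ℝ] V)

theorem SymplecticBasis.form_apply (b : SymplecticBasis ω p) (k l : Fin p ⊕ Fin p) :
    ω (b.basis k) (b.basis l) = stdForm p ℝ k l := by
  rcases k with i | i <;> rcases l with j | j
  · simp [stdForm, b.apply_inl_inl]
  · simp [stdForm, b.apply_inl_inr, Matrix.one_apply]
  · rw [b.apply_inr_inl]; simp [stdForm, Matrix.one_apply]; split_ifs <;> simp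
  · simp [stdForm, b.apply_inr_inr]

theorem SymplecticBasis.toMatrix_form (b : SymplecticBasis ω p) :
    LinearMap.BilinForm.toMatrix b.basis ω = stdForm p ℝ := by
  ext k l
  rw [LinearMap.BilinForm.toMatrix_apply, b.form_apply]

theorem SymplecticBasis.toMatrix_symplectic (b : SymplecticBasis ω p) (φ : Sp ω) :
    (b.toMatrix φ)ᵀ * stdForm p ℝ * b.toMatrix φ = stdForm p ℝ := by
  rw [SymplecticBasis.toMatrix, ← b.toMatrix_form, ← LinearMap.BilinForm.toMatrix_comp]
  congr 1
  ext v w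
  exact φ.2 v w

theorem SymplecticBasis.repr_complexify (b : SymplecticBasis ω p) (φ : Sp ω) (z : ℂ ⊗[ℝ] V) :
    (b.complexBasis.repr (complexify φ.1 z) : Fin p ⊕ Fin p → ℂ) =
      (b.toMatrix φ).map Complex.ofReal *ᵥ b.complexBasis.repr z := by
  induction z with
  | zero => simp
  | add x y hx hy => simp only [map_add, Finsupp.coe_add, hx, hy, Matrix.mulVec_add]
  | tmul a v =>
    ext k
    have h := congrFun (LinearMap.toMatrix_mulVec_repr b.basis b.basis (φ.1 : V →ₗ[ℝ] V) v) k
    rw [complexify_tmul, b.complexBasis_repr_tmul]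
    have h' : b.basis.repr (φ.1 v) k = (b.toMatrix φ *ᵥ b.basis.repr v) k := h.symm
    rw [h']
    simp only [Matrix.mulVec, dotProduct, Matrix.map_apply, b.complexBasis_repr_tmul,
      Complex.ofReal_sum, Complex.ofReal_mul, Finset.sum_mul, mul_assoc]

theorem stdForm_mul_self : stdForm p ℝ * stdForm p ℝ = -1 := by
  rw [stdForm, Matrix.fromBlocks_multiply, ← Matrix.fromBlocks_one, Matrix.fromBlocks_neg]
  simp

theorem isUnit_stdForm : IsUnit (stdForm p ℝ) :=
  IsUnit.of_mul_eq_one (-stdForm p ℝ) (by rw [mul_neg, stdForm_mul_self, neg_neg])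

theorem isUnit_of_symplectic {M : Matrix (Fin p ⊕ Fin p) (Fin p ⊕ Fin p) ℝ}
    (hM : Mᵀ * stdForm p ℝ * M = stdForm p ℝ) : IsUnit M := by
  refine IsUnit.of_mul_eq_one_right (-stdForm p ℝ * (Mᵀ * stdForm p ℝ)) ?_
  rw [mul_assoc, hM, neg_mul, stdForm_mul_self, neg_neg]

theorem formMatrix_mul_stdForm {Z : Matrix (Fin p) (Fin p) ℂ} :
    formMatrix Z * stdForm p ℝ = Matrix.fromBlocks
      (-(Z.map Complex.re * (Z.map Complex.im)⁻¹))
      (Z.map Complex.im + Z.map Complex.re * (Z.map Complex.im)⁻¹ * Z.map Complex.re)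
      (-(Z.map Complex.im)⁻¹) ((Z.map Complex.im)⁻¹ * Z.map Complex.re) := by
  rw [formMatrix_eq, stdForm, Matrix.fromBlocks_multiply]
  simp

theorem map_star_eq (Z : Matrix (Fin p) (Fin p) ℂ) : Z.map (starRingEnd ℂ) =
    (Z.map Complex.re).map Complex.ofReal - Complex.I • (Z.map Complex.im).map Complex.ofReal := by
  ext i j
  apply Complex.ext <;> simp

/-- The `√-1`-eigenspace of the complex structure attached to `Z` is the space `V10`. -/
theorem formMatrix_stdForm_mulVec_eq_iff {Z : Matrix (Fin p) (Fin p) ℂ}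
    (hZ : Z ∈ upperHalfPlane p) (u v : Fin p → ℂ) :
    (formMatrix Z * stdForm p ℝ).map Complex.ofReal *ᵥ Sum.elim u v =
      Complex.I • (Sum.elim u v : Fin p ⊕ Fin p → ℂ) ↔ u = Z.map (starRingEnd ℂ) *ᵥ v := by
  have hu := isUnit_det_of_posDef hZ.2
  rw [formMatrix_mul_stdForm, map_star_eq, Matrix.fromBlocks_map, Matrix.fromBlocks_mulVec]
  set Y := Z.map Complex.im
  set X := Z.map Complex.re
  have hYc : (Y.map Complex.ofReal) * (Y⁻¹.map Complex.ofReal) = 1 := by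
    rw [← map_ofReal_mul, Matrix.mul_nonsing_inv _ hu, map_ofReal_one]
  have hYc' : (Y⁻¹.map Complex.ofReal) * (Y.map Complex.ofReal) = 1 := by
    rw [← map_ofReal_mul, Matrix.nonsing_inv_mul _ hu, map_ofReal_one]
  have m1 : (-(X * Y⁻¹)).map Complex.ofReal = -(X.map Complex.ofReal * Y⁻¹.map Complex.ofReal) := by
    rw [← map_ofReal_mul]; ext i j; simp
  have m2 : (Y + X * Y⁻¹ * X).map Complex.ofReal = Y.map Complex.ofReal +
      X.map Complex.ofReal * Y⁻¹.map Complex.ofReal * X.map Complex.ofReal := by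
    rw [← map_ofReal_mul, ← map_ofReal_mul]; ext i j; simp
  have m3 : (-Y⁻¹).map Complex.ofReal = -(Y⁻¹.map Complex.ofReal) := by ext i j; simp
  rw [m1, m2, m3, map_ofReal_mul]
  clear m1 m2 m3
  generalize Y⁻¹.map Complex.ofReal = G at *
  generalize X.map Complex.ofReal = X at *
  generalize Y.map Complex.ofReal = Y at *
  simp only [Sum.elim_comp_inl, Sum.elim_comp_inr]
  rw [show Complex.I • (Sum.elim u v : Fin p ⊕ Fin p → ℂ) =
    Sum.elim (Complex.I • u) (Complex.I • v) by ext k; cases k <;> rfl, Sum.elim_eq_iff]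
  -- The second block row alone, multiplied by Y, reads -u + X v = √-1 Y v, which is the graph
  -- equation. Conversely, the first block row is a consequence of the second.
  constructor
  · rintro ⟨-, h2⟩
    have h3 := congrArg (fun w => Y *ᵥ w) h2
    simp only [Matrix.mulVec_add, Matrix.mulVec_neg, Matrix.mulVec_mulVec, hYc, ← mul_assoc, one_mul,
      Matrix.neg_mulVec, Matrix.one_mulVec, Matrix.mulVec_smul] at h3
    rw [Matrix.sub_mulVec, Matrix.smul_mulVec, ← h3]
    abel
  · intro h
    have h2 : -(G *ᵥ u) + G *ᵥ X *ᵥ v = Complex.I • v := by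
      rw [h, Matrix.sub_mulVec, Matrix.mulVec_sub, Matrix.smul_mulVec, Matrix.mulVec_smul,
        Matrix.mulVec_mulVec _ G Y, hYc', Matrix.one_mulVec]
      abel
    constructor
    · calc -(X * G) *ᵥ u + (Y + X * G * X) *ᵥ v =
            X *ᵥ (-(G *ᵥ u) + G *ᵥ X *ᵥ v) + Y *ᵥ v := by
            simp only [Matrix.neg_mulVec, Matrix.add_mulVec, Matrix.mulVec_add, Matrix.mulVec_neg,
              Matrix.mulVec_mulVec, mul_assoc]
            abel
        _ = Complex.I • u := by
            rw [h2, h, Matrix.mulVec_smul, Matrix.sub_mulVec, smul_sub, Matrix.smul_mulVec,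
              smul_smul, Complex.I_mul_I, neg_one_smul, sub_neg_eq_add]
    · rw [Matrix.neg_mulVec, ← Matrix.mulVec_mulVec, h2]

/-- A real matrix that kills V10 also kills the real and imaginary parts of its vectors. Those
include all (X w, w) and all (Y w, 0), which span the real space because Y is invertible. -/
theorem eq_zero_of_mulVec_graph {Z : Matrix (Fin p) (Fin p) ℂ} (hZ : Z ∈ upperHalfPlane p)
    {A : Matrix (Fin p ⊕ Fin p) (Fin p ⊕ Fin p) ℝ}
    (hA : ∀ v : Fin p → ℂ, A.map Complex.ofReal *ᵥ
      Sum.elim (Z.map (starRingEnd ℂ) *ᵥ v) v = 0) : A = 0 := by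
  have hu := isUnit_det_of_posDef hZ.2
  have him : ∀ u : Fin p ⊕ Fin p → ℂ, A.map Complex.ofReal *ᵥ u = 0 →
      A *ᵥ (fun k => (u k).re) = 0 ∧ A *ᵥ (fun k => (u k).im) = 0 := by
    intro u h
    constructor <;> ext k
    · have := congrArg Complex.re (congrFun h k)
      simpa [Matrix.mulVec, dotProduct] using this
    · have := congrArg Complex.im (congrFun h k)
      simpa [Matrix.mulVec, dotProduct] using this
  have h1 : ∀ w : Fin p → ℝ, A *ᵥ Sum.elim (Z.map Complex.re *ᵥ w) w = 0 ∧
      A *ᵥ Sum.elim (Z.map Complex.im *ᵥ w) 0 = 0 := by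
    intro w
    obtain ⟨h2, h3⟩ := him _ (hA fun j => (w j : ℂ))
    constructor
    · convert h2 using 2
      ext k
      rcases k with i | i
      · simp [Matrix.mulVec, dotProduct]
      · simp
    · rw [← neg_eq_zero, ← Matrix.mulVec_neg, ← h3]
      congr 1
      ext k
      rcases k with i | i
      · simp [Matrix.mulVec, dotProduct]
      · simp
  have h4 : ∀ a : Fin p → ℝ, A *ᵥ Sum.elim a 0 = 0 := by
    intro a
    have := (h1 ((Z.map Complex.im)⁻¹ *ᵥ a)).2
    rwa [Matrix.mulVec_mulVec, Matrix.mul_nonsing_inv _ hu, Matrix.one_mulVec] at this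
  have h5 : ∀ x, A *ᵥ x = 0 := by
    intro x
    have h6 : x = Sum.elim (Z.map Complex.re *ᵥ (x ∘ Sum.inr)) (x ∘ Sum.inr) +
        Sum.elim (x ∘ Sum.inl - Z.map Complex.re *ᵥ (x ∘ Sum.inr)) 0 := by
      ext k
      rcases k with i | i <;> simp
    rw [h6, Matrix.mulVec_add, (h1 _).1, h4, add_zero]
  exact Matrix.ext_of_mulVec_single fun i => by rw [h5, Matrix.zero_mulVec]

theorem mem_graphSubmodule_iff_mulVec {b : SymplecticBasis ω p} {W : Matrix (Fin p) (Fin p) ℂ}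
    {z : ℂ ⊗[ℝ] V} : z ∈ graphSubmodule b W ↔
      (fun i => b.complexBasis.repr z (Sum.inl i)) =
        W *ᵥ fun j => b.complexBasis.repr z (Sum.inr j) :=
  ⟨fun h => funext h, fun h => congrFun h⟩

theorem mem_graphSubmodule_iff_eigen {b : SymplecticBasis ω p} {Z : Matrix (Fin p) (Fin p) ℂ}
    (hZ : Z ∈ upperHalfPlane p) {z : ℂ ⊗[ℝ] V} :
    z ∈ graphSubmodule b (Z.map (starRingEnd ℂ)) ↔
      (formMatrix Z * stdForm p ℝ).map Complex.ofReal *ᵥ b.complexBasis.repr z =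
        Complex.I • (b.complexBasis.repr z : Fin p ⊕ Fin p → ℂ) := by
  rw [mem_graphSubmodule_iff_mulVec, ← formMatrix_stdForm_mulVec_eq_iff hZ]
  have : (Sum.elim (fun i => b.complexBasis.repr z (Sum.inl i))
      fun j => b.complexBasis.repr z (Sum.inr j)) = b.complexBasis.repr z :=
    Sum.elim_comp_inl_inr (b.complexBasis.repr z : Fin p ⊕ Fin p → ℂ)
  rw [this]

/-- The complex structures attached to `S` and `M S Mᵀ` are intertwined by `M`. -/
theorem intertwine_iff {M S₁ S₂ : Matrix (Fin p ⊕ Fin p) (Fin p ⊕ Fin p) ℝ}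
    (hM : Mᵀ * stdForm p ℝ * M = stdForm p ℝ) :
    S₂ * stdForm p ℝ * M = M * (S₁ * stdForm p ℝ) ↔ S₂ = M * S₁ * Mᵀ := by
  have hu : IsUnit (stdForm p ℝ * M) := isUnit_stdForm.mul (isUnit_of_symplectic hM)
  have : M * S₁ * Mᵀ * (stdForm p ℝ * M) = M * (S₁ * stdForm p ℝ) := by
    rw [← mul_assoc, mul_assoc (M * S₁), mul_assoc (M * S₁), hM, mul_assoc]
  rw [← this, mul_assoc S₂, hu.mul_left_inj]

/-- φ carries the √-1-eigenspace of S₁ J to that of S₂ J, so S₂ J M and M S₁ J agree on V10. Both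
are real, so they agree everywhere, and cancelling J M gives the congruence. -/
theorem formMatrix_eq_of_corresponds_act {b : SymplecticBasis ω p} {φ : Sp ω}
    {H : HodgeStructure ω} {Z₁ Z₂ : Matrix (Fin p) (Fin p) ℂ} (hZ₁ : Z₁ ∈ upperHalfPlane p)
    (hZ₂ : Z₂ ∈ upperHalfPlane p) (h₁ : Corresponds b Z₁ H) (h₂ : Corresponds b Z₂ (act φ H)) :
    formMatrix Z₂ = b.toMatrix φ * formMatrix Z₁ * (b.toMatrix φ)ᵀ := by
  rw [corresponds_iff] at h₁ h₂
  rw [← intertwine_iff (b.toMatrix_symplectic φ), ← sub_eq_zero]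
  refine eq_zero_of_mulVec_graph hZ₁ fun v => ?_
  set u : Fin p ⊕ Fin p → ℂ := Sum.elim (Z₁.map (starRingEnd ℂ) *ᵥ v) v with hu
  let z : ℂ ⊗[ℝ] V := ∑ k, u k • b.complexBasis k
  have hz : (b.complexBasis.repr z : Fin p ⊕ Fin p → ℂ) = u := b.complexBasis.repr_sum_self _
  have hz1 : z ∈ graphSubmodule b (Z₁.map (starRingEnd ℂ)) := by
    rw [mem_graphSubmodule_iff_eigen hZ₁, hz, hu, formMatrix_stdForm_mulVec_eq_iff hZ₁]
  have hz2 : complexify φ.1 z ∈ graphSubmodule b (Z₂.map (starRingEnd ℂ)) := by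
    rw [← h₂]
    exact ⟨z, by rw [h₁]; exact hz1, rfl⟩
  rw [mem_graphSubmodule_iff_eigen hZ₁, hz] at hz1
  rw [mem_graphSubmodule_iff_eigen hZ₂, b.repr_complexify, hz] at hz2
  have h3 : ∀ A B : Matrix (Fin p ⊕ Fin p) (Fin p ⊕ Fin p) ℝ,
      (A - B).map Complex.ofReal = A.map Complex.ofReal - B.map Complex.ofReal := by
    intro A B; ext i j; simp
  rw [h3, map_ofReal_mul _ (b.toMatrix φ), map_ofReal_mul (b.toMatrix φ), Matrix.sub_mulVec,
    ← Matrix.mulVec_mulVec, ← Matrix.mulVec_mulVec, hz1, hz2, Matrix.mulVec_smul, sub_self]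

/-- The converse: intertwined complex structures have corresponding √-1-eigenspaces. It identifies
the endpoint of an explicitly built curve. -/
theorem corresponds_act {b : SymplecticBasis ω p} {φ : Sp ω}
    {H : HodgeStructure ω} {Z₁ Z₂ : Matrix (Fin p) (Fin p) ℂ} (hZ₁ : Z₁ ∈ upperHalfPlane p)
    (hZ₂ : Z₂ ∈ upperHalfPlane p) (h₁ : Corresponds b Z₁ H)
    (hS : formMatrix Z₂ = b.toMatrix φ * formMatrix Z₁ * (b.toMatrix φ)ᵀ) :
    Corresponds b Z₂ (act φ H) := by
  rw [corresponds_iff] at h₁ ⊢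
  rw [← intertwine_iff (b.toMatrix_symplectic φ)] at hS
  have hS' := congrArg (fun A => A.map Complex.ofReal) hS
  rw [map_ofReal_mul _ (b.toMatrix φ), map_ofReal_mul (b.toMatrix φ)] at hS'
  have hinj : Function.Injective fun u => (b.toMatrix φ).map Complex.ofReal *ᵥ u := by
    refine Matrix.mulVec_injective_of_isUnit ?_
    exact (isUnit_of_symplectic (b.toMatrix_symplectic φ)).map Complex.ofRealHom.mapMatrix
  have key : ∀ z, complexify φ.1 z ∈ graphSubmodule b (Z₂.map (starRingEnd ℂ)) ↔
      z ∈ graphSubmodule b (Z₁.map (starRingEnd ℂ)) := by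
    intro z
    rw [mem_graphSubmodule_iff_eigen hZ₁, mem_graphSubmodule_iff_eigen hZ₂, b.repr_complexify,
      Matrix.mulVec_mulVec, hS', ← Matrix.mulVec_mulVec, ← Matrix.mulVec_smul]
    exact hinj.eq_iff
  ext w
  constructor
  · rintro ⟨z, hz, rfl⟩
    rw [h₁] at hz
    exact (key z).2 hz
  · intro hw
    obtain ⟨z, rfl⟩ := (complexify φ.1).surjective w
    exact ⟨z, by rw [h₁]; exact (key z).1 hw, rfl⟩

end Action

/-! ### The lower bound for the length of curves -/

section LowerBound

variable {p : ℕ}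

theorem IsCurve.hasEntryDeriv {γ : ℝ → Matrix (Fin p) (Fin p) ℂ} {Z W : Matrix (Fin p) (Fin p) ℂ}
    (hγ : IsCurve γ Z W) {t : ℝ} (ht : t ∈ Set.Ioo (0 : ℝ) 1) :
    HasEntryDeriv γ (velocity γ t) t := by
  intro i j
  have h := ((hγ.contDiffOn i j).differentiableOn one_ne_zero t (Set.Ioo_subset_Icc_self ht))
  exact h.hasDerivWithinAt.hasDerivAt (Icc_mem_nhds ht.1 ht.2)

theorem IsCurve.eventually_mem {γ : ℝ → Matrix (Fin p) (Fin p) ℂ}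
    {Z W : Matrix (Fin p) (Fin p) ℂ} (hγ : IsCurve γ Z W) {t : ℝ} (ht : t ∈ Set.Ioo (0 : ℝ) 1) :
    ∀ᶠ s in nhds t, γ s ∈ upperHalfPlane p := by
  filter_upwards [isOpen_Ioo.mem_nhds ht] with s hs using hγ.mem s (Set.Ioo_subset_Icc_self hs)

theorem IsCurve.entryContDiffOn_re {γ : ℝ → Matrix (Fin p) (Fin p) ℂ}
    {Z W : Matrix (Fin p) (Fin p) ℂ} (hγ : IsCurve γ Z W) :
    EntryContDiffOn (fun t => (γ t).map Complex.re) (Set.Icc 0 1) :=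
  fun i j => Complex.reCLM.contDiff.comp_contDiffOn (hγ.contDiffOn i j)

theorem IsCurve.entryContDiffOn_im {γ : ℝ → Matrix (Fin p) (Fin p) ℂ}
    {Z W : Matrix (Fin p) (Fin p) ℂ} (hγ : IsCurve γ Z W) :
    EntryContDiffOn (fun t => (γ t).map Complex.im) (Set.Icc 0 1) :=
  fun i j => Complex.imCLM.contDiff.comp_contDiffOn (hγ.contDiffOn i j)

theorem EntryContDiffOn.fromBlocks {l m o q : Type*} {A : ℝ → Matrix l m ℝ} {B : ℝ → Matrix l q ℝ}
    {C : ℝ → Matrix o m ℝ} {D : ℝ → Matrix o q ℝ} {s : Set ℝ} (hA : EntryContDiffOn A s)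
    (hB : EntryContDiffOn B s) (hC : EntryContDiffOn C s) (hD : EntryContDiffOn D s) :
    EntryContDiffOn (fun t => Matrix.fromBlocks (A t) (B t) (C t) (D t)) s := by
  rintro (i | i) (j | j)
  exacts [hA i j, hB i j, hC i j, hD i j]

theorem IsCurve.entryContDiffOn_formMatrix {γ : ℝ → Matrix (Fin p) (Fin p) ℂ}
    {Z W : Matrix (Fin p) (Fin p) ℂ} (hγ : IsCurve γ Z W) :
    EntryContDiffOn (fun t => formMatrix (γ t)) (Set.Icc 0 1) := by
  have h0 := fun (A : Matrix (Fin p) (Fin p) ℝ) => entryContDiffOn_const A (Set.Icc 0 1)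
  have hX := hγ.entryContDiffOn_re
  have hY := hγ.entryContDiffOn_im
  have hG := hY.inv fun t ht => (hγ.mem t ht).2.det_pos.ne'
  exact (((h0 1).fromBlocks hX (h0 0) (h0 1)).mul
    (hY.fromBlocks (h0 0) (h0 0) hG)).mul ((h0 1).fromBlocks (h0 0) hX (h0 1))

theorem continuousOn_sqrt_metricTensor {γ ξ : ℝ → Matrix (Fin p) (Fin p) ℂ} {s : Set ℝ}
    (hG : ContinuousOn (fun t => ((γ t).map Complex.im)⁻¹) s) (hξ : ContinuousOn ξ s) :
    ContinuousOn (fun t => √(metricTensor (γ t) (ξ t))) s := by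
  simp only [metricTensor_eq]
  have h : Continuous fun q : Matrix (Fin p) (Fin p) ℝ × Matrix (Fin p) (Fin p) ℂ =>
      √((q.1 * q.2.map Complex.re * q.1 * q.2.map Complex.re).trace +
        (q.1 * q.2.map Complex.im * q.1 * q.2.map Complex.im).trace) := by
    have hre : Continuous fun q : Matrix (Fin p) (Fin p) ℝ × Matrix (Fin p) (Fin p) ℂ =>
      q.2.map Complex.re := continuous_snd.matrix_map Complex.continuous_re
    have him : Continuous fun q : Matrix (Fin p) (Fin p) ℝ × Matrix (Fin p) (Fin p) ℂ =>
      q.2.map Complex.im := continuous_snd.matrix_map Complex.continuous_im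
    fun_prop
  exact (h.comp_continuousOn (hG.prodMk hξ) :)

theorem IsCurve.continuousOn_speed {γ : ℝ → Matrix (Fin p) (Fin p) ℂ}
    {Z W : Matrix (Fin p) (Fin p) ℂ} (hγ : IsCurve γ Z W) :
    ContinuousOn (fun t => √(metricTensor (γ t) (velocity γ t))) (Set.Icc 0 1) := by
  refine continuousOn_sqrt_metricTensor
    (hγ.entryContDiffOn_im.inv fun t ht => (hγ.mem t ht).2.det_pos.ne').continuousOn ?_
  refine continuousOn_pi.2 fun i => continuousOn_pi.2 fun j => ?_
  exact (hγ.contDiffOn i j).continuousOn_derivWithin (uniqueDiffOn_Icc zero_lt_one) le_rfl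

open scoped ComplexOrder in
theorem posDef_map_ofReal {n : Type*} [Fintype n] [DecidableEq n] {S : Matrix n n ℝ}
    (hS : S.PosDef) : (S.map Complex.ofReal).PosDef := by
  have hH : (S.map Complex.ofReal).IsHermitian := by
    ext i j
    rw [Matrix.conjTranspose_apply, Matrix.map_apply, Matrix.map_apply, Complex.star_def,
      Complex.conj_ofReal]
    exact congrArg _ (hS.isHermitian.apply i j)
  refine Matrix.PosDef.of_dotProduct_mulVec_pos hH fun x hx => ?_
  rw [Complex.pos_iff]
  refine ⟨?_, (hH.im_star_dotProduct_mulVec_self x).symm⟩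
  have h2 : (star x ⬝ᵥ S.map Complex.ofReal *ᵥ x).re =
      (fun i => (x i).re) ⬝ᵥ S *ᵥ (fun i => (x i).re) +
        (fun i => (x i).im) ⬝ᵥ S *ᵥ (fun i => (x i).im) := by
    simp only [dotProduct, Matrix.mulVec, Complex.re_sum, Finset.mul_sum,
      ← Finset.sum_add_distrib]
    refine Finset.sum_congr rfl fun i _ => Finset.sum_congr rfl fun j _ => ?_
    simp
  rw [h2]
  have hpd := (Matrix.posDef_iff_dotProduct_mulVec.1 hS).2
  have hps := fun x => (Matrix.posSemidef_iff_dotProduct_mulVec.1 hS.posSemidef).2 x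
  by_cases hre : (fun i => (x i).re) = 0
  · have him : (fun i => (x i).im) ≠ 0 := fun him => hx (by
      ext i; exact Complex.ext (congrFun hre i) (congrFun him i))
    exact add_pos_of_nonneg_of_pos (hps _) (hpd him)
  · exact add_pos_of_pos_of_nonneg (hpd hre) (hps _)

open scoped ComplexOrder in
/-- A curve of form matrices from `S` to `M S Mᵀ` is at least as long as the translation
part of `M`. -/
theorem sqrt_sum_log_sq_le_curveLength {γ : ℝ → Matrix (Fin p) (Fin p) ℂ}
    {Z W : Matrix (Fin p) (Fin p) ℂ} (hγ : IsCurve γ Z W)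
    {M : Matrix (Fin p ⊕ Fin p) (Fin p ⊕ Fin p) ℝ} (hM : IsUnit M)
    (hS : formMatrix W = M * formMatrix Z * Mᵀ) :
    √(((M.map Complex.ofReal).charpoly.roots.map fun l => (2 * Real.log ‖l‖) ^ 2).sum) ≤
      √2 * curveLength γ := by
  obtain ⟨n, B, B', hBB', hB'B, hT, hroots⟩ := exists_lowerTriangular (M.map Complex.ofReal)
  set T := B * M.map Complex.ofReal * B' with hTdef
  have hTB : T * B = B * M.map Complex.ofReal := by rw [hTdef, Matrix.mul_assoc, hB'B, Matrix.mul_one]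
  have hMc : IsUnit (M.map Complex.ofReal) := hM.map Complex.ofRealHom.mapMatrix
  have hT0 : ∀ i, T i i ≠ 0 := by
    intro i h0
    have hmem : (0 : ℂ) ∈ (M.map Complex.ofReal).charpoly.roots := by
      rw [hroots, Multiset.mem_map]
      exact ⟨i, Finset.mem_univ_val i, h0⟩
    have h1 := (Polynomial.mem_roots'.1 hmem).2
    rw [Polynomial.IsRoot.def, Matrix.eval_charpoly, map_zero, zero_sub, Matrix.det_neg] at h1
    have h2 := ((Matrix.isUnit_iff_isUnit_det _).1 hMc).ne_zero
    exact mul_ne_zero (pow_ne_zero _ (neg_ne_zero.2 one_ne_zero)) h2 h1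
  have hex : ∀ t ∈ Set.Ioo (0 : ℝ) 1, ∃ S', HasEntryDeriv (fun s => formMatrix (γ s)) S' t ∧
      S'ᵀ = S' ∧ ((formMatrix (γ t))⁻¹ * S' * (formMatrix (γ t))⁻¹ * S').trace =
        2 * metricTensor (γ t) (velocity γ t) := fun t ht =>
    exists_hasEntryDeriv_formMatrix (hγ.hasEntryDeriv ht) (hγ.eventually_mem ht)
  choose! S' hS'1 hS'2 hS'3 using hex
  have hBinj : Function.Injective fun x => x ᵥ* B := by
    intro x y hxy
    have := congrArg (fun z => z ᵥ* B') hxy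
    simpa [Matrix.vecMul_vecMul, hBB'] using this
  -- The path B S Bᴴ is isometric to S for the trace metric and ends at T P(0) Tᴴ because B M = T B.
  -- The speed is √2 times the Siegel speed.
  have hmain := sqrt_sum_log_sq_le_integral
    (P := fun t => B * (formMatrix (γ t)).map Complex.ofReal * Bᴴ)
    (Q := fun t => B * (S' t).map Complex.ofReal * Bᴴ)
    (σ := fun t => √2 * √(metricTensor (γ t) (velocity γ t)))
    (T := T) ?_ ?_ ?_ ?_ ?_ ?_ hT hT0 ?_
  · rw [intervalIntegral.integral_const_mul] at hmain
    rw [hroots, Multiset.map_map]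
    exact hmain
  · have hc : Continuous fun A : Matrix (Fin p ⊕ Fin p) (Fin p ⊕ Fin p) ℝ =>
        B * A.map Complex.ofReal * Bᴴ :=
      (continuous_const.matrix_mul (continuous_id.matrix_map Complex.continuous_ofReal)).matrix_mul
        continuous_const
    exact hc.comp_continuousOn hγ.entryContDiffOn_formMatrix.continuousOn
  · intro t ht
    exact (posDef_map_ofReal (formMatrix_posDef (hγ.mem t ht))).mul_mul_conjTranspose_same hBinj
  · intro t ht
    exact ((hS'1 t ht).map_ofReal.const_mul B).mul_const Bᴴ
  · intro t ht
    have h1 : ((S' t).map Complex.ofReal)ᴴ = (S' t).map Complex.ofReal := by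
      conv_rhs => rw [← hS'2 t ht]
      ext i j
      simp
    rw [Matrix.IsHermitian, Matrix.conjTranspose_mul, Matrix.conjTranspose_mul,
      Matrix.conjTranspose_conjTranspose, h1, Matrix.mul_assoc]
  · exact (continuousOn_const.mul hγ.continuousOn_speed).integrableOn_Icc
  · intro t ht
    rw [← Real.sqrt_mul zero_le_two, ← hS'3 t ht]
    congr 1
    have hu := isUnit_det_of_posDef (formMatrix_posDef (hγ.mem t (Set.Ioo_subset_Icc_self ht)))
    generalize formMatrix (γ t) = S at hu
    generalize S' t = S'
    have hBB'H : Bᴴ * B'ᴴ = 1 := by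
      rw [← Matrix.conjTranspose_mul, hB'B, Matrix.conjTranspose_one]
    have hBB'H' : B'ᴴ * Bᴴ = 1 := by
      rw [← Matrix.conjTranspose_mul, hBB', Matrix.conjTranspose_one]
    have hinv : (B * S.map Complex.ofReal * Bᴴ)⁻¹ = B'ᴴ * S⁻¹.map Complex.ofReal * B' := by
      refine Matrix.inv_eq_left_inv ?_
      calc B'ᴴ * S⁻¹.map Complex.ofReal * B' * (B * S.map Complex.ofReal * Bᴴ) =
            B'ᴴ * (S⁻¹.map Complex.ofReal * (B' * B) * S.map Complex.ofReal) * Bᴴ := by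
            simp only [Matrix.mul_assoc]
        _ = 1 := by
            rw [hB'B, Matrix.mul_one, ← map_ofReal_mul, Matrix.nonsing_inv_mul _ hu,
              map_ofReal_one, Matrix.mul_one, hBB'H']
    rw [hinv]
    set G := S⁻¹
    have h1 : B'ᴴ * G.map Complex.ofReal * B' * (B * S'.map Complex.ofReal * Bᴴ) *
        (B'ᴴ * G.map Complex.ofReal * B') * (B * S'.map Complex.ofReal * Bᴴ) =
        B'ᴴ * ((G * S' * G * S').map Complex.ofReal * Bᴴ) := by
      calc _ = B'ᴴ * (G.map Complex.ofReal * (B' * B) * S'.map Complex.ofReal * (Bᴴ * B'ᴴ) *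
            G.map Complex.ofReal * (B' * B) * S'.map Complex.ofReal) * Bᴴ := by
            simp only [Matrix.mul_assoc]
        _ = _ := by
            rw [hB'B, hBB'H]
            simp only [Matrix.mul_one, map_ofReal_mul, Matrix.mul_assoc]
    rw [h1, Matrix.trace_mul_comm (B'ᴴ), Matrix.mul_assoc _ Bᴴ, hBB'H, Matrix.mul_one]
    simp [Matrix.trace, Complex.re_sum]
  · simp only [hγ.source, hγ.target, hS]
    rw [map_ofReal_mul, map_ofReal_mul]
    have h1 : Mᵀ.map Complex.ofReal = (M.map Complex.ofReal)ᴴ := by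
      ext i j
      simp
    calc B * (M.map Complex.ofReal * (formMatrix Z).map Complex.ofReal * Mᵀ.map Complex.ofReal) * Bᴴ
        = (B * M.map Complex.ofReal) * (formMatrix Z).map Complex.ofReal *
            (B * M.map Complex.ofReal)ᴴ := by
          rw [Matrix.conjTranspose_mul, h1]; simp only [Matrix.mul_assoc]
      _ = _ := by
          rw [← hTB, Matrix.conjTranspose_mul]; simp only [Matrix.mul_assoc]

end LowerBound

/-! ### Invariance of the Siegel metric -/

section Invariance

variable {p : ℕ}

/-- The transpose of a symplectic matrix is symplectic: the left inverse -J hᵀ J of h is also a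
right inverse. -/
theorem mul_stdForm_mul_transpose {h : Matrix (Fin p ⊕ Fin p) (Fin p ⊕ Fin p) ℝ}
    (hh : hᵀ * stdForm p ℝ * h = stdForm p ℝ) : h * stdForm p ℝ * hᵀ = stdForm p ℝ := by
  have h1 : (-stdForm p ℝ * hᵀ * stdForm p ℝ) * h = 1 := by
    rw [mul_assoc, mul_assoc, ← mul_assoc hᵀ, hh, neg_mul, stdForm_mul_self, neg_neg]
  have h2 := mul_eq_one_comm.1 h1
  calc h * stdForm p ℝ * hᵀ = h * (-stdForm p ℝ * hᵀ * stdForm p ℝ) * stdForm p ℝ := by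
        simp only [neg_mul, mul_neg, mul_assoc, stdForm_mul_self, mul_one, neg_neg]
    _ = stdForm p ℝ := by rw [h2, one_mul]

theorem posDef_conj {h S : Matrix (Fin p ⊕ Fin p) (Fin p ⊕ Fin p) ℝ} (hh : IsUnit h)
    (hS : S.PosDef) : (h * S * hᵀ).PosDef := by
  rw [← Matrix.conjTranspose_eq_transpose_of_trivial]
  exact hS.mul_mul_conjTranspose_same (Matrix.vecMul_injective_of_isUnit hh)

theorem symplectic_conj {h S : Matrix (Fin p ⊕ Fin p) (Fin p ⊕ Fin p) ℝ}
    (hh : hᵀ * stdForm p ℝ * h = stdForm p ℝ) (hS : S * stdForm p ℝ * S = stdForm p ℝ) :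
    h * S * hᵀ * stdForm p ℝ * (h * S * hᵀ) = stdForm p ℝ := by
  calc h * S * hᵀ * stdForm p ℝ * (h * S * hᵀ) =
        h * (S * (hᵀ * stdForm p ℝ * h) * S) * hᵀ := by simp only [mul_assoc]
    _ = stdForm p ℝ := by rw [hh, hS, mul_stdForm_mul_transpose hh]

/-- The action of a symplectic matrix on the upper half plane. -/
def smulUpperHalfPlane (h : Matrix (Fin p ⊕ Fin p) (Fin p ⊕ Fin p) ℝ)
    (Z : Matrix (Fin p) (Fin p) ℂ) : Matrix (Fin p) (Fin p) ℂ :=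
  ofFormMatrix (h * formMatrix Z * hᵀ)

theorem smulUpperHalfPlane_spec {h : Matrix (Fin p ⊕ Fin p) (Fin p ⊕ Fin p) ℝ}
    (hh : hᵀ * stdForm p ℝ * h = stdForm p ℝ) {Z : Matrix (Fin p) (Fin p) ℂ}
    (hZ : Z ∈ upperHalfPlane p) : smulUpperHalfPlane h Z ∈ upperHalfPlane p ∧
      formMatrix (smulUpperHalfPlane h Z) = h * formMatrix Z * hᵀ :=
  ofFormMatrix_spec (posDef_conj (isUnit_of_symplectic hh) (formMatrix_posDef hZ))
    (symplectic_conj hh (formMatrix_symplectic hZ))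

theorem IsCurve.smul {h : Matrix (Fin p ⊕ Fin p) (Fin p ⊕ Fin p) ℝ}
    (hh : hᵀ * stdForm p ℝ * h = stdForm p ℝ) {γ : ℝ → Matrix (Fin p) (Fin p) ℂ}
    {Z W : Matrix (Fin p) (Fin p) ℂ} (hγ : IsCurve γ Z W) :
    IsCurve (fun t => smulUpperHalfPlane h (γ t)) (smulUpperHalfPlane h Z)
      (smulUpperHalfPlane h W) where
  contDiffOn := by
    have hS := ((entryContDiffOn_const h (Set.Icc 0 1)).mul hγ.entryContDiffOn_formMatrix).mul
      (entryContDiffOn_const hᵀ (Set.Icc 0 1))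
    have hd : EntryContDiffOn (fun t => (h * formMatrix (γ t) * hᵀ).toBlocks₂₂⁻¹)
        (Set.Icc 0 1) := by
      refine EntryContDiffOn.inv (fun i j => hS (Sum.inr i) (Sum.inr j)) fun t ht => ?_
      have hpd := (posDef_conj (isUnit_of_symplectic hh) (formMatrix_posDef (hγ.mem t ht))).submatrix
        (e := Sum.inr) Sum.inr_injective
      exact hpd.det_pos.ne'
    have hb : EntryContDiffOn (fun t => (h * formMatrix (γ t) * hᵀ).toBlocks₁₂)
        (Set.Icc 0 1) := fun i j => hS (Sum.inl i) (Sum.inr j)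
    intro i j
    exact (Complex.ofRealCLM.contDiff.comp_contDiffOn (hb.mul hd i j)).add
      (contDiffOn_const.mul (Complex.ofRealCLM.contDiff.comp_contDiffOn (hd i j)))
  mem := fun t ht => (smulUpperHalfPlane_spec hh (hγ.mem t ht)).1
  source := by rw [hγ.source]
  target := by rw [hγ.target]

theorem trace_conj_inv {n : Type*} [Fintype n] [DecidableEq n] {h : Matrix n n ℝ} (hh : IsUnit h)
    (S Q : Matrix n n ℝ) :
    ((h * S * hᵀ)⁻¹ * (h * Q * hᵀ) * (h * S * hᵀ)⁻¹ * (h * Q * hᵀ)).trace =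
      (S⁻¹ * Q * S⁻¹ * Q).trace := by
  have hhu := (Matrix.isUnit_iff_isUnit_det _).1 hh
  have hhu' : IsUnit hᵀ.det := by rwa [Matrix.det_transpose]
  have e1 := Matrix.nonsing_inv_mul _ hhu
  have e2 := Matrix.mul_nonsing_inv _ hhu'
  rw [Matrix.mul_inv_rev, Matrix.mul_inv_rev]
  generalize S⁻¹ = G
  generalize h⁻¹ = k at *
  generalize hᵀ⁻¹ = k' at *
  generalize hᵀ = h' at *
  calc _ = (k' * (G * (k * h) * Q * (h' * k') * G * (k * h) * Q * h')).trace := by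
        simp only [mul_assoc]
    _ = _ := by
        rw [e1, e2, Matrix.trace_mul_comm]
        simp only [mul_one, mul_assoc, e2]

/-- Invariance is inherited from the trace metric, for which congruence by any invertible matrix is
an isometry; no fractional linear formula is differentiated. -/
theorem metricTensor_smul {h : Matrix (Fin p ⊕ Fin p) (Fin p ⊕ Fin p) ℝ}
    (hh : hᵀ * stdForm p ℝ * h = stdForm p ℝ) {γ : ℝ → Matrix (Fin p) (Fin p) ℂ}
    {Z W : Matrix (Fin p) (Fin p) ℂ} (hγ : IsCurve γ Z W) {t : ℝ} (ht : t ∈ Set.Ioo (0 : ℝ) 1) :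
    metricTensor (smulUpperHalfPlane h (γ t)) (velocity (fun t => smulUpperHalfPlane h (γ t)) t) =
      metricTensor (γ t) (velocity γ t) := by
  have hγ' := hγ.smul hh
  obtain ⟨S', h1, -, h3⟩ :=
    exists_hasEntryDeriv_formMatrix (hγ.hasEntryDeriv ht) (hγ.eventually_mem ht)
  obtain ⟨R', k1, -, k3⟩ :=
    exists_hasEntryDeriv_formMatrix (hγ'.hasEntryDeriv ht) (hγ'.eventually_mem ht)
  have hR : R' = h * S' * hᵀ := by
    refine k1.unique (((h1.const_mul h).mul_const hᵀ).congr_of_eventuallyEq ?_)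
    filter_upwards [hγ.eventually_mem ht] with s hs using (smulUpperHalfPlane_spec hh hs).2
  have hmem := hγ.mem t (Set.Ioo_subset_Icc_self ht)
  rw [(smulUpperHalfPlane_spec hh hmem).2, hR, trace_conj_inv (isUnit_of_symplectic hh), h3] at k3
  exact (mul_left_cancel₀ two_ne_zero k3).symm

theorem curveLength_smul {h : Matrix (Fin p ⊕ Fin p) (Fin p ⊕ Fin p) ℝ}
    (hh : hᵀ * stdForm p ℝ * h = stdForm p ℝ) {γ : ℝ → Matrix (Fin p) (Fin p) ℂ}
    {Z W : Matrix (Fin p) (Fin p) ℂ} (hγ : IsCurve γ Z W) :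
    curveLength (fun t => smulUpperHalfPlane h (γ t)) = curveLength γ := by
  unfold curveLength
  -- The speeds were compared only at interior times; the endpoints form a null set.
  rw [intervalIntegral.integral_of_le zero_le_one, intervalIntegral.integral_of_le zero_le_one,
    MeasureTheory.integral_Ioc_eq_integral_Ioo, MeasureTheory.integral_Ioc_eq_integral_Ioo]
  refine MeasureTheory.setIntegral_congr_fun measurableSet_Ioo fun t ht => ?_
  exact congrArg Real.sqrt (metricTensor_smul hh hγ ht)

end Invariance

/-! ### Model curves from the base point -/

section ModelCurve

variable {p : ℕ}

/-- The base point `√-1 • 1` of the upper half plane. -/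
def basePoint (p : ℕ) : Matrix (Fin p) (Fin p) ℂ := Complex.I • 1

theorem map_im_basePoint : (basePoint p).map Complex.im = 1 := by
  ext i j
  rcases eq_or_ne i j with rfl | h
  · simp [basePoint]
  · simp [basePoint, h]

theorem map_re_basePoint : (basePoint p).map Complex.re = 0 := by
  ext i j
  rcases eq_or_ne i j with rfl | h
  · simp [basePoint]
  · simp [basePoint, h]

theorem basePoint_mem : basePoint p ∈ upperHalfPlane p :=
  ⟨by simp [basePoint], by rw [map_im_basePoint]; exact Matrix.PosDef.one⟩

theorem formMatrix_basePoint : formMatrix (basePoint p) = 1 := by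
  rw [formMatrix_eq, map_im_basePoint, map_re_basePoint]
  simp

/-- The curve `t ↦ e^{tl} ((1 - t) √-1 + t V) e^{tl}`. -/
def modelCurve (l : Fin p → ℝ) (V : Matrix (Fin p) (Fin p) ℂ) (t : ℝ) :
    Matrix (Fin p) (Fin p) ℂ :=
  Matrix.of fun i j => (Real.exp (t * l i) : ℂ) *
    ((1 - t) * basePoint p i j + t * V i j) * (Real.exp (t * l j) : ℂ)

/-- The velocity of `modelCurve`. -/
def modelVelocity (l : Fin p → ℝ) (V : Matrix (Fin p) (Fin p) ℂ) (t : ℝ) :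
    Matrix (Fin p) (Fin p) ℂ :=
  Matrix.of fun i j => (l i + l j : ℂ) * modelCurve l V t i j +
    (Real.exp (t * l i) : ℂ) * (V i j - basePoint p i j) * (Real.exp (t * l j) : ℂ)

theorem hasEntryDeriv_modelCurve (l : Fin p → ℝ) (V : Matrix (Fin p) (Fin p) ℂ) (t : ℝ) :
    HasEntryDeriv (modelCurve l V) (modelVelocity l V t) t := by
  intro i j
  have he : ∀ a : ℝ, HasDerivAt (fun s : ℝ => (Real.exp (s * a) : ℂ))
      ((Real.exp (t * a) * a : ℝ) : ℂ) t := fun a => by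
    have := ((hasDerivAt_id t).mul_const a).exp.ofReal_comp
    simpa using this
  have hid : HasDerivAt (fun s : ℝ => (s : ℂ)) 1 t := (hasDerivAt_id t).ofReal_comp
  have hm : HasDerivAt (fun s : ℝ => (1 - (s : ℂ)) * basePoint p i j + s * V i j)
      (V i j - basePoint p i j) t := by
    refine (((hid.const_sub 1).mul_const (basePoint p i j)).add
      (hid.mul_const (V i j))).congr_deriv ?_
    ring
  refine (((he (l i)).mul hm).mul (he (l j))).congr_deriv ?_
  simp only [modelVelocity, modelCurve, Matrix.of_apply, Pi.mul_apply, Complex.ofReal_mul]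
  ring

theorem modelCurve_zero (l : Fin p → ℝ) (V : Matrix (Fin p) (Fin p) ℂ) :
    modelCurve l V 0 = basePoint p := by
  ext i j
  simp [modelCurve]

theorem modelCurve_mem (l : Fin p → ℝ) {V : Matrix (Fin p) (Fin p) ℂ}
    (hV : V ∈ upperHalfPlane p) {t : ℝ} (ht : t ∈ Set.Icc (0 : ℝ) 1) :
    modelCurve l V t ∈ upperHalfPlane p := by
  constructor
  · ext i j
    have h1 := congrFun₂ hV.1 i j
    have h2 := congrFun₂ (basePoint_mem (p := p)).1 i j
    rw [Matrix.transpose_apply] at h1 h2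
    simp only [modelCurve, Matrix.transpose_apply, Matrix.of_apply, h1, h2]
    ring
  · set D : Matrix (Fin p) (Fin p) ℝ := Matrix.diagonal fun i => Real.exp (t * l i) with hD
    have him : (modelCurve l V t).map Complex.im =
        D * ((1 - t) • (1 : Matrix (Fin p) (Fin p) ℝ) + t • V.map Complex.im) * Dᴴ := by
      rw [hD, Matrix.diagonal_conjTranspose]
      ext i j
      rw [Matrix.mul_diagonal, Matrix.diagonal_mul, ← map_im_basePoint]
      simp only [modelCurve, Matrix.map_apply, Matrix.of_apply, Matrix.add_apply,
        Matrix.smul_apply, Pi.star_apply, star_trivial, smul_eq_mul]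
      rw [Complex.im_mul_ofReal, Complex.im_ofReal_mul, Complex.add_im, Complex.im_ofReal_mul,
        ← Complex.ofReal_one, ← Complex.ofReal_sub, Complex.im_ofReal_mul]
    have hDu : IsUnit D := by
      rw [Matrix.isUnit_iff_isUnit_det, hD, Matrix.det_diagonal]
      exact (Finset.prod_ne_zero_iff.2 fun i _ => (Real.exp_pos _).ne').isUnit
    rw [him]
    refine Matrix.PosDef.mul_mul_conjTranspose_same ?_ (Matrix.vecMul_injective_of_isUnit hDu)
    rcases ht.1.eq_or_lt with h0 | h0
    · rw [← h0]
      simpa using Matrix.PosDef.one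
    · exact Matrix.PosDef.posSemidef_add (Matrix.PosSemidef.one.smul (sub_nonneg.2 ht.2))
        (hV.2.smul h0)

theorem isCurve_modelCurve (l : Fin p → ℝ) {V : Matrix (Fin p) (Fin p) ℂ}
    (hV : V ∈ upperHalfPlane p) : IsCurve (modelCurve l V) (basePoint p) (modelCurve l V 1) where
  contDiffOn := by
    intro i j
    have he : ∀ a : ℝ, ContDiff ℝ 1 (fun s : ℝ => (Real.exp (s * a) : ℂ)) := fun a =>
      Complex.ofRealCLM.contDiff.comp (Real.contDiff_exp.comp (contDiff_id.mul contDiff_const))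
    have hid : ContDiff ℝ 1 (fun s : ℝ => (s : ℂ)) := Complex.ofRealCLM.contDiff
    have h := ((he (l i)).mul (((contDiff_const (c := (1 : ℂ)).sub hid).mul
      (contDiff_const (c := basePoint p i j))).add (hid.mul (contDiff_const (c := V i j))))).mul
      (he (l j))
    exact h.contDiffOn
  mem := fun t ht => modelCurve_mem l hV ht
  source := modelCurve_zero l V
  target := rfl

theorem velocity_modelCurve (l : Fin p → ℝ) (V : Matrix (Fin p) (Fin p) ℂ) {t : ℝ}
    (ht : t ∈ Set.Icc (0 : ℝ) 1) : velocity (modelCurve l V) t = modelVelocity l V t := by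
  ext i j
  exact ((hasEntryDeriv_modelCurve l V t i j).hasDerivWithinAt).derivWithin
    (uniqueDiffOn_Icc zero_lt_one t ht)

theorem continuous_modelCurve (l : Fin p → ℝ) :
    Continuous fun q : Matrix (Fin p) (Fin p) ℂ × ℝ => modelCurve l q.1 q.2 := by
  refine continuous_matrix fun i j => ?_
  simp only [modelCurve, Matrix.of_apply]
  have h : Continuous fun q : Matrix (Fin p) (Fin p) ℂ × ℝ => q.1 i j :=
    continuous_fst.matrix_elem i j
  fun_prop

theorem continuous_modelVelocity (l : Fin p → ℝ) :
    Continuous fun q : Matrix (Fin p) (Fin p) ℂ × ℝ => modelVelocity l q.1 q.2 := by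
  refine continuous_matrix fun i j => ?_
  simp only [modelVelocity, Matrix.of_apply]
  have h : Continuous fun q : Matrix (Fin p) (Fin p) ℂ × ℝ => q.1 i j :=
    continuous_fst.matrix_elem i j
  have h2 : Continuous fun q : Matrix (Fin p) (Fin p) ℂ × ℝ => modelCurve l q.1 q.2 i j :=
    (continuous_modelCurve l).matrix_elem i j
  fun_prop

theorem continuousAt_matrix_inv {n : Type*} [Fintype n] [DecidableEq n] {A : Matrix n n ℝ}
    (hA : A.det ≠ 0) : ContinuousAt (fun B : Matrix n n ℝ => B⁻¹) A := by
  simp only [Matrix.inv_def, Ring.inverse_eq_inv]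
  have h1 : ContinuousAt (fun B : Matrix n n ℝ => B.det) A :=
    (continuous_id.matrix_det).continuousAt
  exact (h1.inv₀ hA).smul (continuous_id.matrix_adjugate).continuousAt

theorem continuousAt_sqrt_metricTensor {Z ξ : Matrix (Fin p) (Fin p) ℂ}
    (hZ : (Z.map Complex.im).det ≠ 0) :
    ContinuousAt (fun q : Matrix (Fin p) (Fin p) ℂ × Matrix (Fin p) (Fin p) ℂ =>
      √(metricTensor q.1 q.2)) (Z, ξ) := by
  simp only [metricTensor_eq]
  have h : Continuous fun q : Matrix (Fin p) (Fin p) ℝ × Matrix (Fin p) (Fin p) ℂ =>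
      √((q.1 * q.2.map Complex.re * q.1 * q.2.map Complex.re).trace +
        (q.1 * q.2.map Complex.im * q.1 * q.2.map Complex.im).trace) := by
    have hre : Continuous fun q : Matrix (Fin p) (Fin p) ℝ × Matrix (Fin p) (Fin p) ℂ =>
      q.2.map Complex.re := continuous_snd.matrix_map Complex.continuous_re
    have him : Continuous fun q : Matrix (Fin p) (Fin p) ℝ × Matrix (Fin p) (Fin p) ℂ =>
      q.2.map Complex.im := continuous_snd.matrix_map Complex.continuous_im
    fun_prop
  have hinv : ContinuousAt (fun q : Matrix (Fin p) (Fin p) ℂ × Matrix (Fin p) (Fin p) ℂ =>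
      (q.1.map Complex.im)⁻¹) (Z, ξ) :=
    ContinuousAt.comp (g := fun B : Matrix (Fin p) (Fin p) ℝ => B⁻¹) (continuousAt_matrix_inv hZ)
      (continuous_fst.matrix_map Complex.continuous_im).continuousAt
  have hpair := hinv.prodMk (continuous_snd (X := Matrix (Fin p) (Fin p) ℂ)
    (Y := Matrix (Fin p) (Fin p) ℂ)).continuousAt
  exact (ContinuousAt.comp h.continuousAt hpair :)

/-- For V = √-1 the curve is the diagonal one √-1 e^{2tl}, whose speed is constant. -/
theorem metricTensor_modelCurve_basePoint (l : Fin p → ℝ) (t : ℝ) :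
    metricTensor (modelCurve l (basePoint p) t) (modelVelocity l (basePoint p) t) =
      ∑ i, (2 * l i) ^ 2 := by
  have h1 : (modelCurve l (basePoint p) t).map Complex.im =
      Matrix.diagonal fun i => Real.exp (t * l i) * Real.exp (t * l i) := by
    ext i j
    rcases eq_or_ne i j with rfl | h
    · simp [modelCurve, basePoint, -Complex.ofReal_exp]
    · simp [modelCurve, basePoint, h]
  have h2 : (modelVelocity l (basePoint p) t).map Complex.re = 0 := by
    ext i j
    rcases eq_or_ne i j with rfl | h
    · simp [modelVelocity, modelCurve, basePoint, -Complex.ofReal_exp]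
    · simp [modelVelocity, modelCurve, basePoint, h]
  have h3 : (modelVelocity l (basePoint p) t).map Complex.im =
      Matrix.diagonal fun i => 2 * l i * (Real.exp (t * l i) * Real.exp (t * l i)) := by
    ext i j
    rcases eq_or_ne i j with rfl | h
    · simp [modelVelocity, modelCurve, basePoint, -Complex.ofReal_exp]
      ring
    · simp [modelVelocity, modelCurve, basePoint, h]
  have hinv : (Matrix.diagonal fun i => Real.exp (t * l i) * Real.exp (t * l i))⁻¹ =
      Matrix.diagonal fun i => (Real.exp (t * l i) * Real.exp (t * l i))⁻¹ := by
    refine Matrix.inv_eq_left_inv ?_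
    rw [Matrix.diagonal_mul_diagonal, ← Matrix.diagonal_one]
    congr 1
    ext i
    exact inv_mul_cancel₀ (mul_pos (Real.exp_pos _) (Real.exp_pos _)).ne'
  rw [metricTensor_eq, h1, h2, h3, hinv, Matrix.diagonal_mul_diagonal,
    Matrix.diagonal_mul_diagonal, Matrix.diagonal_mul_diagonal, mul_zero, Matrix.trace_zero,
    zero_add, Matrix.trace_diagonal]
  refine Finset.sum_congr rfl fun i _ => ?_
  have := (Real.exp_pos (t * l i)).ne'
  field_simp

/-- The speed is jointly continuous in V and t, and [0,1] is compact, so near V = √-1 it exceeds the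
constant speed of the diagonal curve by at most ε, uniformly in t. The bound is needed because the
endpoint only approaches the diagonal one. -/
theorem eventually_curveLength_modelCurve_le (l : Fin p → ℝ) {ε : ℝ} (hε : 0 < ε) :
    ∀ᶠ V in nhds (basePoint p), V ∈ upperHalfPlane p →
      curveLength (modelCurve l V) ≤ √(∑ i, (2 * l i) ^ 2) + ε := by
  have hev : ∀ᶠ V in nhds (basePoint p), ∀ t ∈ Set.Icc (0 : ℝ) 1,
      √(metricTensor (modelCurve l V t) (modelVelocity l V t)) < √(∑ i, (2 * l i) ^ 2) + ε := by
    refine isCompact_Icc.eventually_forall_of_forall_eventually fun t ht => ?_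
    have hc := ContinuousAt.comp (x := ((basePoint p, t) : Matrix (Fin p) (Fin p) ℂ × ℝ))
      (f := fun q : Matrix (Fin p) (Fin p) ℂ × ℝ =>
        (modelCurve l q.1 q.2, modelVelocity l q.1 q.2))
      (continuousAt_sqrt_metricTensor (modelCurve_mem l basePoint_mem ht).2.det_pos.ne')
      ((continuous_modelCurve l).prodMk (continuous_modelVelocity l)).continuousAt
    have hlt : √(metricTensor (modelCurve l (basePoint p) t) (modelVelocity l (basePoint p) t)) <
        √(∑ i, (2 * l i) ^ 2) + ε := by
      rw [metricTensor_modelCurve_basePoint]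
      linarith
    exact Filter.Tendsto.eventually_lt_const hlt hc
  filter_upwards [hev] with V hV hVmem
  have hcurve := isCurve_modelCurve l hVmem
  have hint := hcurve.continuousOn_speed.intervalIntegrable_of_Icc (μ := MeasureTheory.volume)
    zero_le_one
  calc curveLength (modelCurve l V) ≤ ∫ _t in (0 : ℝ)..1, (√(∑ i, (2 * l i) ^ 2) + ε) := by
        refine intervalIntegral.integral_mono_on zero_le_one hint intervalIntegrable_const
          fun t ht => ?_
        rw [velocity_modelCurve l V ht]
        exact (hV t ht).le
    _ = √(∑ i, (2 * l i) ^ 2) + ε := by simp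

end ModelCurve

/-! ### Symplectic families -/

section Families

variable {V : Type*} [AddCommGroup V] [Module ℝ V] {ω : LinearMap.BilinForm ℝ V}
  {ι κ : Type*} [DecidableEq ι] [DecidableEq κ]

/-- The pairings of the vectors `x i` and `y i` are those of a symplectic basis. -/
structure IsSymplecticFamily {ι V : Type*} [AddCommGroup V] [Module ℝ V] [DecidableEq ι]
    (ω : LinearMap.BilinForm ℝ V) (x y : ι → V) : Prop where
  alt : ω.IsAlt
  inl_inl : ∀ i j, ω (x i) (x j) = 0
  inr_inr : ∀ i j, ω (y i) (y j) = 0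
  inl_inr : ∀ i j, ω (x i) (y j) = if i = j then 1 else 0

theorem IsSymplecticFamily.inr_inl {x y : ι → V} (h : IsSymplecticFamily ω x y) (i j : ι) :
    ω (y i) (x j) = if i = j then -1 else 0 := by
  rw [← LinearMap.BilinForm.IsAlt.neg_eq h.alt, h.inl_inr]
  by_cases hij : i = j
  · simp [hij]
  · simp [hij, Ne.symm hij]

/-- Pairing with y_j extracts the x_j-coefficient, and pairing with x_j the y_j-coefficient.
Coordinates, independence and complements of symplectic families all rest on this. -/
theorem IsSymplecticFamily.form_sum_left [Fintype ι] {x y : ι → V} (h : IsSymplecticFamily ω x y)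
    (a c : ι → ℝ) (j : ι) :
    ω (∑ i, a i • x i + ∑ i, c i • y i) (y j) = a j ∧
      ω (x j) (∑ i, a i • x i + ∑ i, c i • y i) = c j := by
  constructor
  · simp [map_sum, LinearMap.sum_apply, h.inr_inr, h.inl_inr]
  · simp [map_sum, h.inl_inl, h.inl_inr]

/-- The coordinates in a symplectic basis are given by the symplectic form. -/
theorem IsSymplecticFamily.repr_inl [Fintype ι] {b : Module.Basis (ι ⊕ ι) ℝ V}
    (h : IsSymplecticFamily ω (fun i => b (Sum.inl i)) (fun i => b (Sum.inr i))) (v : V) (i : ι) :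
    b.repr v (Sum.inl i) = ω v (b (Sum.inr i)) := by
  conv_rhs => rw [← b.sum_repr v, Fintype.sum_sum_type]
  exact (h.form_sum_left (fun j => b.repr v (Sum.inl j)) (fun j => b.repr v (Sum.inr j)) i).1.symm

theorem IsSymplecticFamily.repr_inr [Fintype ι] {b : Module.Basis (ι ⊕ ι) ℝ V}
    (h : IsSymplecticFamily ω (fun i => b (Sum.inl i)) (fun i => b (Sum.inr i))) (v : V) (i : ι) :
    b.repr v (Sum.inr i) = ω (b (Sum.inl i)) v := by
  conv_rhs => rw [← b.sum_repr v, Fintype.sum_sum_type]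
  exact (h.form_sum_left (fun j => b.repr v (Sum.inl j)) (fun j => b.repr v (Sum.inr j)) i).2.symm

/-- The symplectic orthogonal complement of a symplectic family. -/
def symplecticPerp {κ : Type*} (ω : LinearMap.BilinForm ℝ V) (x y : κ → V) : Submodule ℝ V where
  carrier := {v | ∀ i, ω (x i) v = 0 ∧ ω (y i) v = 0}
  zero_mem' := fun i => by simp
  add_mem' := fun {v w} hv hw i => by simp [hv i, hw i]
  smul_mem' := fun c v hv i => by simp [hv i]

/-- The remainder of `v` after subtracting its components along a symplectic family. -/
def perpPart {κ : Type*} [Fintype κ] (ω : LinearMap.BilinForm ℝ V) (x y : κ → V) (v : V) : V :=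
  v - (∑ i, ω v (y i) • x i + ∑ i, ω (x i) v • y i)

theorem IsSymplecticFamily.perpPart_mem [Fintype κ] {x y : κ → V}
    (h : IsSymplecticFamily ω x y) (v : V) :
    perpPart ω x y v ∈ symplecticPerp ω x y := by
  intro j
  obtain ⟨h1, h2⟩ := h.form_sum_left (fun i => ω v (y i)) (fun i => ω (x i) v) j
  constructor
  · rw [perpPart, map_sub, h2, sub_self]
  · rw [← LinearMap.BilinForm.IsAlt.neg_eq h.alt, perpPart, map_sub, LinearMap.sub_apply, h1,
      sub_self, neg_zero]

theorem perpPart_add {κ : Type*} [Fintype κ] (x y : κ → V) (v : V) :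
    v = perpPart ω x y v + (∑ i, ω v (y i) • x i + ∑ i, ω (x i) v • y i) :=
  (sub_add_cancel _ _).symm

theorem IsSymplecticFamily.alt_restrict {x y : κ → V} (h : IsSymplecticFamily ω x y) :
    (ω.restrict (symplecticPerp ω x y)).IsAlt := fun v => h.alt v.1

theorem IsSymplecticFamily.perp_left {x y : κ → V} (h : IsSymplecticFamily ω x y) {v : V}
    (hv : v ∈ symplecticPerp ω x y) (i : κ) : ω v (x i) = 0 ∧ ω v (y i) = 0 := by
  rw [← LinearMap.BilinForm.IsAlt.neg_eq h.alt, (hv i).1,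
    ← LinearMap.BilinForm.IsAlt.neg_eq h.alt, (hv i).2]
  simp

/-- Any u differs from its part in the complement by a combination of the x_i and y_i, with which a
vector of the complement pairs to zero; so such a vector orthogonal to the complement is orthogonal
to everything. -/
theorem IsSymplecticFamily.nondegenerate_restrict [Fintype κ] {x y : κ → V}
    (h : IsSymplecticFamily ω x y)
    (hω : ω.Nondegenerate) : (ω.restrict (symplecticPerp ω x y)).Nondegenerate := by
  have key : ∀ v : symplecticPerp ω x y, (∀ w, ω.restrict (symplecticPerp ω x y) v w = 0) →
      v = 0 := by
    intro v hv
    refine Subtype.ext (hω.1 v.1 fun u => ?_)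
    rw [perpPart_add (ω := ω) x y u, map_add, map_add, map_sum, map_sum]
    simp only [map_smul, (h.perp_left v.2 _).1, (h.perp_left v.2 _).2, smul_zero,
      Finset.sum_const_zero, add_zero]
    exact hv ⟨_, h.perpPart_mem u⟩
  refine ⟨key, fun v hv => key v fun w => ?_⟩
  rw [← LinearMap.BilinForm.IsAlt.neg_eq h.alt_restrict, hv w, neg_zero]

theorem IsSymplecticFamily.finrank_perp_lt [FiniteDimensional ℝ V] [Nonempty κ] {x y : κ → V}
    (h : IsSymplecticFamily ω x y) :
    Module.finrank ℝ (symplecticPerp ω x y) < Module.finrank ℝ V := by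
  refine Submodule.finrank_lt fun htop => ?_
  obtain ⟨i⟩ := ‹Nonempty κ›
  have : y i ∈ symplecticPerp ω x y := htop ▸ Submodule.mem_top
  have h1 := (this i).1
  rw [h.inl_inr] at h1
  simp at h1

/-- A symplectic basis of the complement of a symplectic family extends to the whole space. -/
theorem IsSymplecticFamily.exists_basis [Fintype ι] [Fintype κ] {x y : κ → V}
    (h : IsSymplecticFamily ω x y)
    (b' : Module.Basis (ι ⊕ ι) ℝ (symplecticPerp ω x y))
    (hb' : IsSymplecticFamily (ω.restrict (symplecticPerp ω x y)) (fun i => b' (Sum.inl i))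
      (fun i => b' (Sum.inr i))) :
    ∃ b : Module.Basis ((ι ⊕ κ) ⊕ (ι ⊕ κ)) ℝ V,
      (∀ i, b (Sum.inl (Sum.inl i)) = b' (Sum.inl i)) ∧ (∀ i, b (Sum.inl (Sum.inr i)) = x i) ∧
      (∀ i, b (Sum.inr (Sum.inl i)) = b' (Sum.inr i)) ∧ (∀ i, b (Sum.inr (Sum.inr i)) = y i) ∧
      IsSymplecticFamily ω (fun i => b (Sum.inl i)) (fun i => b (Sum.inr i)) := by
  let X : ι ⊕ κ → V := Sum.elim (fun i => (b' (Sum.inl i) : V)) x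
  let Y : ι ⊕ κ → V := Sum.elim (fun i => (b' (Sum.inr i) : V)) y
  have hXY : IsSymplecticFamily ω X Y := by
    refine ⟨h.alt, ?_, ?_, ?_⟩
    · rintro (i | i) (j | j)
      · exact hb'.inl_inl i j
      · exact (h.perp_left (b' _).2 j).1
      · exact ((b' (Sum.inl j)).2 i).1
      · exact h.inl_inl i j
    · rintro (i | i) (j | j)
      · exact hb'.inr_inr i j
      · exact (h.perp_left (b' _).2 j).2
      · exact ((b' (Sum.inr j)).2 i).2
      · exact h.inr_inr i j
    · rintro (i | i) (j | j)
      · exact (hb'.inl_inr i j).trans (by simp)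
      · exact (h.perp_left (b' _).2 j).2.trans (by simp)
      · exact ((b' (Sum.inr j)).2 i).1.trans (by simp)
      · exact (h.inl_inr i j).trans (by simp)
  have hli : LinearIndependent ℝ (Sum.elim X Y) := by
    rw [Fintype.linearIndependent_iff]
    intro g hg
    rw [Fintype.sum_sum_type] at hg
    have h1 := fun i => hXY.form_sum_left (fun i => g (Sum.inl i)) (fun i => g (Sum.inr i)) i
    simp only [Sum.elim_inl, Sum.elim_inr] at hg
    simp only [hg, map_zero, LinearMap.zero_apply] at h1
    rintro (i | i)
    exacts [(h1 i).1.symm, (h1 i).2.symm]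
  have hspan : ⊤ ≤ Submodule.span ℝ (Set.range (Sum.elim X Y)) := by
    intro v _
    have hmem : ∀ k, Sum.elim X Y k ∈ Submodule.span ℝ (Set.range (Sum.elim X Y)) :=
      fun k => Submodule.subset_span ⟨k, rfl⟩
    rw [perpPart_add (ω := ω) x y v]
    refine Submodule.add_mem _ ?_ (Submodule.add_mem _ ?_ ?_)
    · have h1 : perpPart ω x y v = ∑ k, b'.repr ⟨_, h.perpPart_mem v⟩ k • (b' k : V) := by
        have := congrArg (symplecticPerp ω x y).subtype (b'.sum_repr ⟨_, h.perpPart_mem v⟩)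
        rw [map_sum] at this
        exact this.symm
      rw [h1]
      refine Submodule.sum_mem _ fun k _ => Submodule.smul_mem _ _ ?_
      rcases k with i | i
      exacts [hmem (Sum.inl (Sum.inl i)), hmem (Sum.inr (Sum.inl i))]
    · exact Submodule.sum_mem _ fun i _ => Submodule.smul_mem _ _ (hmem (Sum.inl (Sum.inr i)))
    · exact Submodule.sum_mem _ fun i _ => Submodule.smul_mem _ _ (hmem (Sum.inr (Sum.inr i)))
  refine ⟨Module.Basis.mk hli hspan, ?_, ?_, ?_, ?_, ?_⟩
  · intro i; simp [X]
  · intro i; simp [X]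
  · intro i; simp [Y]
  · intro i; simp [Y]
  · simpa using hXY

/-- An isotropic linearly independent family is half of a symplectic family. -/
theorem exists_isSymplecticFamily [Fintype κ] [FiniteDimensional ℝ V] (hω : ω.IsAlt)
    (hnd : ω.Nondegenerate) {x : κ → V} (hli : LinearIndependent ℝ x)
    (hx : ∀ i j, ω (x i) (x j) = 0) : ∃ y, IsSymplecticFamily ω x y := by
  have hf : ∀ j, ∃ f : Module.Dual ℝ V, ∀ i, f (x i) = if i = j then 1 else 0 := by
    intro j
    obtain ⟨f, hf⟩ := LinearMap.exists_extend ((Finsupp.lapply j).comp hli.repr)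
    refine ⟨f, fun i => ?_⟩
    have h1 := congrArg (fun g => g ⟨x i, Submodule.subset_span ⟨i, rfl⟩⟩) hf
    have h2 := hli.repr_eq_single i ⟨x i, Submodule.subset_span ⟨i, rfl⟩⟩ rfl
    simp only [LinearMap.comp_apply, Submodule.subtype_apply, h2, Finsupp.lapply_apply,
      Finsupp.single_apply] at h1
    exact h1
  choose f hf using hf
  -- Nondegeneracy represents the dual functionals by vectors z_j with ω(x_i, z_j) = δ_ij. The sign
  -- compensates for the order of the arguments in `toDual`.
  let z : κ → V := fun j => -(ω.toDual hnd).symm (f j)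
  have hz : ∀ i j, ω (x i) (z j) = if i = j then 1 else 0 := by
    intro i j
    rw [← LinearMap.BilinForm.IsAlt.neg_eq hω, ← hf j i]
    simp only [z, map_neg, LinearMap.neg_apply, neg_neg]
    exact LinearMap.BilinForm.apply_toDual_symm_apply (B := ω) (hB := hnd) (f j) (x i)
  have hz' : ∀ i j, ω (z i) (x j) = if i = j then -1 else 0 := by
    intro i j
    rw [← LinearMap.BilinForm.IsAlt.neg_eq hω, hz]
    by_cases hij : i = j
    · simp [hij]
    · simp [hij, Ne.symm hij]
  -- Adding multiples of the x_i does not change the pairings with the x_i. In ω(y_i, y_j) each of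
  -- the two corrections contributes -ω(z_i, z_j)/2, so the y_j become isotropic.
  refine ⟨fun j => z j + ∑ i, (ω (z i) (z j) / 2) • x i, hω, hx, ?_, ?_⟩
  · intro i j
    simp only [map_add, LinearMap.add_apply, map_sum, map_smul, LinearMap.sum_apply,
      LinearMap.smul_apply, hz, hz', hx, smul_eq_mul, mul_zero, Finset.sum_const_zero, mul_ite,
      mul_one, Finset.sum_ite_eq, Finset.sum_ite_eq', Finset.mem_univ, if_true, add_zero]
    rw [← LinearMap.BilinForm.IsAlt.neg_eq hω (z i) (z j)]
    ring
  · intro i j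
    simp only [map_add, map_sum, map_smul, hz, hx, smul_zero, Finset.sum_const_zero, add_zero]

end Families

/-! ### Normal forms of symplectic matrices up to scaling -/

section NormalForm

/-- The sum of `f |λ|` over the complex eigenvalues `λ` of a real matrix. -/
def eigenSum {n : Type*} [Fintype n] [DecidableEq n] (M : Matrix n n ℝ) (f : ℝ → ℝ) : ℝ :=
  ((M.map Complex.ofReal).charpoly.roots.map fun l => f ‖l‖).sum

variable {m n : Type*} [Fintype m] [DecidableEq m] [Fintype n] [DecidableEq n]

theorem eigenSum_fromBlocks (A : Matrix m m ℝ) (B : Matrix m n ℝ) (D : Matrix n n ℝ)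
    (f : ℝ → ℝ) : eigenSum (Matrix.fromBlocks A B 0 D) f = eigenSum A f + eigenSum D f := by
  have h : (Matrix.fromBlocks A B 0 D).map Complex.ofReal =
      Matrix.fromBlocks (A.map Complex.ofReal) (B.map Complex.ofReal) 0 (D.map Complex.ofReal) := by
    rw [Matrix.fromBlocks_map]
    congr 1
  rw [eigenSum, h, Matrix.charpoly_fromBlocks_zero₂₁,
    Polynomial.roots_mul (mul_ne_zero (Matrix.charpoly_monic _).ne_zero
      (Matrix.charpoly_monic _).ne_zero), Multiset.map_add, Multiset.sum_add]
  rfl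

theorem eigenSum_submatrix (e : m ≃ n) (M : Matrix n n ℝ) (f : ℝ → ℝ) :
    eigenSum (M.submatrix e e) f = eigenSum M f := by
  have h := Matrix.charpoly_reindex e.symm (M.map Complex.ofReal)
  rw [eigenSum, eigenSum, ← h]
  rfl

open scoped ComplexOrder in
/-- All complex eigenvalues of a multiple of an orthogonal matrix have the same absolute value. -/
theorem eigenSum_of_mul_transpose {A : Matrix n n ℝ} {r : ℝ} (hr : 0 < r)
    (hA : A * Aᵀ = (r ^ 2) • (1 : Matrix n n ℝ)) (f : ℝ → ℝ) :
    eigenSum A f = Fintype.card n * f r := by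
  have hA' : Aᵀ * A = (r ^ 2) • (1 : Matrix n n ℝ) := by
    have h1 : (((r ^ 2)⁻¹) • Aᵀ) * A = 1 := by
      apply mul_eq_one_comm.1
      rw [mul_smul_comm, hA, smul_smul, inv_mul_cancel₀ (pow_pos hr 2).ne', one_smul]
    rw [← h1, smul_mul_assoc, smul_smul, mul_inv_cancel₀ (pow_pos hr 2).ne', one_smul]
  have hroot : ∀ l ∈ (A.map Complex.ofReal).charpoly.roots, ‖l‖ = r := by
    intro l hl
    have h1 := (Polynomial.mem_roots'.1 hl).2
    rw [Polynomial.IsRoot.def, Matrix.eval_charpoly, ← Matrix.exists_mulVec_eq_zero_iff] at h1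
    obtain ⟨v, hv0, hv⟩ := h1
    have h2 : A.map Complex.ofReal *ᵥ v = l • v := by
      rw [Matrix.sub_mulVec, sub_eq_zero] at hv
      rw [← hv, Matrix.scalar_apply, ← Matrix.smul_one_eq_diagonal, Matrix.smul_mulVec,
        Matrix.one_mulVec]
    have h3 : (A.map Complex.ofReal)ᴴ * A.map Complex.ofReal =
        ((r ^ 2 : ℝ) : ℂ) • (1 : Matrix n n ℂ) := by
      have : (A.map Complex.ofReal)ᴴ = Aᵀ.map Complex.ofReal := by
        ext i j
        simp
      rw [this, ← map_ofReal_mul, hA']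
      ext i j
      simp only [Matrix.one_apply, Matrix.map_apply, Matrix.smul_apply, smul_eq_mul, mul_ite,
        mul_one, mul_zero]
      split_ifs <;> simp
    -- AᴴA = r² gives ‖A v‖² = r² ‖v‖², and for an eigenvector this forces |l| = r.
    have h4 : star (A.map Complex.ofReal *ᵥ v) ⬝ᵥ (A.map Complex.ofReal *ᵥ v) =
        ((r ^ 2 : ℝ) : ℂ) * (star v ⬝ᵥ v) := by
      rw [Matrix.star_mulVec, ← Matrix.dotProduct_mulVec, Matrix.mulVec_mulVec, h3,
        Matrix.smul_mulVec, Matrix.one_mulVec, dotProduct_smul, smul_eq_mul]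
    rw [h2, star_smul, smul_dotProduct, dotProduct_smul, smul_eq_mul, smul_eq_mul,
      ← mul_assoc] at h4
    have hv1 : star v ⬝ᵥ v ≠ 0 := fun h => hv0 (dotProduct_star_self_eq_zero.1 h)
    have h5 := mul_right_cancel₀ hv1 h4
    rw [Complex.star_def, mul_comm, Complex.mul_conj, Complex.normSq_eq_norm_sq] at h5
    exact (sq_eq_sq₀ (norm_nonneg _) hr.le).1 (by exact_mod_cast h5)
  rw [eigenSum, Multiset.map_congr rfl fun l hl => by rw [hroot l hl], Multiset.map_const',
    Multiset.sum_replicate, nsmul_eq_mul]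
  congr 2
  rw [IsAlgClosed.card_roots_eq_natDegree, Matrix.charpoly_natDegree_eq_dim]

/-- The part of a matrix that connects indices of the same weight. -/
def weightPart {n : Type*} (w : n → ℤ) (M : Matrix n n ℝ) : Matrix n n ℝ :=
  Matrix.of fun k l => if w k = w l then M k l else 0

/-- A symplectic matrix is in normal form if it is block triangular for the weights `(m, -m)`
and its block diagonal part is the product of `diag (r, r⁻¹)` and an orthogonal matrix, up to the
order of the factors; moreover the absolute values of its eigenvalues are the `r` and `r⁻¹`. -/
structure HasNormalForm {ι : Type*} [Fintype ι] [DecidableEq ι] (M : Matrix (ι ⊕ ι) (ι ⊕ ι) ℝ)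
    (r : ι → ℝ) (m : ι → ℤ) : Prop where
  pos : ∀ i, 0 < r i
  eigenSum_eq : ∀ f, eigenSum M f = ∑ i, (f (r i) + f (r i)⁻¹)
  triangular : ∀ k l, Sum.elim m (-m) k < Sum.elim m (-m) l → M k l = 0
  gram : weightPart (Sum.elim m (-m)) M * (weightPart (Sum.elim m (-m)) M)ᵀ =
    Matrix.diagonal (Sum.elim (fun i => r i ^ 2) (fun i => (r i)⁻¹ ^ 2))

variable {ι κ : Type*} [Fintype ι] [DecidableEq ι] [Fintype κ] [DecidableEq κ]

/-- After regrouping the indices as (old x, old y), (new x, new y), the matrix is block diagonal, so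
its Gram matrix is computed block by block. -/
theorem gram_of_submatrix {L : Matrix ((ι ⊕ κ) ⊕ (ι ⊕ κ)) ((ι ⊕ κ) ⊕ (ι ⊕ κ)) ℝ}
    {L' : Matrix (ι ⊕ ι) (ι ⊕ ι) ℝ} {R : Matrix (κ ⊕ κ) (κ ⊕ κ) ℝ} {r : ι → ℝ} {s : ℝ}
    (hL : L = (Matrix.fromBlocks L' 0 0 R).submatrix (Equiv.sumSumSumComm ι κ ι κ)
      (Equiv.sumSumSumComm ι κ ι κ))
    (hL' : L' * L'ᵀ = Matrix.diagonal (Sum.elim (fun i => r i ^ 2) (fun i => (r i)⁻¹ ^ 2)))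
    (hR : R * Rᵀ = Matrix.diagonal (Sum.elim (fun _ => s ^ 2) (fun _ => s⁻¹ ^ 2))) :
    L * Lᵀ = Matrix.diagonal (Sum.elim (fun i => (Sum.elim r (fun _ => s) : ι ⊕ κ → ℝ) i ^ 2)
      (fun i => ((Sum.elim r (fun _ => s) : ι ⊕ κ → ℝ) i)⁻¹ ^ 2)) := by
  have h : Matrix.fromBlocks L' 0 0 R * (Matrix.fromBlocks L' 0 0 R)ᵀ = Matrix.diagonal (Sum.elim
      (Sum.elim (fun i => r i ^ 2) (fun i => (r i)⁻¹ ^ 2))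
      (Sum.elim (fun _ => s ^ 2) (fun _ => s⁻¹ ^ 2))) := by
    rw [Matrix.fromBlocks_transpose, Matrix.fromBlocks_multiply, hL', hR]
    simp only [Matrix.transpose_zero, Matrix.mul_zero, Matrix.zero_mul, add_zero,
      zero_add, Matrix.fromBlocks_diagonal]
  have h' : L * Lᵀ = (Matrix.fromBlocks L' 0 0 R * (Matrix.fromBlocks L' 0 0 R)ᵀ).submatrix
      (Equiv.sumSumSumComm ι κ ι κ) (Equiv.sumSumSumComm ι κ ι κ) := by
    rw [hL, Matrix.transpose_submatrix, Matrix.submatrix_mul_equiv]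
  rw [h', h, Matrix.submatrix_diagonal_equiv]
  congr 1
  ext k
  rcases k with (i | i) | (i | i) <;> rfl

/-- Adding a pair of dual isotropic subspaces to a normal form. -/
theorem HasNormalForm.extend_isotropic {M' : Matrix (ι ⊕ ι) (ι ⊕ ι) ℝ} {r : ι → ℝ} {m : ι → ℤ}
    (h : HasNormalForm M' r m) {M : Matrix ((ι ⊕ κ) ⊕ (ι ⊕ κ)) ((ι ⊕ κ) ⊕ (ι ⊕ κ)) ℝ}
    {A C : Matrix κ κ ℝ} {s : ℝ} (hs : 0 < s) (hA : A * Aᵀ = (s ^ 2) • (1 : Matrix κ κ ℝ))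
    (hC : C * Cᵀ = (s⁻¹ ^ 2) • (1 : Matrix κ κ ℝ))
    (hM : ∀ k l, M (Sum.map Sum.inl Sum.inl k) (Sum.map Sum.inl Sum.inl l) = M' k l)
    (hMA : ∀ i j, M (Sum.inl (Sum.inr i)) (Sum.inl (Sum.inr j)) = A i j)
    (hMC : ∀ i j, M (Sum.inr (Sum.inr i)) (Sum.inr (Sum.inr j)) = C i j)
    (h1 : ∀ k j, M (Sum.map Sum.inl Sum.inl k) (Sum.inl (Sum.inr j)) = 0)
    (h2 : ∀ i j, M (Sum.inr (Sum.inr i)) (Sum.inl (Sum.inr j)) = 0)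
    (h3 : ∀ i l, M (Sum.inr (Sum.inr i)) (Sum.map Sum.inl Sum.inl l) = 0) :
    ∃ K : ℤ, HasNormalForm M (Sum.elim r fun _ => s) (Sum.elim m fun _ => K) := by
  have hM11 := fun i j => hM (Sum.inl i) (Sum.inl j)
  have hM12 := fun i j => hM (Sum.inl i) (Sum.inr j)
  have hM21 := fun i j => hM (Sum.inr i) (Sum.inl j)
  have hM22 := fun i j => hM (Sum.inr i) (Sum.inr j)
  have h1l := fun i => h1 (Sum.inl i)
  have h1r := fun i => h1 (Sum.inr i)
  have h3l := fun i l => h3 i (Sum.inl l)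
  have h3r := fun i l => h3 i (Sum.inr l)
  simp only [Sum.map_inl, Sum.map_inr] at hM11 hM12 hM21 hM22 h1l h1r h3l h3r
  -- K exceeds every old |m_i|, so the new x get strictly the highest weight and the new y strictly
  -- the lowest. The new blocks then never share a weight with the old ones, and K > 0 separates
  -- them from each other.
  have hK : ∀ i, |m i| < ∑ j, |m j| + 1 := fun i =>
    Int.lt_add_one_of_le (Finset.single_le_sum (f := fun j => |m j|) (fun j _ => abs_nonneg _)
      (Finset.mem_univ i))
  have hK0 : 0 < ∑ j, |m j| + 1 :=
    Int.lt_add_one_of_le (Finset.sum_nonneg fun j _ => abs_nonneg _)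
  generalize (∑ j, |m j| + 1) = K at hK hK0
  have hK1 : ∀ i, m i < K := fun i => (abs_lt.1 (hK i)).2
  have hK2 : ∀ i, -K < m i := fun i => (abs_lt.1 (hK i)).1
  refine ⟨K, ?_, ?_, ?_, ?_⟩
  · rintro (i | i)
    exacts [h.pos i, hs]
  · intro f
    -- In the order new x, old basis, new y, the matrix is block upper triangular with diagonal
    -- blocks A, M' and C, so the eigenvalue sums add up.
    let e : κ ⊕ ((ι ⊕ ι) ⊕ κ) ≃ (ι ⊕ κ) ⊕ (ι ⊕ κ) :=
      { toFun := Sum.elim (fun j => Sum.inl (Sum.inr j))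
          (Sum.elim (Sum.map Sum.inl Sum.inl) fun j => Sum.inr (Sum.inr j))
        invFun := Sum.elim (Sum.elim (fun i => Sum.inr (Sum.inl (Sum.inl i))) Sum.inl)
          (Sum.elim (fun i => Sum.inr (Sum.inl (Sum.inr i))) fun j => Sum.inr (Sum.inr j))
        left_inv := by rintro (j | (i | i) | j) <;> rfl
        right_inv := by rintro ((i | j) | (i | j)) <;> rfl }
    have hblock : M.submatrix e e = Matrix.fromBlocks A
        (Matrix.of fun i l => M (e (Sum.inl i)) (e (Sum.inr l))) 0
        (Matrix.fromBlocks M' (Matrix.of fun k j => M (e (Sum.inr (Sum.inl k)))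
          (e (Sum.inr (Sum.inr j)))) 0 C) := by
      ext k l
      rcases k with i | k | i <;> rcases l with j | l | j
      · exact hMA i j
      · rfl
      · rfl
      · exact h1 k j
      · exact hM k l
      · rfl
      · exact h2 i j
      · exact h3 i l
      · exact hMC i j
    rw [← eigenSum_submatrix e, hblock, eigenSum_fromBlocks, eigenSum_fromBlocks, h.eigenSum_eq,
      eigenSum_of_mul_transpose hs hA, eigenSum_of_mul_transpose (inv_pos.2 hs) hC,
      Fintype.sum_sum_type]
    simp only [Sum.elim_inl, Sum.elim_inr, Finset.sum_const, Finset.card_univ, nsmul_eq_mul]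
    ring
  · rintro ((i | i) | (i | i)) ((j | j) | (j | j)) hlt
    all_goals simp only [Sum.elim_inl, Sum.elim_inr, Pi.neg_apply] at hlt
    · exact (hM11 i j).trans (h.triangular _ _ hlt)
    · exact h1l i j
    · exact (hM12 i j).trans (h.triangular _ _ hlt)
    · have := hK2 i; omega
    · have := hK1 j; omega
    · omega
    · have := hK2 j; omega
    · omega
    · exact (hM21 i j).trans (h.triangular _ _ hlt)
    · exact h1r i j
    · exact (hM22 i j).trans (h.triangular _ _ hlt)
    · have := hK1 i; omega
    · exact h3l i j
    · exact h2 i j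
    · exact h3r i j
    · omega
  · refine gram_of_submatrix (L' := weightPart (Sum.elim m (-m)) M') (R := Matrix.fromBlocks A 0 0 C)
      ?_ h.gram ?_
    · have hn1 : ∀ i, m i ≠ K := fun i => (hK1 i).ne
      have hn2 : ∀ i, m i ≠ -K := fun i => (hK2 i).ne'
      have hn3 : ∀ i, -m i ≠ K := fun i h => hn2 i (by omega)
      have hn4 : K ≠ -K := by omega
      ext k l
      rcases k with (i | i) | (i | i) <;> rcases l with (j | j) | (j | j) <;>
      simp [weightPart, hM11, hM12, hM21, hM22, hMA, hMC, hn1, hn2, hn3,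
        hn4, (hn1 _).symm, (hn2 _).symm, (hn3 _).symm, hn4.symm]
      all_goals exact if_congr Iff.rfl rfl rfl
    · rw [Matrix.fromBlocks_transpose, Matrix.fromBlocks_multiply, hA, hC]
      simp only [Matrix.transpose_zero, mul_zero, zero_mul, add_zero, zero_add]
      rw [Matrix.smul_one_eq_diagonal, Matrix.smul_one_eq_diagonal, Matrix.fromBlocks_diagonal]

/-- Adding an invariant symplectic subspace on which the transformation is orthogonal. -/
theorem HasNormalForm.extend_orthogonal {M' : Matrix (ι ⊕ ι) (ι ⊕ ι) ℝ} {r : ι → ℝ} {m : ι → ℤ}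
    (h : HasNormalForm M' r m) {M : Matrix ((ι ⊕ κ) ⊕ (ι ⊕ κ)) ((ι ⊕ κ) ⊕ (ι ⊕ κ)) ℝ}
    {R : Matrix (κ ⊕ κ) (κ ⊕ κ) ℝ} (hR : R * Rᵀ = 1)
    (hM : M = (Matrix.fromBlocks M' 0 0 R).submatrix (Equiv.sumSumSumComm ι κ ι κ)
      (Equiv.sumSumSumComm ι κ ι κ)) :
    HasNormalForm M (Sum.elim r fun _ => 1) (Sum.elim m fun _ => 0) := by
  refine ⟨?_, ?_, ?_, ?_⟩
  · rintro (i | i)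
    exacts [h.pos i, one_pos]
  · intro f
    rw [hM, eigenSum_submatrix, eigenSum_fromBlocks, h.eigenSum_eq,
      eigenSum_of_mul_transpose one_pos (by rw [hR]; simp), Fintype.sum_sum_type]
    simp only [Sum.elim_inl, Sum.elim_inr, Finset.sum_const, Finset.card_univ, nsmul_eq_mul,
      Fintype.card_sum, inv_one, Nat.cast_add]
    ring
  · subst hM
    rintro ((i | i) | (i | i)) ((j | j) | (j | j)) hlt <;>
      simp only [Sum.elim_inl, Sum.elim_inr, Pi.neg_apply, neg_zero, lt_self_iff_false] at hlt
    all_goals first | rfl | exact h.triangular _ _ hlt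
  · refine gram_of_submatrix (L' := weightPart (Sum.elim m (-m)) M') (R := R) ?_ h.gram ?_
    · subst hM
      ext k l
      rcases k with (i | i) | (i | i) <;> rcases l with (j | j) | (j | j) <;> simp [weightPart]
      all_goals first
        | exact ite_self _
        | exact if_congr Iff.rfl rfl rfl
    · rw [hR, ← Matrix.diagonal_one]
      congr 1
      ext k
      rcases k with i | i <;> simp

end NormalForm

/-! ### Existence of normal forms -/

section Existence

variable {V : Type*} [AddCommGroup V] [Module ℝ V] {ω : LinearMap.BilinForm ℝ V}

/-- Existence of a symplectic basis, indexed by any finite type, in which `φ` has a normal form. -/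
def ExistsNormalForm {V : Type*} [AddCommGroup V] [Module ℝ V] (ω : LinearMap.BilinForm ℝ V)
    (φ : V →ₗ[ℝ] V) : Prop :=
  ∃ (ι : Type) (_ : Fintype ι) (_ : DecidableEq ι) (b : Module.Basis (ι ⊕ ι) ℝ V) (r : ι → ℝ)
    (m : ι → ℤ), IsSymplecticFamily ω (fun i => b (Sum.inl i)) (fun i => b (Sum.inr i)) ∧
      HasNormalForm (LinearMap.toMatrix b b φ) r m

theorem form_perpPart_left {κ : Type*} [Fintype κ] {x y : κ → V} (v : V) {u : V}
    (hu : u ∈ symplecticPerp ω x y) : ω (perpPart ω x y v) u = ω v u := by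
  simp only [perpPart, map_sub, map_add, map_sum, map_smul, LinearMap.sub_apply,
    LinearMap.add_apply, LinearMap.sum_apply, LinearMap.smul_apply, (hu _).1, (hu _).2, smul_zero,
    Finset.sum_const_zero, add_zero, sub_zero]

/-! ### Compression of a symplectic map to the complement of a symplectic family -/

section Perp

variable {ι κ : Type*} [Fintype ι] [DecidableEq ι] [Fintype κ] [DecidableEq κ] {x y : κ → V}

theorem IsSymplecticFamily.form_perpPart_right (h : IsSymplecticFamily ω x y) (v : V) {u : V}
    (hu : u ∈ symplecticPerp ω x y) : ω u (perpPart ω x y v) = ω u v := by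
  rw [← LinearMap.BilinForm.IsAlt.neg_eq h.alt, form_perpPart_left v hu,
    LinearMap.BilinForm.IsAlt.neg_eq h.alt]

/-- The compression of a linear map to the complement of a symplectic family. -/
def IsSymplecticFamily.compress (h : IsSymplecticFamily ω x y) (φ : V →ₗ[ℝ] V) :
    symplecticPerp ω x y →ₗ[ℝ] symplecticPerp ω x y where
  toFun v := ⟨perpPart ω x y (φ v), h.perpPart_mem _⟩
  map_add' v w := by
    refine Subtype.ext ?_
    simp only [perpPart, Submodule.coe_add, map_add, LinearMap.add_apply, add_smul,
      Finset.sum_add_distrib]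
    abel
  map_smul' c v := by
    refine Subtype.ext ?_
    simp only [perpPart, Submodule.coe_smul, map_smul, LinearMap.smul_apply, smul_sub, smul_add,
      Finset.smul_sum, smul_smul, smul_eq_mul, RingHom.id_apply]

/-- If φ keeps the complement orthogonal to all x_i, projecting φ v back removes only components
along the x_i. These pair to zero with each other and with φ w, so the form is unchanged. -/
theorem IsSymplecticFamily.form_compress (h : IsSymplecticFamily ω x y) {φ : V →ₗ[ℝ] V}
    (hφ : ∀ v w, ω (φ v) (φ w) = ω v w)
    (hx : ∀ v ∈ symplecticPerp ω x y, ∀ i, ω (x i) (φ v) = 0) (v w : symplecticPerp ω x y) :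
    ω.restrict _ (h.compress φ v) (h.compress φ w) = ω.restrict _ v w := by
  have h1 : ω (perpPart ω x y (φ v)) (perpPart ω x y (φ w)) = ω (φ v) (φ w) := by
    rw [form_perpPart_left _ (h.perpPart_mem _)]
    have h2 : ∀ i, ω (φ v) (x i) = 0 := fun i => by
      rw [← LinearMap.BilinForm.IsAlt.neg_eq h.alt, hx _ v.2, neg_zero]
    simp only [perpPart, map_sub, map_sum, map_smul, h2, hx _ w.2, zero_smul, smul_zero,
      Finset.sum_const_zero, add_zero, sub_zero]
  exact h1.trans (hφ v w)

/-- The matrix of the compression is a block of the matrix of the whole map. -/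
theorem IsSymplecticFamily.toMatrix_compress (h : IsSymplecticFamily ω x y) (φ : V →ₗ[ℝ] V)
    {b' : Module.Basis (ι ⊕ ι) ℝ (symplecticPerp ω x y)}
    (hb' : IsSymplecticFamily (ω.restrict (symplecticPerp ω x y)) (fun i => b' (Sum.inl i))
      (fun i => b' (Sum.inr i)))
    {b : Module.Basis ((ι ⊕ κ) ⊕ (ι ⊕ κ)) ℝ V}
    (hb : IsSymplecticFamily ω (fun i => b (Sum.inl i)) (fun i => b (Sum.inr i)))
    (h1 : ∀ i, b (Sum.inl (Sum.inl i)) = b' (Sum.inl i))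
    (h2 : ∀ i, b (Sum.inr (Sum.inl i)) = b' (Sum.inr i)) (k l : ι ⊕ ι) :
    LinearMap.toMatrix b b φ (Sum.map Sum.inl Sum.inl k) (Sum.map Sum.inl Sum.inl l) =
      LinearMap.toMatrix b' b' (h.compress φ) k l := by
  have hl : b (Sum.map Sum.inl Sum.inl l) = b' l := by
    rcases l with l | l
    exacts [h1 l, h2 l]
  rw [LinearMap.toMatrix_apply, LinearMap.toMatrix_apply, hl]
  rcases k with k | k
  · rw [Sum.map_inl, hb.repr_inl, hb'.repr_inl, h2]
    exact (form_perpPart_left _ (b' _).2).symm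
  · rw [Sum.map_inr, hb.repr_inr, hb'.repr_inr, h1]
    exact (h.form_perpPart_right _ (b' _).2).symm

end Perp

/-! ### Splitting off invariant subspaces -/

variable {κ : Type} [Fintype κ] [DecidableEq κ] {x y : κ → V} {φ : V →ₗ[ℝ] V}

/-- A Aᵀ = c gives c x_i = ∑ A_il φ(x_l). Pairing with φ v and using the invariance of ω expresses
ω(x_i, φ v) through ω(x_l, v) without inverting φ. -/
theorem smul_form_apply_of_mul_transpose {κ : Type*} [Fintype κ] [DecidableEq κ] {x : κ → V}
    (hφ : ∀ v w, ω (φ v) (φ w) = ω v w) {A : Matrix κ κ ℝ} {c : ℝ}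
    (hx : ∀ j, φ (x j) = ∑ i, A i j • x i) (hA : A * Aᵀ = c • (1 : Matrix κ κ ℝ)) (v : V) (i : κ) :
    c * ω (x i) (φ v) = ∑ l, A i l * ω (x l) v := by
  have h1 : ∑ l, A i l • φ (x l) = c • x i := by
    simp only [hx, Finset.smul_sum, smul_smul]
    rw [Finset.sum_comm]
    have h2 : ∀ k, ∑ l, (A i l * A k l) • x k = (if i = k then c else 0) • x k := by
      intro k
      have h3 := congrFun (congrFun hA i) k
      rw [Matrix.mul_apply] at h3
      rw [← Finset.sum_smul]
      congr 1
      simpa [Matrix.one_apply] using h3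
    simp [h2]
  rw [← smul_eq_mul, ← LinearMap.smul_apply, ← map_smul, ← h1]
  simp [map_sum, LinearMap.sum_apply, hφ]

/-- The span of x is invariant and φ is a similarity of ratio s on it. Completing x by a dual family
y, φ preserves x^⊥, so the compression to the complement is symplectic and the induction applies;
modulo x^⊥, φ acts on the y by s⁻² A, of ratio s⁻¹. -/
theorem existsNormalForm_of_isotropic [FiniteDimensional ℝ V] (hω : ω.IsAlt)
    (hnd : ω.Nondegenerate) (hφ : ∀ v w, ω (φ v) (φ w) = ω v w) (hli : LinearIndependent ℝ x)
    (hx : ∀ i j, ω (x i) (x j) = 0) {A : Matrix κ κ ℝ} {s : ℝ} (hs : 0 < s)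
    (hφx : ∀ j, φ (x j) = ∑ i, A i j • x i) (hA : A * Aᵀ = (s ^ 2) • (1 : Matrix κ κ ℝ))
    (ih : ∀ y, IsSymplecticFamily ω x y →
      ∀ φ' : symplecticPerp ω x y →ₗ[ℝ] symplecticPerp ω x y,
        (∀ v w, ω.restrict (symplecticPerp ω x y) (φ' v) (φ' w) = ω.restrict _ v w) →
        ExistsNormalForm (ω.restrict (symplecticPerp ω x y)) φ') :
    ExistsNormalForm ω φ := by
  obtain ⟨y, h⟩ := exists_isSymplecticFamily hω hnd hli hx
  have hs2 : s ^ 2 ≠ 0 := (pow_pos hs 2).ne'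
  have key := smul_form_apply_of_mul_transpose hφ hφx hA
  have hperp : ∀ v ∈ symplecticPerp ω x y, ∀ i, ω (x i) (φ v) = 0 := by
    intro v hv i
    have h1 := key v i
    simp only [(hv _).1, mul_zero, Finset.sum_const_zero] at h1
    exact (mul_eq_zero.1 h1).resolve_left hs2
  have hy : ∀ i j, ω (x i) (φ (y j)) = (s ^ 2)⁻¹ * A i j := by
    intro i j
    have h1 := key (y j) i
    simp only [h.inl_inr, mul_ite, mul_one, mul_zero, Finset.sum_ite_eq', Finset.mem_univ,
      if_true] at h1
    rw [← h1, inv_mul_cancel_left₀ hs2]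
  have hxx : ∀ i j, ω (x i) (φ (x j)) = 0 := by
    intro i j
    have h1 := key (x j) i
    simp only [hx, mul_zero, Finset.sum_const_zero] at h1
    exact (mul_eq_zero.1 h1).resolve_left hs2
  obtain ⟨ι, _, _, b', r, m, hb', hn⟩ := ih y h (h.compress φ) (h.form_compress hφ hperp)
  obtain ⟨b, hb1, hb2, hb3, hb4, hb⟩ := h.exists_basis b' hb'
  suffices hK : ∃ K : ℤ, HasNormalForm (LinearMap.toMatrix b b φ) (Sum.elim r fun _ => s)
      (Sum.elim m fun _ => K) from
    hK.elim fun K hK => ⟨ι ⊕ κ, inferInstance, inferInstance, b, _, _, hb, hK⟩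
  refine hn.extend_isotropic (C := (s ^ 2)⁻¹ • A) hs hA ?_
    (h.toMatrix_compress φ hb' hb hb1 hb3) ?_ ?_ ?_ ?_ ?_
  · rw [Matrix.transpose_smul, Matrix.smul_mul, Matrix.mul_smul, hA, smul_smul, smul_smul]
    congr 1
    field_simp
  · intro i j
    rw [LinearMap.toMatrix_apply, hb.repr_inl, hb2, hb4, hφx]
    simp [map_sum, LinearMap.sum_apply, h.inl_inr]
  · intro i j
    rw [LinearMap.toMatrix_apply, hb.repr_inr, hb2, hb4, hy]
    rfl
  · intro k j
    rw [LinearMap.toMatrix_apply, hb2, hφx]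
    rcases k with i | i
    · rw [Sum.map_inl, hb.repr_inl, hb3]
      simp [map_sum, LinearMap.sum_apply, ((b' (Sum.inr i)).2 _).1]
    · rw [Sum.map_inr, hb.repr_inr, hb1]
      simp [map_sum, (h.perp_left (b' (Sum.inl i)).2 _).1]
  · intro i j
    rw [LinearMap.toMatrix_apply, hb.repr_inr, hb2, hb2, hxx]
  · intro i l
    rw [LinearMap.toMatrix_apply, hb.repr_inr, hb2]
    rcases l with j | j
    · rw [Sum.map_inl, hb1]
      exact hperp _ (b' _).2 i
    · rw [Sum.map_inr, hb3]
      exact hperp _ (b' _).2 i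

/-- The span of x and y is invariant and nondegenerate, so φ preserves its complement as well and
the matrix splits as a direct sum. -/
theorem existsNormalForm_of_orthogonal (hφ : ∀ v w, ω (φ v) (φ w) = ω v w)
    (h : IsSymplecticFamily ω x y) {R : Matrix (κ ⊕ κ) (κ ⊕ κ) ℝ}
    (hφx : ∀ l, φ (Sum.elim x y l) = ∑ k, R k l • Sum.elim x y k) (hR : R * Rᵀ = 1)
    (ih : ∀ φ' : symplecticPerp ω x y →ₗ[ℝ] symplecticPerp ω x y,
        (∀ v w, ω.restrict (symplecticPerp ω x y) (φ' v) (φ' w) = ω.restrict _ v w) →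
        ExistsNormalForm (ω.restrict (symplecticPerp ω x y)) φ') :
    ExistsNormalForm ω φ := by
  have key := smul_form_apply_of_mul_transpose (c := 1) hφ hφx (by rw [hR, one_smul])
  have hperp : ∀ v ∈ symplecticPerp ω x y, ∀ k, ω (Sum.elim x y k) (φ v) = 0 := by
    intro v hv k
    have hv' : ∀ l, ω (Sum.elim x y l) v = 0 := by
      rintro (l | l)
      exacts [(hv l).1, (hv l).2]
    have h1 := key v k
    simp only [hv', mul_zero, Finset.sum_const_zero, one_mul] at h1
    exact h1
  obtain ⟨ι, _, _, b', r, m, hb', hn⟩ := ih (h.compress φ)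
    (h.form_compress hφ fun v hv i => hperp v hv (Sum.inl i))
  obtain ⟨b, hb1, hb2, hb3, hb4, hb⟩ := h.exists_basis b' hb'
  have hM := h.toMatrix_compress φ hb' hb hb1 hb3
  have hxl : ∀ l, b (Sum.map Sum.inr Sum.inr l) = Sum.elim x y l := by
    rintro (l | l)
    exacts [hb2 l, hb4 l]
  have hnn : ∀ k l, LinearMap.toMatrix b b φ (Sum.map Sum.inr Sum.inr k)
      (Sum.map Sum.inr Sum.inr l) = R k l := by
    intro k l
    rw [LinearMap.toMatrix_apply, hxl, hφx, Fintype.sum_sum_type]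
    have h1 := h.form_sum_left (fun i => R (Sum.inl i) l) (fun i => R (Sum.inr i) l)
    rcases k with k | k
    · rw [Sum.map_inl, hb.repr_inl, hb4]
      exact (h1 k).1
    · rw [Sum.map_inr, hb.repr_inr, hb2]
      exact (h1 k).2
  have hon : ∀ k l, LinearMap.toMatrix b b φ (Sum.map Sum.inl Sum.inl k)
      (Sum.map Sum.inr Sum.inr l) = 0 := by
    intro k l
    rw [LinearMap.toMatrix_apply, hxl, hφx, Fintype.sum_sum_type]
    rcases k with k | k
    · rw [Sum.map_inl, hb.repr_inl, hb3]
      simp [map_sum, LinearMap.sum_apply, ((b' (Sum.inr k)).2 _).1, ((b' (Sum.inr k)).2 _).2]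
    · rw [Sum.map_inr, hb.repr_inr, hb1]
      simp [map_sum, (h.perp_left (b' (Sum.inl k)).2 _).1, (h.perp_left (b' (Sum.inl k)).2 _).2]
  have hno : ∀ k l, LinearMap.toMatrix b b φ (Sum.map Sum.inr Sum.inr k)
      (Sum.map Sum.inl Sum.inl l) = 0 := by
    intro k l
    have hl : b (Sum.map Sum.inl Sum.inl l) = b' l := by
      rcases l with l | l
      exacts [hb1 l, hb3 l]
    rw [LinearMap.toMatrix_apply, hl]
    rcases k with k | k
    · rw [Sum.map_inl, hb.repr_inl, hb4, ← LinearMap.BilinForm.IsAlt.neg_eq h.alt]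
      exact neg_eq_zero.2 (hperp _ (b' l).2 (Sum.inr k))
    · rw [Sum.map_inr, hb.repr_inr, hb2]
      exact hperp _ (b' l).2 (Sum.inl k)
  refine ⟨ι ⊕ κ, inferInstance, inferInstance, b, _, _, hb, hn.extend_orthogonal hR ?_⟩
  ext k l
  rcases k with (i | i) | (i | i) <;> rcases l with (j | j) | (j | j)
  · exact hM (Sum.inl i) (Sum.inl j)
  · exact hon (Sum.inl i) (Sum.inl j)
  · exact hM (Sum.inl i) (Sum.inr j)
  · exact hon (Sum.inl i) (Sum.inr j)
  · exact hno (Sum.inl i) (Sum.inl j)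
  · exact hnn (Sum.inl i) (Sum.inl j)
  · exact hno (Sum.inl i) (Sum.inr j)
  · exact hnn (Sum.inl i) (Sum.inr j)
  · exact hM (Sum.inr i) (Sum.inl j)
  · exact hon (Sum.inr i) (Sum.inl j)
  · exact hM (Sum.inr i) (Sum.inr j)
  · exact hon (Sum.inr i) (Sum.inr j)
  · exact hno (Sum.inr i) (Sum.inl j)
  · exact hnn (Sum.inr i) (Sum.inl j)
  · exact hno (Sum.inr i) (Sum.inr j)
  · exact hnn (Sum.inr i) (Sum.inr j)

/-- The real and imaginary parts of a complex eigenvector. -/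
theorem exists_complex_eigenvector [FiniteDimensional ℝ V] [Nontrivial V] (φ : V →ₗ[ℝ] V) :
    ∃ (a c : ℝ) (v u : V), (v ≠ 0 ∨ u ≠ 0) ∧ φ v = a • v - c • u ∧ φ u = c • v + a • u := by
  let b := Module.finBasis ℝ V
  let M := LinearMap.toMatrix b b φ
  have : Nonempty (Fin (Module.finrank ℝ V)) := ⟨⟨0, Module.finrank_pos⟩⟩
  obtain ⟨l, hl⟩ := IsAlgClosed.exists_root (M.map Complex.ofReal).charpoly (by
    rw [Matrix.charpoly_degree_eq_dim, Fintype.card_fin]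
    exact_mod_cast Module.finrank_pos.ne')
  rw [Polynomial.IsRoot.def, Matrix.eval_charpoly, ← Matrix.exists_mulVec_eq_zero_iff] at hl
  obtain ⟨z, hz0, hz⟩ := hl
  have hz' : ∀ i, ∑ j, (M i j : ℂ) * z j = l * z i := by
    rw [Matrix.sub_mulVec, sub_eq_zero] at hz
    intro i
    have := congrFun hz i
    rw [Matrix.scalar_apply, ← Matrix.smul_one_eq_diagonal, Matrix.smul_mulVec,
      Matrix.one_mulVec] at this
    exact this.symm
  have hrepr : ∀ f : Fin (Module.finrank ℝ V) → ℝ, ∀ i,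
      b.repr (φ (b.equivFun.symm f)) i = ∑ j, M i j * f j := by
    intro f i
    rw [← LinearMap.toMatrix_mulVec_repr b b]
    simp only [Matrix.mulVec, dotProduct, M]
    refine Finset.sum_congr rfl fun j _ => ?_
    rw [← Module.Basis.equivFun_apply, LinearEquiv.apply_symm_apply]
  refine ⟨l.re, l.im, b.equivFun.symm fun i => (z i).re, b.equivFun.symm fun i => (z i).im,
    ?_, ?_, ?_⟩
  · by_contra! h
    simp only [LinearEquiv.map_eq_zero_iff] at h
    exact hz0 (funext fun i => Complex.ext (congrFun h.1 i) (congrFun h.2 i))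
  · refine b.ext_elem fun i => ?_
    have h1 := congrArg Complex.re (hz' i)
    rw [hrepr, map_sub, map_smul, map_smul, Finsupp.sub_apply, Finsupp.smul_apply,
      Finsupp.smul_apply, ← Module.Basis.equivFun_apply, ← Module.Basis.equivFun_apply,
      LinearEquiv.apply_symm_apply, LinearEquiv.apply_symm_apply]
    simpa using h1
  · refine b.ext_elem fun i => ?_
    have h1 := congrArg Complex.im (hz' i)
    rw [hrepr, map_add, map_smul, map_smul, Finsupp.add_apply, Finsupp.smul_apply,
      Finsupp.smul_apply, ← Module.Basis.equivFun_apply, ← Module.Basis.equivFun_apply,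
      LinearEquiv.apply_symm_apply, LinearEquiv.apply_symm_apply]
    rw [add_comm]
    simpa using h1

/-- Applying φ to s v + t u = 0 and using c ≠ 0 gives t v - s u = 0. Together the two relations make
s² + t² annihilate both v and u. -/
theorem linearIndependent_of_rotation {a c : ℝ} {v u : V} (hc : c ≠ 0) (h0 : v ≠ 0 ∨ u ≠ 0)
    (hv : φ v = a • v - c • u) (hu : φ u = c • v + a • u) : LinearIndependent ℝ ![v, u] := by
  rw [LinearIndependent.pair_iff]
  intro s t hst
  have h1 : c • (t • v - s • u) = 0 := by
    have h2 := congrArg φ hst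
    rw [map_add, map_smul, map_smul, map_zero, hv, hu] at h2
    have h3 : c • (t • v - s • u) =
        (s • (a • v - c • u) + t • (c • v + a • u)) - a • (s • v + t • u) := by module
    rw [h3, h2, hst, smul_zero, sub_zero]
  have h2 := (smul_eq_zero.1 h1).resolve_left hc
  have h3 : (s ^ 2 + t ^ 2) • v = 0 := by
    have : (s ^ 2 + t ^ 2) • v = s • (s • v + t • u) + t • (t • v - s • u) := by module
    rw [this, hst, h2, smul_zero, smul_zero, add_zero]
  have h4 : (s ^ 2 + t ^ 2) • u = 0 := by
    have : (s ^ 2 + t ^ 2) • u = t • (s • v + t • u) - s • (t • v - s • u) := by module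
    rw [this, hst, h2, smul_zero, smul_zero, sub_zero]
  have h5 : s ^ 2 + t ^ 2 = 0 := by
    rcases h0 with h0 | h0
    exacts [(smul_eq_zero.1 h3).resolve_right h0, (smul_eq_zero.1 h4).resolve_right h0]
  constructor <;> nlinarith [sq_nonneg s, sq_nonneg t]

theorem existsNormalForm_of_rotation {a c : ℝ} {v u : V} (hω : ω.IsAlt)
    (hφ : ∀ v w, ω (φ v) (φ w) = ω v w) (hac : a ^ 2 + c ^ 2 = 1) (hvu : 0 < ω v u)
    (hv : φ v = a • v - c • u) (hu : φ u = c • v + a • u)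
    (ih : ∀ x y : Unit → V, IsSymplecticFamily ω x y →
      ∀ φ' : symplecticPerp ω x y →ₗ[ℝ] symplecticPerp ω x y,
        (∀ v w, ω.restrict (symplecticPerp ω x y) (φ' v) (φ' w) = ω.restrict _ v w) →
        ExistsNormalForm (ω.restrict (symplecticPerp ω x y)) φ') :
    ExistsNormalForm ω φ := by
  -- Scaling both vectors by the same factor makes them a symplectic pair without disturbing the
  -- rotation matrix; this requires ω(v, u) > 0.
  let t := (√(ω v u))⁻¹
  have ht : t * (t * ω v u) = 1 := by
    have h1 := Real.mul_self_sqrt hvu.le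
    have h2 := (Real.sqrt_pos.2 hvu).ne'
    simp only [t]
    rw [← h1]
    field_simp
    simp
  have h : IsSymplecticFamily ω (fun _ : Unit => t • v) (fun _ : Unit => t • u) := by
    refine ⟨hω, fun _ _ => hω _, fun _ _ => hω _, fun i j => ?_⟩
    simpa using ht
  refine existsNormalForm_of_orthogonal (R := Matrix.fromBlocks (Matrix.of fun _ _ => a)
    (Matrix.of fun _ _ => c) (Matrix.of fun _ _ => -c) (Matrix.of fun _ _ => a)) hφ h ?_ ?_
    (ih _ _ h)
  · rintro (l | l)
    · simp only [Sum.elim_inl, map_smul, hv, Fintype.sum_sum_type, Sum.elim_inr,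
        Matrix.fromBlocks_apply₁₁, Matrix.fromBlocks_apply₂₁, Matrix.of_apply,
        Finset.univ_unique, Finset.sum_singleton]
      module
    · simp only [Sum.elim_inl, map_smul, hu, Fintype.sum_sum_type, Sum.elim_inr,
        Matrix.fromBlocks_apply₁₂, Matrix.fromBlocks_apply₂₂, Matrix.of_apply,
        Finset.univ_unique, Finset.sum_singleton]
      module
  · rw [Matrix.fromBlocks_transpose, Matrix.fromBlocks_multiply, ← Matrix.fromBlocks_one]
    congr 1 <;> ext i j <;> simp [Matrix.mul_apply] <;> linarith

universe u

/-- Induction on dimension, starting from a complex eigenvector v + √-1 u with eigenvalue a + √-1 c.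
A real eigenvalue gives an isotropic line; otherwise v and u span an invariant plane that is either
isotropic, with φ a similarity of ratio √(a² + c²), or symplectic, with φ a rotation. -/
theorem existsNormalForm_of_finrank (n : ℕ) : ∀ (V : Type u) [AddCommGroup V] [Module ℝ V]
    [FiniteDimensional ℝ V] (ω : LinearMap.BilinForm ℝ V) (φ : V →ₗ[ℝ] V),
    Module.finrank ℝ V = n → ω.IsAlt → ω.Nondegenerate → (∀ v w, ω (φ v) (φ w) = ω v w) →
    ExistsNormalForm ω φ := by
  induction n using Nat.strong_induction_on with
  | _ n ih =>
  intro V _ _ _ ω φ hn hω hnd hφ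
  have ih' : ∀ {κ : Type} [Fintype κ] [DecidableEq κ] [Nonempty κ] (x y : κ → V),
      IsSymplecticFamily ω x y → ∀ φ' : symplecticPerp ω x y →ₗ[ℝ] symplecticPerp ω x y,
        (∀ v w, ω.restrict (symplecticPerp ω x y) (φ' v) (φ' w) = ω.restrict _ v w) →
        ExistsNormalForm (ω.restrict (symplecticPerp ω x y)) φ' := fun x y h φ' h' =>
    ih _ (hn ▸ h.finrank_perp_lt) _ _ φ' rfl h.alt_restrict (h.nondegenerate_restrict hnd) h'
  rcases subsingleton_or_nontrivial V with hV | hV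
  · refine ⟨Empty, inferInstance, inferInstance, Module.Basis.empty V, Empty.elim, Empty.elim,
      ⟨hω, fun i => i.elim, fun i => i.elim, fun i => i.elim⟩, fun i => i.elim, fun f => ?_,
      ?_, ?_⟩
    · simp [eigenSum]
    · rintro (i | i) <;> exact i.elim
    · ext i
      rcases i with i | i <;> exact i.elim
  obtain ⟨a, c, v, u, h0, hv, hu⟩ := exists_complex_eigenvector φ
  by_cases hc : c = 0
  · obtain ⟨w, hw0, hw⟩ : ∃ w, w ≠ 0 ∧ φ w = a • w := by
      simp only [hc, zero_smul, sub_zero, zero_add] at hv hu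
      rcases h0 with h0 | h0
      exacts [⟨v, h0, hv⟩, ⟨u, h0, hu⟩]
    have ha : a ≠ 0 := by
      rintro rfl
      refine hw0 (hnd.1 w fun t => ?_)
      rw [← hφ, hw, zero_smul, map_zero, LinearMap.zero_apply]
    refine existsNormalForm_of_isotropic (x := fun _ : Unit => w) (A := Matrix.of fun _ _ => a)
      (s := |a|) hω hnd hφ ?_ (fun _ _ => hω w) (abs_pos.2 ha) (fun _ => by simp [hw]) ?_
      fun y h => ih' _ y h
    · exact linearIndependent_unique_iff.2 hw0
    · ext i j
      simp [Matrix.mul_apply, pow_two]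
  · have hli := linearIndependent_of_rotation hc h0 hv hu
    -- φ multiplies the area form of the plane by a² + c² and also preserves ω; so a plane that is
    -- not isotropic has |λ| = 1.
    have h1 : (a ^ 2 + c ^ 2) * ω v u = ω v u := by
      have h2 := hφ v u
      rw [hv, hu] at h2
      simp only [map_sub, map_add, map_smul, LinearMap.sub_apply, LinearMap.smul_apply,
        smul_eq_mul, hω.self_eq_zero, ← hω.neg_eq v u] at h2 ⊢
      linarith
    by_cases hvu : ω v u = 0
    · have hpos : 0 < a ^ 2 + c ^ 2 := by positivity
      refine existsNormalForm_of_isotropic (x := ![v, u]) (A := !![a, c; -c, a])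
        (s := √(a ^ 2 + c ^ 2)) hω hnd hφ hli ?_ (Real.sqrt_pos.2 hpos) ?_ ?_
        fun y h => ih' _ y h
      · intro i j
        have huv : ω u v = 0 := by rw [← hω.neg_eq, hvu, neg_zero]
        fin_cases i <;> fin_cases j <;> simp [hω.self_eq_zero, hvu, huv]
      · intro j
        fin_cases j
        · simp [Fin.sum_univ_two, hv, sub_eq_add_neg]
        · simp [Fin.sum_univ_two, hu]
      · rw [Real.sq_sqrt hpos.le]
        ext i j
        fin_cases i <;> fin_cases j <;> simp [Matrix.mul_apply, Fin.sum_univ_two] <;> ring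
    · have hac : a ^ 2 + c ^ 2 = 1 := mul_right_cancel₀ hvu (h1.trans (one_mul _).symm)
      rcases lt_or_gt_of_ne hvu with hneg | hpos
      -- Exchanging v and u reverses the sign of the area and replaces c by -c.
      · refine existsNormalForm_of_rotation (v := u) (u := v) (a := a) (c := -c) hω hφ
          (by rw [neg_sq, hac]) ?_ (by rw [hu]; module) (by rw [hv]; module) fun x y => ih' x y
        rw [← hω.neg_eq]
        exact neg_pos.2 hneg
      · exact existsNormalForm_of_rotation hω hφ hac hpos hv hu fun x y => ih' x y

end Existence

/-! ### Short curves from a normal form -/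

section ShortCurves

open Filter Topology

variable {p : ℕ}

theorem HasNormalForm.submatrix {ι κ : Type*} [Fintype ι] [DecidableEq ι] [Fintype κ]
    [DecidableEq κ] {M : Matrix (ι ⊕ ι) (ι ⊕ ι) ℝ} {r : ι → ℝ} {m : ι → ℤ}
    (h : HasNormalForm M r m) (e : κ ≃ ι) :
    HasNormalForm (M.submatrix (Equiv.sumCongr e e) (Equiv.sumCongr e e)) (r ∘ e) (m ∘ e) := by
  have hw : ∀ k, Sum.elim m (-m) (Equiv.sumCongr e e k) = Sum.elim (m ∘ e) (-(m ∘ e)) k := by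
    rintro (k | k) <;> rfl
  refine ⟨fun i => h.pos _, fun f => ?_, fun k l hkl => ?_, ?_⟩
  · rw [eigenSum_submatrix, h.eigenSum_eq, ← e.sum_comp]
    rfl
  · rw [← hw, ← hw] at hkl
    exact h.triangular _ _ hkl
  · have h1 : weightPart (Sum.elim (m ∘ e) (-(m ∘ e)))
        (M.submatrix (Equiv.sumCongr e e) (Equiv.sumCongr e e)) =
        (weightPart (Sum.elim m (-m)) M).submatrix (Equiv.sumCongr e e) (Equiv.sumCongr e e) := by
      ext k l
      simp only [weightPart, Matrix.of_apply, Matrix.submatrix_apply, hw]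
    rw [h1, Matrix.transpose_submatrix, Matrix.submatrix_mul_equiv, h.gram,
      Matrix.submatrix_diagonal_equiv]
    congr 1
    ext k
    rcases k with k | k <;> rfl

/-- Conjugation by the scaling `s ^ w` of a block triangular matrix tends to its block diagonal
part. -/
theorem tendsto_conj_zpow {n : Type*} [Fintype n] [DecidableEq n] {w : n → ℤ} {M : Matrix n n ℝ}
    (h : ∀ k l, w k < w l → M k l = 0) :
    Tendsto (fun s : ℝ => Matrix.diagonal (fun k => s ^ (-w k)) * M *
      Matrix.diagonal (fun k => s ^ w k)) atTop (𝓝 (weightPart w M)) := by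
  refine tendsto_pi_nhds.2 fun k => tendsto_pi_nhds.2 fun l => ?_
  have h1 : (fun s : ℝ => s ^ (w l - w k) * M k l) =ᶠ[atTop] fun s : ℝ =>
      (Matrix.diagonal (fun k => s ^ (-w k)) * M * Matrix.diagonal (fun k => s ^ w k)) k l := by
    filter_upwards [eventually_gt_atTop 0] with s hs
    rw [Matrix.mul_diagonal, Matrix.diagonal_mul, sub_eq_add_neg, zpow_add₀ hs.ne']
    ring
  refine Tendsto.congr' h1 ?_
  simp only [weightPart, Matrix.of_apply]
  rcases lt_trichotomy (w k) (w l) with hlt | heq | hgt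
  · simp [h k l hlt]
  · simp [heq]
  · rw [if_neg hgt.ne']
    simpa using (tendsto_zpow_atTop_zero (𝕜 := ℝ) (sub_neg.2 hgt)).mul_const (M k l)

theorem diagonal_symplectic {d : Fin p ⊕ Fin p → ℝ}
    (hd : ∀ i, d (Sum.inl i) * d (Sum.inr i) = 1) :
    (Matrix.diagonal d)ᵀ * stdForm p ℝ * Matrix.diagonal d = stdForm p ℝ := by
  ext k l
  rw [Matrix.diagonal_transpose, Matrix.mul_diagonal, Matrix.diagonal_mul]
  rcases k with i | i <;> rcases l with j | j
  · simp [stdForm]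
  · by_cases hij : i = j
    · subst hij
      simp [stdForm, hd]
    · simp [stdForm, hij]
  · by_cases hij : i = j
    · subst hij
      simp [stdForm, mul_comm, hd]
    · simp [stdForm, hij]
  · simp [stdForm]

/-- Multiplication of the rows and columns of a point of the upper half plane by `e^{-l}`. -/
def rescale (l : Fin p → ℝ) (W : Matrix (Fin p) (Fin p) ℂ) : Matrix (Fin p) (Fin p) ℂ :=
  Matrix.of fun i j => (Real.exp (-l i) : ℂ) * W i j * (Real.exp (-l j) : ℂ)

theorem rescale_mem (l : Fin p → ℝ) {W : Matrix (Fin p) (Fin p) ℂ} (hW : W ∈ upperHalfPlane p) :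
    rescale l W ∈ upperHalfPlane p := by
  constructor
  · ext i j
    have h1 : W j i = W i j := congrFun (congrFun hW.1 i) j
    simp only [rescale, Matrix.transpose_apply, Matrix.of_apply, h1]
    ring
  · let E : Matrix (Fin p) (Fin p) ℝ := Matrix.diagonal fun i => Real.exp (-l i)
    have h1 : (rescale l W).map Complex.im = E * W.map Complex.im * Eᴴ := by
      ext i j
      rw [Matrix.conjTranspose_eq_transpose_of_trivial, Matrix.diagonal_transpose,
        Matrix.mul_diagonal, Matrix.diagonal_mul]
      simp only [rescale, Matrix.map_apply, Matrix.of_apply, Complex.im_mul_ofReal,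
        Complex.im_ofReal_mul]
    have hE : IsUnit E := by
      rw [Matrix.isUnit_iff_isUnit_det, Matrix.det_diagonal, isUnit_iff_ne_zero]
      exact Finset.prod_ne_zero_iff.2 fun i _ => (Real.exp_pos _).ne'
    rw [h1]
    exact hW.2.mul_mul_conjTranspose_same (Matrix.vecMul_injective_of_isUnit hE)

theorem modelCurve_rescale (l : Fin p → ℝ) (W : Matrix (Fin p) (Fin p) ℂ) :
    modelCurve l (rescale l W) 1 = W := by
  ext i j
  have h : ∀ k, (Real.exp (l k) : ℂ) * Real.exp (-l k) = 1 := fun k => by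
    rw [← Complex.ofReal_mul, ← Real.exp_add, add_neg_cancel, Real.exp_zero, Complex.ofReal_one]
  simp only [modelCurve, rescale, Matrix.of_apply, Complex.ofReal_one, sub_self, zero_mul,
    zero_add, one_mul]
  calc _ = ((Real.exp (l i) : ℂ) * Real.exp (-l i)) * W i j *
        ((Real.exp (l j) : ℂ) * Real.exp (-l j)) := by ring
    _ = W i j := by rw [h, h, one_mul, mul_one]

theorem continuousAt_ofFormMatrix {S : Matrix (Fin p ⊕ Fin p) (Fin p ⊕ Fin p) ℝ}
    (hS : S.toBlocks₂₂.det ≠ 0) : ContinuousAt ofFormMatrix S := by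
  have h22 : Continuous fun S : Matrix (Fin p ⊕ Fin p) (Fin p ⊕ Fin p) ℝ => S.toBlocks₂₂ :=
    continuous_matrix fun i j => continuous_id.matrix_elem _ _
  have h12 : Continuous fun S : Matrix (Fin p ⊕ Fin p) (Fin p ⊕ Fin p) ℝ => S.toBlocks₁₂ :=
    continuous_matrix fun i j => continuous_id.matrix_elem _ _
  have hinv : ContinuousAt (fun S : Matrix (Fin p ⊕ Fin p) (Fin p ⊕ Fin p) ℝ => S.toBlocks₂₂⁻¹) S :=
    ContinuousAt.comp (continuousAt_matrix_inv hS) h22.continuousAt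
  have hmap : Continuous fun A : Matrix (Fin p) (Fin p) ℝ => A.map Complex.ofReal :=
    continuous_id.matrix_map Complex.continuous_ofReal
  exact (hmap.continuousAt.comp (h12.continuousAt.mul hinv)).add
    ((hmap.continuousAt.comp hinv).const_smul Complex.I)

/-- diag(r², r⁻²) belongs to the point √-1 r², which rescaling by log r brings back to √-1. It is
the limit of the conjugated form matrices. -/
theorem ofFormMatrix_diagonal {r : Fin p → ℝ} (hr : ∀ i, 0 < r i) :
    rescale (fun i => Real.log (r i))
      (ofFormMatrix (Matrix.diagonal (Sum.elim (fun i => r i ^ 2) fun i => (r i)⁻¹ ^ 2))) =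
      basePoint p := by
  have h22 : (Matrix.diagonal (Sum.elim (fun i => r i ^ 2)
      fun i => (r i)⁻¹ ^ 2)).toBlocks₂₂⁻¹ = Matrix.diagonal fun i => r i ^ 2 := by
    rw [← Matrix.fromBlocks_diagonal, Matrix.toBlocks_fromBlocks₂₂]
    refine Matrix.inv_eq_left_inv ?_
    rw [Matrix.diagonal_mul_diagonal, ← Matrix.diagonal_one]
    congr 1
    ext i
    rw [← mul_pow, mul_inv_cancel₀ (hr i).ne', one_pow]
  ext i j
  rw [rescale, ofFormMatrix, h22, ← Matrix.fromBlocks_diagonal, Matrix.toBlocks_fromBlocks₁₂,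
    zero_mul, basePoint]
  simp only [Real.exp_neg, Real.exp_log (hr _)]
  by_cases hij : i = j
  · subst hij
    have : (r i : ℂ) ≠ 0 := Complex.ofReal_ne_zero.2 (hr i).ne'
    simp
    field_simp
  · simp [hij]

/-- If `M` has a normal form, some symplectic conjugate of `M` moves the base point by little more
than `√(∑ (2 log r)²)`. -/
theorem HasNormalForm.exists_curve {M : Matrix (Fin p ⊕ Fin p) (Fin p ⊕ Fin p) ℝ}
    {r : Fin p → ℝ} {m : Fin p → ℤ} (h : HasNormalForm M r m)
    (hM : Mᵀ * stdForm p ℝ * M = stdForm p ℝ) {ε : ℝ} (hε : 0 < ε) :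
    ∃ D W γ, Dᵀ * stdForm p ℝ * D = stdForm p ℝ ∧ W ∈ upperHalfPlane p ∧
      D * formMatrix W * Dᵀ = M * (D * Dᵀ) * Mᵀ ∧ IsCurve γ (basePoint p) W ∧
      curveLength γ ≤ √(∑ i, (2 * Real.log (r i)) ^ 2) + ε := by
  set w : Fin p ⊕ Fin p → ℤ := Sum.elim m (-m) with hw
  let N : ℝ → Matrix (Fin p ⊕ Fin p) (Fin p ⊕ Fin p) ℝ := fun s =>
    Matrix.diagonal (fun k => s ^ (-w k)) * M * Matrix.diagonal (fun k => s ^ w k)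
  let l : Fin p → ℝ := fun i => Real.log (r i)
  have hS : Tendsto (fun s => N s * (N s)ᵀ) atTop
      (𝓝 (Matrix.diagonal (Sum.elim (fun i => r i ^ 2) fun i => (r i)⁻¹ ^ 2))) := by
    have h1 := tendsto_conj_zpow (w := w) h.triangular
    rw [← h.gram]
    exact h1.mul ((continuous_id.matrix_transpose.tendsto _).comp h1)
  have hresc : Continuous (rescale l) := by
    refine continuous_matrix fun i j => ?_
    exact (continuous_const.mul (continuous_id.matrix_elem i j)).mul continuous_const
  -- The image of the base point under N s, rescaled, tends to √-1. For large s it therefore lies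
  -- where the model curve, which ends at the unscaled image, is short.
  have hV : Tendsto (fun s => rescale l (ofFormMatrix (N s * (N s)ᵀ))) atTop (𝓝 (basePoint p)) := by
    rw [← ofFormMatrix_diagonal h.pos]
    refine (hresc.tendsto _).comp (Tendsto.comp (ContinuousAt.tendsto
      (continuousAt_ofFormMatrix ?_)) hS)
    rw [← Matrix.fromBlocks_diagonal, Matrix.toBlocks_fromBlocks₂₂, Matrix.det_diagonal]
    exact Finset.prod_ne_zero_iff.2 fun i _ => (pow_pos (inv_pos.2 (h.pos i)) 2).ne'
  obtain ⟨s, hs, hs0⟩ := ((hV.eventually (eventually_curveLength_modelCurve_le l hε)).and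
    (eventually_gt_atTop 0)).exists
  let D : Matrix (Fin p ⊕ Fin p) (Fin p ⊕ Fin p) ℝ := Matrix.diagonal fun k => s ^ w k
  have hD : Dᵀ * stdForm p ℝ * D = stdForm p ℝ := diagonal_symplectic fun i => by
    rw [← zpow_add₀ hs0.ne', hw, Sum.elim_inl, Sum.elim_inr, Pi.neg_apply, add_neg_cancel,
      zpow_zero]
  have hDN : D * N s = M * D := by
    have h1 : D * Matrix.diagonal (fun k => s ^ (-w k)) = 1 := by
      rw [Matrix.diagonal_mul_diagonal, ← Matrix.diagonal_one]
      congr 1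
      ext k
      rw [← zpow_add₀ hs0.ne', add_neg_cancel, zpow_zero]
    rw [← mul_assoc, ← mul_assoc, h1, one_mul]
  have hN : (N s)ᵀ * stdForm p ℝ * N s = stdForm p ℝ := by
    calc (N s)ᵀ * stdForm p ℝ * N s = (N s)ᵀ * (Dᵀ * stdForm p ℝ * D) * N s := by rw [hD]
      _ = (D * N s)ᵀ * stdForm p ℝ * (D * N s) := by
        rw [Matrix.transpose_mul D (N s)]; simp only [mul_assoc]
      _ = Dᵀ * (Mᵀ * stdForm p ℝ * M) * D := by
        rw [hDN, Matrix.transpose_mul]; simp only [mul_assoc]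
      _ = stdForm p ℝ := by rw [hM, hD]
  have hW := smulUpperHalfPlane_spec hN basePoint_mem
  have hSN : N s * formMatrix (basePoint p) * (N s)ᵀ = N s * (N s)ᵀ := by
    rw [formMatrix_basePoint, mul_one]
  rw [smulUpperHalfPlane, hSN] at hW
  have hmem := rescale_mem l hW.1
  have hcurve := isCurve_modelCurve l hmem
  rw [modelCurve_rescale] at hcurve
  refine ⟨D, _, _, hD, hW.1, ?_, hcurve, hs hmem⟩
  rw [hW.2]
  calc D * (N s * (N s)ᵀ) * Dᵀ = (D * N s) * (D * N s)ᵀ := by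
        rw [Matrix.transpose_mul D (N s)]; simp only [mul_assoc]
    _ = M * (D * Dᵀ) * Mᵀ := by
        rw [hDN, Matrix.transpose_mul]; simp only [mul_assoc]

end ShortCurves

/-! ### The translation length -/

section TranslationLength

variable {V : Type*} [AddCommGroup V] [Module ℝ V] {ω : LinearMap.BilinForm ℝ V} {p : ℕ}

/-- The short curve starts at the base point in coordinates adapted to `b₀`. The product of the base
change P with the scaling D is symplectic and transports it isometrically to `b`, where it joins a
point to its image under φ. -/
theorem exists_curveLength_le (b b₀ : SymplecticBasis ω p) (φ : Sp ω) {r : Fin p → ℝ}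
    {m : Fin p → ℤ} (h : HasNormalForm (b₀.toMatrix φ) r m) {ε : ℝ} (hε : 0 < ε) :
    ∃ H Z₁ Z₂ γ, Z₁ ∈ upperHalfPlane p ∧ Z₂ ∈ upperHalfPlane p ∧ Corresponds b Z₁ H ∧
      Corresponds b Z₂ (act φ H) ∧ IsCurve γ Z₁ Z₂ ∧
      curveLength γ ≤ √(∑ i, (2 * Real.log (r i)) ^ 2) + ε := by
  obtain ⟨D, W, γ, hD, hW, hDW, hγ, hlen⟩ := h.exists_curve (b₀.toMatrix_symplectic φ) hε
  let P := b.basis.toMatrix b₀.basis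
  have hP : Pᵀ * stdForm p ℝ * P = stdForm p ℝ := by
    rw [← b.toMatrix_form, LinearMap.BilinForm.toMatrix_mul_basis_toMatrix, b.toMatrix_form,
      b₀.toMatrix_form]
  have hφP : b.toMatrix φ * P = P * b₀.toMatrix φ := by
    simp only [SymplecticBasis.toMatrix, P]
    rw [linearMap_toMatrix_mul_basis_toMatrix, basis_toMatrix_mul_linearMap_toMatrix]
  have hPD : (P * D)ᵀ * stdForm p ℝ * (P * D) = stdForm p ℝ := by
    calc (P * D)ᵀ * stdForm p ℝ * (P * D) = Dᵀ * (Pᵀ * stdForm p ℝ * P) * D := by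
          rw [Matrix.transpose_mul]; simp only [mul_assoc]
      _ = stdForm p ℝ := by rw [hP, hD]
  have hZ₁ := smulUpperHalfPlane_spec hPD basePoint_mem
  have hZ₂ := smulUpperHalfPlane_spec hPD hW
  refine ⟨hodgeStructure b hZ₁.1, _, _, _, hZ₁.1, hZ₂.1, corresponds_hodgeStructure b hZ₁.1,
    corresponds_act hZ₁.1 hZ₂.1 (corresponds_hodgeStructure b hZ₁.1) ?_, hγ.smul hPD,
    (curveLength_smul hPD hγ).trans_le hlen⟩
  rw [hZ₁.2, hZ₂.2, formMatrix_basePoint, mul_one]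
  calc P * D * formMatrix W * (P * D)ᵀ = P * (D * formMatrix W * Dᵀ) * Pᵀ := by
        rw [Matrix.transpose_mul]; simp only [mul_assoc]
    _ = (P * b₀.toMatrix φ) * (D * Dᵀ) * (P * b₀.toMatrix φ)ᵀ := by
        rw [hDW, Matrix.transpose_mul P]; simp only [mul_assoc]
    _ = b.toMatrix φ * (P * D * (P * D)ᵀ) * (b.toMatrix φ)ᵀ := by
        rw [← hφP, Matrix.transpose_mul, Matrix.transpose_mul]; simp only [mul_assoc]

theorem translationLength_le (b : SymplecticBasis ω p) (φ : Sp ω) {c : ℝ}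
    (h : ∀ ε > 0, ∃ H Z₁ Z₂ γ, Z₁ ∈ upperHalfPlane p ∧ Z₂ ∈ upperHalfPlane p ∧
      Corresponds b Z₁ H ∧ Corresponds b Z₂ (act φ H) ∧ IsCurve γ Z₁ Z₂ ∧
      curveLength γ ≤ c + ε) : translationLength b φ ≤ ENNReal.ofReal c := by
  refine ENNReal.le_of_forall_pos_le_add fun ε hε _ => ?_
  obtain ⟨H, Z₁, Z₂, γ, hZ₁, hZ₂, h₁, h₂, hγ, hlen⟩ := h ε hε
  calc translationLength b φ ≤ siegelDist b H (act φ H) := iInf_le _ H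
    _ ≤ upperHalfPlaneDist Z₁ Z₂ := iInf_le_of_le Z₁ <| iInf_le_of_le hZ₁ <| iInf_le_of_le Z₂ <|
        iInf_le_of_le hZ₂ <| iInf_le_of_le h₁ <| iInf_le _ h₂
    _ ≤ ENNReal.ofReal (curveLength γ) := iInf_le_of_le γ <| iInf_le _ hγ
    _ ≤ ENNReal.ofReal (c + ε) := ENNReal.ofReal_le_ofReal hlen
    _ ≤ ENNReal.ofReal c + ENNReal.ofReal ε := ENNReal.ofReal_add_le
    _ = ENNReal.ofReal c + ε := by rw [ENNReal.ofReal_coe_nnreal]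

theorem le_translationLength (b : SymplecticBasis ω p) (φ : Sp ω) {c : ℝ}
    (h : √(eigenSum (b.toMatrix φ) fun x => (2 * Real.log x) ^ 2) = √2 * c) :
    ENNReal.ofReal c ≤ translationLength b φ := by
  refine le_iInf fun H => le_iInf fun Z₁ => le_iInf fun hZ₁ => le_iInf fun Z₂ => le_iInf fun hZ₂ =>
    le_iInf fun h₁ => le_iInf fun h₂ => le_iInf fun γ => le_iInf fun hγ =>
    ENNReal.ofReal_le_ofReal ?_
  have h3 := sqrt_sum_log_sq_le_curveLength hγ (isUnit_of_symplectic (b.toMatrix_symplectic φ))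
    (formMatrix_eq_of_corresponds_act hZ₁ hZ₂ h₁ h₂)
  exact le_of_mul_le_mul_left (h.symm.trans_le h3) (Real.sqrt_pos.2 two_pos)

/-- There is a symplectic basis in which `φ` has a normal form. -/
theorem exists_symplecticBasis [FiniteDimensional ℝ V] (hω : ω.IsAlt) (hnd : ω.Nondegenerate)
    (φ : Sp ω) : ∃ (p : ℕ) (b : SymplecticBasis ω p) (r : Fin p → ℝ) (m : Fin p → ℤ),
      HasNormalForm (b.toMatrix φ) r m := by
  obtain ⟨ι, _, _, b, r, m, hb, hn⟩ :=
    existsNormalForm_of_finrank _ V ω (φ.1 : V →ₗ[ℝ] V) rfl hω hnd φ.2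
  let e := (Fintype.equivFin ι).symm
  refine ⟨Fintype.card ι, ⟨b.reindex (Equiv.sumCongr e e).symm, fun i j => ?_, fun i j => ?_,
    fun i j => ?_, fun i j => ?_⟩, r ∘ e, m ∘ e, ?_⟩
  · simpa using hb.inl_inl (e i) (e j)
  · simpa using hb.inr_inr (e i) (e j)
  · simpa using hb.inl_inr (e i) (e j)
  · simpa using hb.inr_inl (e i) (e j)
  · convert hn.submatrix e using 1
    ext k l
    simp [SymplecticBasis.toMatrix, LinearMap.toMatrix_apply]

theorem eigenSum_toMatrix [FiniteDimensional ℝ V] (b : SymplecticBasis ω p) (φ : Sp ω)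
    (f : ℝ → ℝ) : eigenSum (b.toMatrix φ) f =
      (((LinearMap.charpoly (φ.1 : V →ₗ[ℝ] V)).map (algebraMap ℝ ℂ)).roots.map fun l =>
        f ‖l‖).sum := by
  have h := Matrix.charpoly_map (b.toMatrix φ) (algebraMap ℝ ℂ)
  rw [SymplecticBasis.toMatrix, LinearMap.charpoly_toMatrix] at h
  rw [← h]
  rfl

/-- Of r and r⁻¹ only the one above 1 contributes, so each reciprocal pair counts once in the Jensen
sum. -/
theorem log_max_one_sq_add {r : ℝ} (hr : 0 < r) :
    Real.log (max 1 r) ^ 2 + Real.log (max 1 r⁻¹) ^ 2 = Real.log r ^ 2 := by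
  rcases le_total 1 r with h | h
  · rw [max_eq_right h, max_eq_left (inv_le_one_of_one_le₀ h), Real.log_one]
    ring
  · rw [max_eq_left h, max_eq_right ((one_le_inv₀ hr).2 h), Real.log_one, Real.log_inv]
    ring

theorem translationLength_eq [FiniteDimensional ℝ V] (b b₀ : SymplecticBasis ω p) (φ : Sp ω)
    {r : Fin p → ℝ} {m : Fin p → ℤ} (h : HasNormalForm (b₀.toMatrix φ) r m) :
    translationLength b φ = ENNReal.ofReal (2 * √(jensenSquareSum
      ((LinearMap.charpoly (φ.1 : V →ₗ[ℝ] V)).map (algebraMap ℝ ℂ)))) := by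
  have hw : jensenSquareSum ((LinearMap.charpoly (φ.1 : V →ₗ[ℝ] V)).map (algebraMap ℝ ℂ)) =
      ∑ i, Real.log (r i) ^ 2 := by
    have h1 := h.eigenSum_eq fun x => Real.log (max 1 x) ^ 2
    rw [eigenSum_toMatrix] at h1
    exact h1.trans (Finset.sum_congr rfl fun i _ => log_max_one_sq_add (h.pos i))
  have h2 : ∑ i, (2 * Real.log (r i)) ^ 2 = 2 ^ 2 * ∑ i, Real.log (r i) ^ 2 := by
    simp only [mul_pow, Finset.mul_sum]
  have h3 : √(∑ i, (2 * Real.log (r i)) ^ 2) = 2 * √(∑ i, Real.log (r i) ^ 2) := by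
    rw [h2, Real.sqrt_mul (by positivity), Real.sqrt_sq zero_le_two]
  rw [hw]
  refine le_antisymm (translationLength_le b φ fun ε hε => ?_) (le_translationLength b φ ?_)
  · rw [← h3]
    exact exists_curveLength_le b b₀ φ h hε
  -- The eigenvalue sum does not depend on the basis. The squares for r and r⁻¹ coincide, and the
  -- resulting factor 2 is the √2 expected by `le_translationLength`.
  · rw [(eigenSum_toMatrix b φ _).trans (eigenSum_toMatrix b₀ φ _).symm, h.eigenSum_eq]
    simp only [Real.log_inv, mul_neg, neg_sq, ← two_mul]
    rw [← Finset.mul_sum, Real.sqrt_mul zero_le_two, h3]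

theorem SymplecticBasis.finrank_eq (b : SymplecticBasis ω p) : Module.finrank ℝ V = p + p := by
  rw [Module.finrank_eq_card_basis b.basis, Fintype.card_sum, Fintype.card_fin]

end TranslationLength

end SiegelSpace

end

theorem theorem3p1 {V : Type*} [AddCommGroup V] [Module ℝ V] [FiniteDimensional ℝ V]
    (ω : LinearMap.BilinForm ℝ V) (hω_alt : ω.IsAlt) (hω_nondeg : ω.Nondegenerate)
    (φ : SiegelSpace.Sp ω) :
    (∃ p : ℕ, Nonempty (SiegelSpace.SymplecticBasis ω p)) ∧
    ∀ (p : ℕ) (b : SiegelSpace.SymplecticBasis ω p),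
      SiegelSpace.translationLength b φ =
        ENNReal.ofReal (2 * Real.sqrt (SiegelSpace.jensenSquareSum
          ((LinearMap.charpoly (φ.1 : V →ₗ[ℝ] V)).map (algebraMap ℝ ℂ)))) := by
  obtain ⟨p₀, b₀, r, m, h⟩ := SiegelSpace.exists_symplecticBasis hω_alt hω_nondeg φ
  refine ⟨⟨p₀, ⟨b₀⟩⟩, fun p b => ?_⟩
  -- Both bases have 2p = dim V elements, so the adapted basis has the same p as the given one.
  obtain rfl : p₀ = p := by
    have h1 := b.finrank_eq
    have h2 := b₀.finrank_eq
    omega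
  exact SiegelSpace.translationLength_eq b b₀ φ h
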